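/- Let $G$ be the group of orientation-preserving affine transformations of $\mathbb{R}$, and $\mathfrak{g}$ its Lie algebra, identified with the space of vector fields $(aw+b)\partial_w$ on $\mathbb{R}$; let $\mathfrak{g}_{\geq} = \mathbb{R}^{\geq 0}\,\partial_w$ be the subset of everywhere nonnegative vector fields. For $A \in \Omega^1(S,\mathfrak{g})$, the connection $d-A$ has curvature $F_A = -dA + \frac12[A,A]$, where $[\cdot,\cdot]$ is the matrix commutator on $\mathfrak{g}$, so that $F_A = (d-A)^2$. Let $\mathcal{A}([0,1])$ be the set of smooth $A \in \Omega^1([0,1],\mathfrak{g})$ whose parallel transport $g \in G$ over $[0,1]$ satisfies $g(0) > 0$. Let $\bar{S}$ be the closed unit disc with its standard orientation (as an oriented smooth surface), let $\Sigma = \Sigma_- \sqcup \Sigma_+ \subset \partial\bar{S}$ be a finite nonempty set of boundary points, and let $S = \bar{S}\setminus\Sigma$. Suppose that for each $\zeta \in \Sigma$ we are given an end, meaning a proper smooth orientation-preserving embedding $$\epsilon_\zeta: (-\infty,\sigma_\zeta]\times[0,1] \to S \;\; (\zeta \in \Sigma_-), \qquad \epsilon_\zeta: [\sigma_\zeta,\infty)\times[0,1]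 \to S \;\; (\zeta \in \Sigma_+),$$ with $\epsilon_\zeta^{-1}(\partial S) = \{t = 0\} \cup \{t = 1\}$, such that $\epsilon_\zeta(s,t) \to \zeta$ as $s \to -\infty$ respectively $s \to +\infty$; and suppose that the images of the different $\epsilon_\zeta$ are pairwise disjoint. Let $\mathcal{A}_{\geq}(S)$ be the space of all smooth $A \in \Omega^1(S,\mathfrak{g})$ such that: (i) for each $\zeta$, $\epsilon_\zeta^*A$ is the pullback, by the projection $(s,t) \mapsto t$, of some $A_\zeta \in \mathcal{A}([0,1])$; (ii) parallel transport for $A|\partial S$ preserves $0 \in \mathbb{R}$; (iii) $A$ is nonnegatively curved: $F_A(X,Y) \in \mathfrak{g}_{\geq}$ for every point of $S$ and every oriented basis $(X,Y)$ of the tangent space there. Equip $\mathcal{A}_{\geq}(S)$ with the $C^\infty$ topology (uniform convergence of all derivatives on compact subsets of $S$). Then $\mathcal{A}_{\geq}(S)$ is empty if $\Sigma_- = \emptyset$, and it is weakly contractible (nonempty, with trivial $\pi_n$ for all $n \geq 0$) if $\Sigma_- \neq \emptyset$. -/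

import Mathlib

open Set Filter Topology
open scoped ContDiff

noncomputable section

/-! ### The affine group and its Lie algebra -/

/-- The group `G` of orientation-preserving affine transformations of the real line. -/
def AffGroup : Subgroup (ℝ ≃ᵃ[ℝ] ℝ) where
  carrier := {g | 0 < g.linear (1 : ℝ)}
  one_mem' := by
    change (0 : ℝ) < (1 : ℝ)
    exact one_pos
  mul_mem' := by
    intro g h hg hh
    change (0 : ℝ) < g.linear (h.linear 1)
    have e : g.linear (h.linear 1) = h.linear 1 * g.linear 1 := by
      conv_lhs => rw [← mul_one (h.linear 1), ← smul_eq_mul, map_smul, smul_eq_mul]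
    rw [e]
    exact mul_pos hh hg
  inv_mem' := by
    intro g hg
    change (0 : ℝ) < g.linear.symm 1
    have e : g.linear.symm 1 * g.linear 1 = 1 := by
      rw [← smul_eq_mul, ← map_smul, smul_eq_mul, mul_one, LinearEquiv.apply_symm_apply]
    have h : 0 < g.linear.symm 1 * g.linear 1 := by rw [e]; exact one_pos
    exact pos_of_mul_pos_left h (le_of_lt hg)

/-- The Lie algebra `𝔤` of `G`: the pair `(a, b)` is the vector field `(a w + b) ∂_w` on the real
line. -/
abbrev AffLie : Type := ℝ × ℝ

/-- The value at `w` of the vector field `(a w + b) ∂_w`. -/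
def AffLie.eval (X : AffLie) (w : ℝ) : ℝ := X.1 * w + X.2

/-- The bracket of the Lie algebra of `G`, i.e. the commutator `X Y - Y X` of the matrices
`!![a, b; 0, 0]` (the opposite of the bracket of vector fields on the line).  With this bracket
`-dA + ½[A, A]` is the curvature `(d - A)²` of the connection `d - A`. -/
def AffLie.bracket (X Y : AffLie) : AffLie := (0, X.1 * Y.2 - Y.1 * X.2)

/-- The nonnegative part of `𝔤`: vector fields which are nonnegative on the whole real line. -/
def AffLie.nonneg : Set AffLie := {X | ∀ w : ℝ, 0 ≤ X.eval w}

/-- `g ∈ G` is the parallel transport over `[0, 1]` of the connection `d - a_t dt`: it is the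
time-one value of the path `Φ` in `G` which starts at the identity and satisfies
`dΦ_t/dt = a_t Φ_t`, meaning that `t ↦ Φ_t(w)` is an integral curve of the time-dependent vector
field `a_t`, for each `w`. -/
def IsParallelTransport (a : ℝ → AffLie) (g : AffGroup) : Prop :=
  ∃ Φ : ℝ → AffGroup, Φ 0 = 1 ∧ Φ 1 = g ∧
    ∀ t ∈ Icc (0 : ℝ) 1, ∀ w : ℝ,
      HasDerivWithinAt (fun τ => (Φ τ : ℝ ≃ᵃ[ℝ] ℝ) w)
        ((a t).eval ((Φ t : ℝ ≃ᵃ[ℝ] ℝ) w)) (Icc 0 1) t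

/-- The space `𝒜([0, 1])`: smooth one-forms `a_t dt` on `[0, 1]` with values in `𝔤` (only the values
of `a` on `[0, 1]` matter), whose parallel transport `g` over `[0, 1]` satisfies `g(0) > 0`. -/
def IsIntervalConnection (a : ℝ → AffLie) : Prop :=
  ContDiffOn ℝ ∞ a (Icc 0 1) ∧
    ∃ g : AffGroup, IsParallelTransport a g ∧ 0 < (g : ℝ ≃ᵃ[ℝ] ℝ) 0

/-! ### Surfaces and ends -/

/-- A pair of tangent vectors of the plane is a positively oriented basis. -/
def IsOrientedBasis (X Y : ℂ) : Prop := 0 < X.re * Y.im - X.im * Y.re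

/-- A punctured disc: the closed unit disc together with a finite nonempty set of boundary points,
divided into negative and positive ones. -/
structure PuncturedDisc where
  neg : Finset ℂ
  pos : Finset ℂ
  neg_disjoint_pos : Disjoint neg pos
  neg_boundary : ∀ ζ ∈ neg, ‖ζ‖ = 1
  pos_boundary : ∀ ζ ∈ pos, ‖ζ‖ = 1
  exists_puncture : neg.Nonempty ∨ pos.Nonempty

namespace PuncturedDisc

/-- The set of all punctures. -/
def punctures (S : PuncturedDisc) : Set ℂ := {ζ | ζ ∈ S.neg ∨ ζ ∈ S.pos}

/-- The surface: the closed disc minus the punctures. -/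
def surface (S : PuncturedDisc) : Set ℂ := Metric.closedBall 0 1 \ S.punctures

/-- The boundary of the surface: the unit circle minus the punctures. -/
def boundary (S : PuncturedDisc) : Set ℂ := Metric.sphere 0 1 \ S.punctures

/-- Extension by zero of a function on the surface to the plane.  Smoothness and derivatives are
taken within the surface, so that the values elsewhere do not matter. -/
def extend (S : PuncturedDisc) {F : Type*} [Zero F] (f : S.surface → F) (z : ℂ) : F :=
  open Classical in if h : z ∈ S.surface then f ⟨z, h⟩ else 0

/-- `ε : I × [0, 1] → S` is an end at `ζ`, where `I` is a half-line going to infinity along the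
filter `l`: a proper smooth embedding, compatible with orientations, sending exactly the two sides
`t = 0, 1` to the boundary, such that `ε(s, t)` converges to `ζ` as `s → ±∞`. -/
structure IsEnd (S : PuncturedDisc) (I : Set ℝ) (l : Filter ℝ) (ζ : ℂ) (ε : ℝ × ℝ → ℂ) :
    Prop where
  mapsTo : MapsTo ε (I ×ˢ Icc 0 1) S.surface
  smooth : ContDiffOn ℝ ∞ ε (I ×ˢ Icc 0 1)
  injOn : InjOn ε (I ×ˢ Icc 0 1)
  oriented : ∀ p ∈ I ×ˢ Icc (0 : ℝ) 1,
    IsOrientedBasis (fderivWithin ℝ ε (I ×ˢ Icc 0 1) p (1, 0))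
      (fderivWithin ℝ ε (I ×ˢ Icc 0 1) p (0, 1))
  proper : ∀ K ⊆ S.surface, IsCompact K → IsCompact ((I ×ˢ Icc (0 : ℝ) 1) ∩ ε ⁻¹' K)
  boundary_iff : ∀ p ∈ I ×ˢ Icc (0 : ℝ) 1, ε p ∈ S.boundary ↔ p.2 = 0 ∨ p.2 = 1
  tendsto : ∀ t ∈ Icc (0 : ℝ) 1, Tendsto (fun s => ε (s, t)) l (𝓝 ζ)

open Classical in
/-- The half-line over which the end at `ζ` is parametrized: `(-∞, σ]` for negative `ζ`, and `[σ, ∞)`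
for positive `ζ`. -/
def halfLine (S : PuncturedDisc) (ζ : ℂ) (σ : ℝ) : Set ℝ :=
  if ζ ∈ S.neg then Iic σ else Ici σ

open Classical in
/-- The direction in which the end at `ζ` goes to infinity: `s → -∞` for negative `ζ`, and `s → +∞`
for positive `ζ`. -/
def direction (S : PuncturedDisc) (ζ : ℂ) : Filter ℝ :=
  if ζ ∈ S.neg then atBot else atTop

/-- A choice of ends for `S`, one for each puncture, with pairwise disjoint images. -/
structure Ends (S : PuncturedDisc) where
  σ : S.punctures → ℝ
  ε : S.punctures → ℝ × ℝ → ℂ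
  isEnd : ∀ ζ : S.punctures, S.IsEnd (S.halfLine ζ (σ ζ)) (S.direction ζ) ζ (ε ζ)
  disjoint : ∀ ζ ζ' : S.punctures, ζ ≠ ζ' →
    Disjoint (ε ζ '' (S.halfLine ζ (σ ζ) ×ˢ Icc 0 1)) (ε ζ' '' (S.halfLine ζ' (σ ζ') ×ˢ Icc 0 1))

/-! ### Connections -/

/-- Connections on the trivial `G`-bundle over `S`: smooth one-forms on `S` with values in `𝔤`. -/
structure Connection (S : PuncturedDisc) where
  form : S.surface → ℂ →L[ℝ] AffLie
  smooth : ContDiffOn ℝ ∞ (S.extend form) S.surface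

/-- The `C^∞` topology on the space of connections: uniform convergence of all derivatives on compact
subsets of `S`. -/
instance (S : PuncturedDisc) : TopologicalSpace S.Connection :=
  ⨅ j : ℕ, TopologicalSpace.induced
    (fun A : S.Connection => UniformOnFun.ofFun {K : Set S.surface | IsCompact K}
      (fun z : S.surface => iteratedFDerivWithin ℝ j (S.extend A.form) S.surface (z : ℂ)))
    inferInstance

namespace Connection

variable {S : PuncturedDisc}

/-- The curvature `F_A = -dA + ½[A, A]`, evaluated at `z` on a pair of tangent vectors; here
`dA(X, Y) = (D_X A)(Y) - (D_Y A)(X)`, and `½[A, A](X, Y) = [A(X), A(Y)]`. -/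
def curvature (A : S.Connection) (z : S.surface) (X Y : ℂ) : AffLie :=
  -(fderivWithin ℝ (S.extend A.form) S.surface z X Y
      - fderivWithin ℝ (S.extend A.form) S.surface z Y X)
    + AffLie.bracket (A.form z X) (A.form z Y)

/-- `A` is nonnegatively curved everywhere. -/
def NonnegCurved (A : S.Connection) : Prop :=
  ∀ (z : S.surface) (X Y : ℂ), IsOrientedBasis X Y → A.curvature z X Y ∈ AffLie.nonneg

/-- The pullback `c^*A = a_t dt` of `A` by a path `c : [0, 1] → S`, as a function `t ↦ a_t`. -/
def pullbackPath (A : S.Connection) (c : ℝ → ℂ) (t : ℝ) : AffLie :=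
  S.extend A.form (c t) (derivWithin c (Icc 0 1) t)

/-- Parallel transport for `A` along any smooth path in `∂S` preserves `0 ∈ ℝ`. -/
def PreservesZeroOnBoundary (A : S.Connection) : Prop :=
  ∀ c : ℝ → ℂ, ContDiffOn ℝ ∞ c (Icc 0 1) → MapsTo c (Icc 0 1) S.boundary →
    ∃ g : AffGroup, IsParallelTransport (A.pullbackPath c) g ∧ (g : ℝ ≃ᵃ[ℝ] ℝ) 0 = 0

/-- On the domain `U` of an end `ε`, the pullback `ε^*A` is the pullback, under the projection
`(s, t) ↦ t`, of some `a_t dt ∈ 𝒜([0, 1])`. -/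
def IsPullbackOnEnd (A : S.Connection) (U : Set (ℝ × ℝ)) (ε : ℝ × ℝ → ℂ) : Prop :=
  ∃ a : ℝ → AffLie, IsIntervalConnection a ∧
    ∀ p ∈ U, ∀ v : ℝ × ℝ, S.extend A.form (ε p) (fderivWithin ℝ ε U p v) = v.2 • a p.2

end Connection

/-- The space `𝒜_≥(S)` (with the subspace topology of the `C^∞` topology). -/
def Ends.connections {S : PuncturedDisc} (E : S.Ends) : Set S.Connection :=
  {A | (∀ ζ : S.punctures, A.IsPullbackOnEnd (S.halfLine ζ (E.σ ζ) ×ˢ Icc 0 1) (E.ε ζ)) ∧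
    A.PreservesZeroOnBoundary ∧ A.NonnegCurved}

end PuncturedDisc

/-- A topological space is weakly contractible if it is nonempty, and all its homotopy groups
(including the set `π_0` of path components) are trivial. -/
def WeaklyContractible (X : Type*) [TopologicalSpace X] : Prop :=
  Nonempty X ∧ ∀ (n : ℕ) (x : X), Subsingleton (HomotopyGroup.Pi n X x)

end

/-!
A nonnegative affine vector field on the line is constant. Writing a connection as `A = (α, β)`, with
`α` the linear part and `β` the translation part, nonnegative curvature therefore means that `dα = 0`
and `-dβ + α ∧ β ≥ 0`. The surface is convex, so `α = dh` with `h 0 = 0`, and if `β = exp h • γ`, the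
second condition becomes `dγ ≤ 0` (`PuncturedDisc.curvature_eq`). In terms of the potential `h` and
the profile `γ`, the other conditions separate as well (`PuncturedDisc.Ends.mem_connections_iff`): on
each end, `h` depends only on `t`, and `γ = c(t) dt` with `∫ c > 0`; and `γ` vanishes on vectors tangent
to the boundary. The conditions on `h` are linear and those on `γ` are convex, so that straight lines in
the variables `(h, γ)` contract the space of connections to any of its points, leaving that point fixed.
Hence the space is weakly contractible as soon as it is nonempty, which means as soon as there is a
profile (`PuncturedDisc.Ends.weaklyContractible_connections`,
`PuncturedDisc.Ends.nonempty_connections_iff`).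

If all ends are positive, there is no profile (`PuncturedDisc.Ends.not_isProfile`): the integral of `γ`
over the boundary of the truncated surface, which consists of the integrals across the ends, would be
positive, contradicting `dγ ≤ 0` by Stokes' theorem. Since the truncated surface has corners, Stokes'
theorem is applied in the form of an integration by parts against cutoff functions.

If there is a negative end, a profile is a sum of forms of two kinds
(`PuncturedDisc.Ends.exists_isProfile`). For a negative end there is the form `g(s) c(t) dt`, where
`g = 1` on the end and `g` decreases to zero just past it; this has the right sign of `dγ` exactly
because the end is negative (`isWeakProfile_sinkForm`). For a positive end there is the differential of
a function which is constant along the two boundary arcs between that end and a fixed negative one, and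
depends only on `t` on all ends (`exists_isWeakProfile_of_pos`). Both constructions need the ends to be
extended smoothly past their edge `s = 0`. As smoothness at the edge is one-sided, this is done by
Borel's lemma (`exists_contDiff_eqOn_leftHalf`).
-/

noncomputable section

/-! ### Contractions fixing the base point -/

/-- If `X` can be contracted to each of its points by a homotopy which leaves that point fixed, then
every loop, of any dimension, is homotopic to the constant one relative to its boundary. -/
theorem weaklyContractible_of_contractions {X : Type*} [TopologicalSpace X] (hne : Nonempty X)
    (H : ∀ x : X, ∃ F : unitInterval × X → X, Continuous F ∧ (∀ y, F (0, y) = y) ∧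
      (∀ y, F (1, y) = x) ∧ ∀ τ, F (τ, x) = x) :
    WeaklyContractible X := by
  refine ⟨hne, fun n x => ?_⟩
  obtain ⟨F, hF, h0, h1, hx⟩ := H x
  have key : ∀ f : GenLoop (Fin n) X x, GenLoop.Homotopic f GenLoop.const := fun f =>
    ⟨{ toFun := fun p => F (p.1, f p.2)
       continuous_toFun := hF.comp (continuous_fst.prodMk (f.1.continuous.comp continuous_snd))
       map_zero_left := fun y => h0 _
       map_one_left := fun y => h1 _
       prop' := fun τ y hy => by
        change F (τ, f y) = f y
        rw [show f y = x from f.2 y hy, hx] }⟩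
  constructor
  intro a b
  induction a using Quotient.inductionOn
  induction b using Quotient.inductionOn
  exact Quotient.sound ((key _).trans (key _).symm)

/-! ### Families of functions depending continuously on a parameter with all derivatives -/

/-- A family `f x` of functions on `s` such that its derivatives of order up to `n` in `z ∈ s` exist, and
are jointly continuous in `(x, z)`.  The definition is recursive in `n`, which makes the calculus rules
below easy to prove by induction; continuity of a map into the space of connections amounts to this
condition for all `n`. -/
def JointC {X : Type*} [TopologicalSpace X] (s : Set ℂ) :
    ℕ → ∀ {F : Type} [NormedAddCommGroup F] [NormedSpace ℝ F], (X → ℂ → F) → Prop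
  | 0, _, _, _, f => Continuous fun p : X × s => f p.1 p.2
  | n + 1, _, _, _, f => (Continuous fun p : X × s => f p.1 p.2) ∧
      (∀ x, DifferentiableOn ℝ (f x) s) ∧ JointC s n fun x => fderivWithin ℝ (f x) s

namespace JointC

variable {X Y : Type*} [TopologicalSpace X] [TopologicalSpace Y] {s : Set ℂ} {n : ℕ}
  {F G H : Type} [NormedAddCommGroup F] [NormedSpace ℝ F] [NormedAddCommGroup G] [NormedSpace ℝ G]
  [NormedAddCommGroup H] [NormedSpace ℝ H]

theorem continuous {f : X → ℂ → F} (hf : JointC s n f) :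
    Continuous fun p : X × s => f p.1 p.2 := by
  cases n with
  | zero => exact hf
  | succ n => exact hf.1

theorem of_succ {f : X → ℂ → F} (hf : JointC s (n + 1) f) : JointC s n f := by
  induction n generalizing F with
  | zero => exact hf.1
  | succ n ih => exact ⟨hf.1, hf.2.1, ih hf.2.2⟩

theorem congr {f g : X → ℂ → F} (hf : JointC s n f) (h : ∀ x, EqOn (g x) (f x) s) :
    JointC s n g := by
  induction n generalizing F with
  | zero => exact Continuous.congr hf fun p => (h p.1 p.2.2).symm
  | succ n ih =>
    exact ⟨hf.1.congr fun p => (h p.1 p.2.2).symm, fun x => (hf.2.1 x).congr (h x),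
      ih hf.2.2 fun x z hz => fderivWithin_congr (h x) (h x hz)⟩

theorem comp_param {f : X → ℂ → F} (hf : JointC s n f) {φ : Y → X} (hφ : Continuous φ) :
    JointC s n fun y => f (φ y) := by
  induction n generalizing F with
  | zero => exact Continuous.comp hf ((hφ.comp continuous_fst).prodMk continuous_snd)
  | succ n ih =>
    exact ⟨hf.1.comp ((hφ.comp continuous_fst).prodMk continuous_snd), fun y => hf.2.1 (φ y),
      ih hf.2.2⟩

theorem of_param {k : X → F} (hk : Continuous k) : JointC s n fun x (_ : ℂ) => k x := by
  induction n generalizing F with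
  | zero => exact hk.comp continuous_fst
  | succ n ih =>
    refine ⟨hk.comp continuous_fst, fun x => differentiableOn_const _, ?_⟩
    refine (ih (k := fun _ : X => (0 : ℂ →L[ℝ] F)) continuous_const).congr fun x z _ => ?_
    simp

theorem of_contDiffOn (hs : UniqueDiffOn ℝ s) {f : ℂ → F} (hf : ContDiffOn ℝ ∞ f s) :
    JointC s n fun _ : X => f := by
  induction n generalizing F with
  | zero => exact (continuousOn_iff_continuous_domRestrict.1 hf.continuousOn).comp continuous_snd
  | succ n ih =>
    exact ⟨(continuousOn_iff_continuous_domRestrict.1 hf.continuousOn).comp continuous_snd,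
      fun _ => hf.differentiableOn (by simp), ih (hf.fderivWithin hs (by simp))⟩

theorem add (hs : UniqueDiffOn ℝ s) {f g : X → ℂ → F} (hf : JointC s n f) (hg : JointC s n g) :
    JointC s n fun x z => f x z + g x z := by
  induction n generalizing F with
  | zero => exact Continuous.add hf hg
  | succ n ih =>
    refine ⟨hf.1.add hg.1, fun x => (hf.2.1 x).add (hg.2.1 x), (ih hf.2.2 hg.2.2).congr ?_⟩
    intro x z hz
    exact fderivWithin_fun_add (hs z hz) (hf.2.1 x z hz) (hg.2.1 x z hz)

theorem clm (hs : UniqueDiffOn ℝ s) {f : X → ℂ → F} (hf : JointC s n f) (L : F →L[ℝ] G) :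
    JointC s n fun x z => L (f x z) := by
  induction n generalizing F G with
  | zero => exact L.continuous.comp hf
  | succ n ih =>
    refine ⟨L.continuous.comp hf.1, fun x => L.differentiable.comp_differentiableOn (hf.2.1 x),
      (ih hf.2.2 (ContinuousLinearMap.compL ℝ ℂ F G L)).congr ?_⟩
    intro x z hz
    exact (L.hasFDerivAt.comp_hasFDerivWithinAt z (hf.2.1 x z hz).hasFDerivWithinAt).fderivWithin
      (hs z hz)

theorem bilin (hs : UniqueDiffOn ℝ s) {f : X → ℂ → F} {g : X → ℂ → G} (hf : JointC s n f)
    (hg : JointC s n g) (B : F →L[ℝ] G →L[ℝ] H) : JointC s n fun x z => B (f x z) (g x z) := by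
  induction n generalizing F G H with
  | zero => exact B.continuous₂.comp (Continuous.prodMk hf hg)
  | succ n ih =>
    refine ⟨B.continuous₂.comp (hf.1.prodMk hg.1), fun x => fun z hz =>
      (B.hasFDerivWithinAt_of_bilinear (hf.2.1 x z hz).hasFDerivWithinAt
        (hg.2.1 x z hz).hasFDerivWithinAt).differentiableWithinAt,
      ((ih hf.of_succ hg.2.2 (B.precompR ℂ)).add hs
        (ih hf.2.2 hg.of_succ (B.precompL ℂ))).congr ?_⟩
    intro x z hz
    exact (B.hasFDerivWithinAt_of_bilinear (hf.2.1 x z hz).hasFDerivWithinAt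
        (hg.2.1 x z hz).hasFDerivWithinAt).fderivWithin (hs z hz)

theorem smul (hs : UniqueDiffOn ℝ s) {f : X → ℂ → ℝ} {g : X → ℂ → G} (hf : JointC s n f)
    (hg : JointC s n g) : JointC s n fun x z => f x z • g x z :=
  hf.bilin hs hg (ContinuousLinearMap.lsmul ℝ ℝ)

theorem exp (hs : UniqueDiffOn ℝ s) {f : X → ℂ → ℝ} (hf : JointC s n f) :
    JointC s n fun x z => Real.exp (f x z) := by
  induction n with
  | zero => exact Real.continuous_exp.comp hf
  | succ n ih =>
    refine ⟨Real.continuous_exp.comp hf.1, fun x => (hf.2.1 x).exp,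
      ((ih hf.of_succ).smul hs hf.2.2).congr ?_⟩
    intro x z hz
    exact fderivWithin_exp (hf.2.1 x z hz) (hs z hz)

theorem of_continuous_iteratedFDerivWithin (hs : UniqueDiffOn ℝ s) {f : X → ℂ → F}
    (hf : ∀ x, ContDiffOn ℝ ∞ (f x) s)
    (hc : ∀ j, Continuous fun p : X × s => iteratedFDerivWithin ℝ j (f p.1) s p.2) :
    JointC s n f := by
  have h0 : ∀ {F : Type} [NormedAddCommGroup F] [NormedSpace ℝ F] {f : X → ℂ → F},
      (Continuous fun p : X × s => iteratedFDerivWithin ℝ 0 (f p.1) s p.2) →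
      Continuous fun p : X × s => f p.1 p.2 := by
    intro F _ _ f h
    have := (continuousMultilinearCurryFin0 ℝ ℂ F).continuous.comp h
    refine this.congr fun p => ?_
    simp [iteratedFDerivWithin_zero_eq_comp]
  induction n generalizing F with
  | zero => exact h0 (hc 0)
  | succ n ih =>
    refine ⟨h0 (hc 0), fun x => (hf x).differentiableOn (by simp),
      ih (fun x => (hf x).fderivWithin hs (by simp)) fun j => ?_⟩
    have := (continuousMultilinearCurryRightEquiv' ℝ j ℂ F).continuous.comp (hc (j + 1))
    refine this.congr fun p => ?_
    simp [iteratedFDerivWithin_succ_eq_comp_right hs p.2.2]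

theorem continuous_iteratedFDerivWithin (hs : UniqueDiffOn ℝ s) {f : X → ℂ → F}
    (hf : JointC s n f) :
    Continuous fun p : X × s => iteratedFDerivWithin ℝ n (f p.1) s p.2 := by
  induction n generalizing F with
  | zero =>
    have := (continuousMultilinearCurryFin0 ℝ ℂ F).symm.continuous.comp hf.continuous
    refine this.congr fun p => ?_
    simp [iteratedFDerivWithin_zero_eq_comp]
  | succ n ih =>
    have := (continuousMultilinearCurryRightEquiv' ℝ n ℂ F).symm.continuous.comp (ih hf.2.2)
    refine this.congr fun p => ?_
    simp [iteratedFDerivWithin_succ_eq_comp_right hs p.2.2]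

end JointC

/-! ### The punctured disc -/

namespace PuncturedDisc

variable (S : PuncturedDisc)

theorem finite_punctures : S.punctures.Finite :=
  (S.neg.finite_toSet.union S.pos.finite_toSet).subset fun _ h => h

variable {S}

theorem norm_of_mem_punctures {ζ : ℂ} (h : ζ ∈ S.punctures) : ‖ζ‖ = 1 :=
  h.elim (S.neg_boundary ζ) (S.pos_boundary ζ)

variable (S)

theorem ball_subset_surface : Metric.ball (0 : ℂ) 1 ⊆ S.surface := fun z hz =>
  ⟨Metric.ball_subset_closedBall hz, fun h => by
    rw [mem_ball_zero_iff, norm_of_mem_punctures h] at hz; exact lt_irrefl _ hz⟩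

theorem zero_mem_surface : (0 : ℂ) ∈ S.surface :=
  S.ball_subset_surface (Metric.mem_ball_self one_pos)

theorem convex_surface : Convex ℝ S.surface := by
  rw [convex_iff_pairwise_pos]
  intro x hx y hy hxy a b ha hb hab
  refine S.ball_subset_surface ?_
  have := (strictConvex_closedBall ℝ (0 : ℂ) 1) hx.1 hy.1 hxy ha hb hab
  rwa [interior_closedBall _ one_ne_zero] at this

theorem interior_surface_nonempty : (interior S.surface).Nonempty :=
  ⟨0, mem_interior.2 ⟨_, S.ball_subset_surface, Metric.isOpen_ball, Metric.mem_ball_self one_pos⟩⟩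

theorem uniqueDiffOn_surface : UniqueDiffOn ℝ S.surface :=
  uniqueDiffOn_convex S.convex_surface S.interior_surface_nonempty

theorem surface_mem_nhds {z : ℂ} (hz : ‖z‖ < 1) : S.surface ∈ 𝓝 z :=
  mem_of_superset (Metric.isOpen_ball.mem_nhds (by simpa using hz)) S.ball_subset_surface

instance : LocallyCompactSpace S.surface := by
  have : IsLocallyClosed S.surface :=
    Metric.isClosed_closedBall.isLocallyClosed.inter S.finite_punctures.isClosed.isOpen_compl.isLocallyClosed
  exact IsLocallyClosed.locallyCompactSpace this

variable {S}

theorem extend_apply {F : Type*} [Zero F] (f : S.surface → F) {z : ℂ} (hz : z ∈ S.surface) :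
    S.extend f z = f ⟨z, hz⟩ := by
  simp [extend, hz]

@[simp]
theorem extend_coe {F : Type*} [Zero F] (f : S.surface → F) (z : S.surface) :
    S.extend f z = f z := extend_apply f z.2

/-- On the locally compact surface, uniform convergence on compact subsets is the compact-open
topology, and continuity can be tested on the product with the surface. -/
theorem continuous_connection_iff {Y : Type*} [TopologicalSpace Y] {Φ : Y → S.Connection} :
    Continuous Φ ↔ ∀ j : ℕ, Continuous fun p : Y × S.surface =>
      iteratedFDerivWithin ℝ j (S.extend (Φ p.1).form) S.surface (p.2 : ℂ) := by
  refine continuous_iInf_rng.trans (forall_congr' fun j => ?_)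
  rw [continuous_induced_rng]
  have hc : ∀ y, Continuous fun z : S.surface =>
      iteratedFDerivWithin ℝ j (S.extend (Φ y).form) S.surface (z : ℂ) := fun y =>
    continuousOn_iff_continuous_domRestrict.1
      ((Φ y).smooth.continuousOn_iteratedFDerivWithin (by exact_mod_cast le_top)
        S.uniqueDiffOn_surface)
  let Ψ : Y → C(S.surface, ContinuousMultilinearMap ℝ (fun _ : Fin j => ℂ) (ℂ →L[ℝ] AffLie)) :=
    fun y => ⟨_, hc y⟩
  have : Continuous Ψ ↔ Continuous ((fun A : S.Connection => UniformOnFun.ofFun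
      {K : Set S.surface | IsCompact K} (fun z : S.surface =>
        iteratedFDerivWithin ℝ j (S.extend A.form) S.surface (z : ℂ))) ∘ Φ) :=
    (ContinuousMap.isUniformEmbedding_toUniformOnFunIsCompact (α := S.surface)
      (β := ContinuousMultilinearMap ℝ (fun _ : Fin j => ℂ) (ℂ →L[ℝ] AffLie))).isInducing.continuous_iff
      (f := Ψ)
  rw [← this]
  constructor
  · intro h
    exact (h.comp continuous_fst).eval continuous_snd
  · intro h
    exact ContinuousMap.continuous_of_continuous_uncurry _ h

theorem continuous_connection_of_jointC {Y : Type*} [TopologicalSpace Y] {Φ : Y → S.Connection}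
    (h : ∀ n, JointC S.surface n fun y => S.extend (Φ y).form) : Continuous Φ :=
  continuous_connection_iff.2 fun j => (h j).continuous_iteratedFDerivWithin S.uniqueDiffOn_surface

theorem jointC_form {n : ℕ} : JointC S.surface n fun A : S.Connection => S.extend A.form :=
  JointC.of_continuous_iteratedFDerivWithin S.uniqueDiffOn_surface (fun A => A.smooth)
    (continuous_connection_iff.1 continuous_id)

end PuncturedDisc

/-! ### Parallel transport on the affine group -/

/-- The affine transformation `w ↦ m w + b`. -/
def affMk (m b : ℝ) (hm : 0 < m) : AffGroup :=
  ⟨{ toFun := fun w => m * w + b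
     invFun := fun w => m⁻¹ * (w - b)
     left_inv := fun w => by field_simp; ring
     right_inv := fun w => by field_simp; ring
     linear := LinearEquiv.smulOfNeZero ℝ ℝ m hm.ne'
     map_vadd' := fun p v => by simp; ring }, by
    change 0 < m • (1 : ℝ)
    simpa using hm⟩

@[simp]
theorem affMk_apply (m b : ℝ) (hm : 0 < m) (w : ℝ) :
    (affMk m b hm : ℝ ≃ᵃ[ℝ] ℝ) w = m * w + b := rfl

/-- Variation of constants: if `P' = a.1`, then the image of `0` under parallel transport is
`exp (P 1)` times the integral of `exp (-P) * a.2`. -/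
theorem exp_neg_mul_parallelTransport_zero {a : ℝ → AffLie} {g : AffGroup} {P : ℝ → ℝ}
    (hg : IsParallelTransport a g)
    (hP : ∀ t ∈ Icc (0 : ℝ) 1, HasDerivWithinAt P (a t).1 (Icc 0 1) t)
    (hc : ContinuousOn (fun t => Real.exp (-P t) * (a t).2) (Icc 0 1)) :
    Real.exp (-P 1) * (g : ℝ ≃ᵃ[ℝ] ℝ) 0 = ∫ t in (0 : ℝ)..1, Real.exp (-P t) * (a t).2 := by
  obtain ⟨Φ, h0, h1, hΦ⟩ := hg
  have hd : ∀ t ∈ Icc (0 : ℝ) 1, HasDerivWithinAt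
      (fun t => Real.exp (-P t) * (Φ t : ℝ ≃ᵃ[ℝ] ℝ) 0) (Real.exp (-P t) * (a t).2)
      (Icc 0 1) t := by
    intro t ht
    convert! (hP t ht).fun_neg.exp.mul (hΦ t ht 0) using 1
    simp only [AffLie.eval]
    ring
  rw [intervalIntegral.integral_eq_sub_of_hasDerivAt_of_le zero_le_one
    (fun t ht => (hd t ht).continuousWithinAt)
    (fun t ht => (hd t (Ioo_subset_Icc_self ht)).hasDerivAt (Icc_mem_nhds ht.1 ht.2))
    (hc.intervalIntegrable_of_Icc zero_le_one)]
  simp [h0, h1]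

/-- Parallel transport in terms of primitives `P` of `a.1` and `Q` of `exp (-P) * a.2`. -/
theorem exists_parallelTransport {a : ℝ → AffLie} {P Q : ℝ → ℝ}
    (hP : ∀ t ∈ Icc (0 : ℝ) 1, HasDerivWithinAt P (a t).1 (Icc 0 1) t)
    (hQ : ∀ t ∈ Icc (0 : ℝ) 1,
      HasDerivWithinAt Q (Real.exp (-P t) * (a t).2) (Icc 0 1) t) :
    ∃ g : AffGroup, IsParallelTransport a g ∧
      (g : ℝ ≃ᵃ[ℝ] ℝ) 0 = Real.exp (P 1) * (Q 1 - Q 0) := by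
  let Φ : ℝ → AffGroup := fun t =>
    affMk (Real.exp (P t - P 0)) (Real.exp (P t) * (Q t - Q 0)) (Real.exp_pos _)
  refine ⟨Φ 1, ⟨Φ, ?_, rfl, fun t ht w => ?_⟩, by simp [Φ]⟩
  · ext w
    change Real.exp (P 0 - P 0) * w + Real.exp (P 0) * (Q 0 - Q 0) = w
    simp
  · convert! (((hP t ht).sub_const (P 0)).exp.mul_const w).add
      ((hP t ht).exp.mul ((hQ t ht).sub_const (Q 0))) using 1
    simp only [AffLie.eval, Φ, affMk_apply, Real.exp_neg]
    field_simp
    ring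

/-! ### Gauge potentials and profiles -/

theorem mem_nonneg_iff (X : AffLie) : X ∈ AffLie.nonneg ↔ X.1 = 0 ∧ 0 ≤ X.2 := by
  constructor
  · intro h
    have h' : ∀ w : ℝ, 0 ≤ X.1 * w + X.2 := h
    have h0 : 0 ≤ X.2 := by simpa using h' 0
    refine ⟨?_, h0⟩
    by_contra hne
    have := h' (-(X.2 + 1) / X.1)
    rw [mul_div_cancel₀ _ hne] at this
    linarith
  · rintro ⟨h1, h2⟩ w
    simpa [AffLie.eval, h1] using h2

theorem antisymm_bilin_eq (D : ℂ →L[ℝ] ℂ →L[ℝ] ℝ) (X Y : ℂ) :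
    D X Y - D Y X =
      (X.re * Y.im - X.im * Y.re) * (D 1 Complex.I - D Complex.I 1) := by
  have e : ∀ Z : ℂ, Z = Z.re • (1 : ℂ) + Z.im • Complex.I := fun Z => by
    simp [Complex.re_add_im]
  rw [e X, e Y]
  simp only [map_add, map_smul, add_apply, smul_apply, smul_eq_mul]
  simp
  ring

namespace PuncturedDisc

variable {S : PuncturedDisc}

theorem boundary_subset_surface : S.boundary ⊆ S.surface :=
  sdiff_subset_sdiff_left Metric.sphere_subset_closedBall

/-- The domain of the end at `ζ`. -/
abbrev Ends.dom (E : S.Ends) (ζ : S.punctures) : Set (ℝ × ℝ) :=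
  S.halfLine ζ (E.σ ζ) ×ˢ Icc 0 1

/-- A function on the surface whose restriction to each end only depends on `t`. -/
structure Ends.IsGauge (E : S.Ends) (h : ℂ → ℝ) : Prop where
  smooth : ContDiffOn ℝ ∞ h S.surface
  const : ∀ ζ s s' t, (s, t) ∈ E.dom ζ → (s', t) ∈ E.dom ζ →
    h (E.ε ζ (s, t)) = h (E.ε ζ (s', t))

/-- A real one-form `γ` on the surface which vanishes on vectors tangent to the boundary, satisfies
`dγ ≤ 0`, and equals `c(t) dt` with `∫ c > 0` on each end.  These forms make up a convex set. -/
structure Ends.IsProfile (E : S.Ends) (γ : ℂ → ℂ →L[ℝ] ℝ) : Prop where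
  smooth : ContDiffOn ℝ ∞ γ S.surface
  tangential : ∀ z ∈ S.boundary, γ z (Complex.I * z) = 0
  curl_nonpos : ∀ z ∈ S.surface, fderivWithin ℝ γ S.surface z 1 Complex.I
    - fderivWithin ℝ γ S.surface z Complex.I 1 ≤ 0
  ends : ∀ ζ, ∃ c : ℝ → ℝ, ContDiffOn ℝ ∞ c (Icc 0 1) ∧ 0 < ∫ t in (0 : ℝ)..1, c t ∧
    ∀ p ∈ E.dom ζ, ∀ v : ℝ × ℝ,
      γ (E.ε ζ p) (fderivWithin ℝ (E.ε ζ) (E.dom ζ) p v) = v.2 * c p.2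

/-- The connection one-form obtained from the one-form `γ`, regarded as taking values in the
translations, by the gauge transformation which rescales the line by `exp h`. -/
def gaugeForm (S : PuncturedDisc) (h : ℂ → ℝ) (γ : ℂ → ℂ →L[ℝ] ℝ) (z : ℂ) : ℂ →L[ℝ] AffLie :=
  (ContinuousLinearMap.inl ℝ ℝ ℝ).comp (fderivWithin ℝ h S.surface z) +
    Real.exp (h z) • (ContinuousLinearMap.inr ℝ ℝ ℝ).comp (γ z)

@[simp]
theorem gaugeForm_apply (h : ℂ → ℝ) (γ : ℂ → ℂ →L[ℝ] ℝ) (z v : ℂ) :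
    S.gaugeForm h γ z v = (fderivWithin ℝ h S.surface z v, Real.exp (h z) * γ z v) := by
  simp [gaugeForm]

theorem contDiff_comp_left {F G : Type*} [NormedAddCommGroup F] [NormedSpace ℝ F]
    [NormedAddCommGroup G] [NormedSpace ℝ G] (L : F →L[ℝ] G) {s : Set ℂ} {f : ℂ → ℂ →L[ℝ] F}
    (hf : ContDiffOn ℝ ∞ f s) : ContDiffOn ℝ ∞ (fun z => L.comp (f z)) s :=
  (ContinuousLinearMap.compL ℝ ℂ F G L).contDiff.comp_contDiffOn hf

theorem contDiffOn_gaugeForm {h : ℂ → ℝ} {γ : ℂ → ℂ →L[ℝ] ℝ} (hh : ContDiffOn ℝ ∞ h S.surface)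
    (hγ : ContDiffOn ℝ ∞ γ S.surface) : ContDiffOn ℝ ∞ (S.gaugeForm h γ) S.surface :=
  (contDiff_comp_left _ (hh.fderivWithin S.uniqueDiffOn_surface (by simp))).add
    (hh.exp.smul (contDiff_comp_left _ hγ))

theorem halfLine_convex (ζ : ℂ) (σ : ℝ) : Convex ℝ (S.halfLine ζ σ) := by
  unfold halfLine
  split_ifs
  exacts [convex_Iic _, convex_Ici _]

theorem mem_halfLine (ζ : ℂ) (σ : ℝ) : σ ∈ S.halfLine ζ σ := by
  unfold halfLine
  split_ifs <;> simp

theorem uniqueDiffOn_halfLine (ζ : ℂ) (σ : ℝ) : UniqueDiffOn ℝ (S.halfLine ζ σ) := by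
  unfold halfLine
  split_ifs
  exacts [uniqueDiffOn_Iic _, uniqueDiffOn_Ici _]

theorem Ends.uniqueDiffOn_dom (E : S.Ends) (ζ : S.punctures) : UniqueDiffOn ℝ (E.dom ζ) :=
  (uniqueDiffOn_halfLine _ _).prod (uniqueDiffOn_Icc zero_lt_one)

theorem surface_subset_closure_interior : S.surface ⊆ closure (interior S.surface) := by
  rw [S.convex_surface.closure_interior_eq_closure_of_nonempty_interior
    S.interior_surface_nonempty]
  exact subset_closure

theorem two_le_infty : (2 : WithTop ℕ∞) ≤ ∞ :=
  WithTop.coe_le_coe.2 (le_top : (2 : ℕ∞) ≤ ⊤)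

/-- The second component of the curvature is `-exp h` times `dγ`, and the first one vanishes. -/
theorem curvature_eq {A : S.Connection} {h : ℂ → ℝ} {γ : ℂ → ℂ →L[ℝ] ℝ}
    (hA : EqOn (S.extend A.form) (S.gaugeForm h γ) S.surface)
    (hh : ContDiffOn ℝ ∞ h S.surface) (hγ : ContDiffOn ℝ ∞ γ S.surface)
    (z : S.surface) (X Y : ℂ) :
    A.curvature z X Y = (0, -Real.exp (h z) * (fderivWithin ℝ γ S.surface z X Y
      - fderivWithin ℝ γ S.surface z Y X)) := by
  have hz := z.2
  have hU := S.uniqueDiffOn_surface z hz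
  have hdh := (hh.fderivWithin S.uniqueDiffOn_surface (m := ∞) (by simp)).differentiableOn
    (by simp) z hz
  have hd := hh.differentiableOn (by simp) z hz
  have hdγ := hγ.differentiableOn (by simp) z hz
  have hd2 : HasFDerivWithinAt (S.gaugeForm h γ) _ S.surface z :=
    ((ContinuousLinearMap.compL ℝ ℂ ℝ AffLie
      (ContinuousLinearMap.inl ℝ ℝ ℝ)).hasFDerivAt.comp_hasFDerivWithinAt (z : ℂ)
        hdh.hasFDerivWithinAt).add
    (hd.hasFDerivWithinAt.exp.smul ((ContinuousLinearMap.compL ℝ ℂ ℝ AffLie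
      (ContinuousLinearMap.inr ℝ ℝ ℝ)).hasFDerivAt.comp_hasFDerivWithinAt (z : ℂ)
        hdγ.hasFDerivWithinAt))
  have hsymm : IsSymmSndFDerivWithinAt ℝ h S.surface (z : ℂ) :=
    (hh z hz).isSymmSndFDerivWithinAt (by simpa using two_le_infty) S.uniqueDiffOn_surface
      (surface_subset_closure_interior hz) hz
  have hfz : A.form z = S.gaugeForm h γ z := by rw [← hA hz, extend_coe]
  have e : ∀ X Y : ℂ, fderivWithin ℝ (S.extend A.form) S.surface z X Y =
      (fderivWithin ℝ (fderivWithin ℝ h S.surface) S.surface z X Y,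
        Real.exp (h z) * fderivWithin ℝ γ S.surface z X Y +
        Real.exp (h z) * fderivWithin ℝ h S.surface z X * γ z Y) := by
    intro X Y
    rw [fderivWithin_congr hA (hA hz), hd2.fderivWithin hU]
    simp
  unfold Connection.curvature
  rw [e, e, hfz, hsymm.eq X Y]
  ext
  · simp [AffLie.bracket]
  · simp [AffLie.bracket, gaugeForm]
    ring

/-- Nonnegativity of the curvature forces the first component of the connection form to be closed,
hence exact, because the surface is convex. -/
theorem exists_potential {A : S.Connection} (hA : A.NonnegCurved) :
    ∀ z ∈ S.surface, HasFDerivWithinAt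
      (fun z => ∫ r in (0 : ℝ)..1, (S.extend A.form (r • z) z).1)
      ((ContinuousLinearMap.fst ℝ ℝ ℝ).comp (S.extend A.form z)) S.surface z := by
  let L := ContinuousLinearMap.compL ℝ ℂ AffLie ℝ (ContinuousLinearMap.fst ℝ ℝ ℝ)
  let α : ℂ → ℂ →L[ℝ] ℝ := fun z => L (S.extend A.form z)
  have hα : ∀ z ∈ S.surface, HasFDerivWithinAt α
      (L.comp (fderivWithin ℝ (S.extend A.form) S.surface z)) S.surface z := fun z hz =>
    L.hasFDerivAt.comp_hasFDerivWithinAt z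
      (A.smooth.differentiableOn (by simp) z hz).hasFDerivWithinAt
  have hcl : ∀ z ∈ S.surface, ∀ X Y : ℂ,
      L.comp (fderivWithin ℝ (S.extend A.form) S.surface z) X Y =
      L.comp (fderivWithin ℝ (S.extend A.form) S.surface z) Y X := by
    intro z hz X Y
    have h1 := ((mem_nonneg_iff _).1 (hA ⟨z, hz⟩ 1 Complex.I (by simp [IsOrientedBasis]))).1
    have h2 := antisymm_bilin_eq (L.comp (fderivWithin ℝ (S.extend A.form) S.surface z)) X Y
    have h3 : L.comp (fderivWithin ℝ (S.extend A.form) S.surface z) 1 Complex.I -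
        L.comp (fderivWithin ℝ (S.extend A.form) S.surface z) Complex.I 1 = 0 := by
      simp [Connection.curvature, AffLie.bracket] at h1
      simp [L]
      linarith
    rw [h3, mul_zero, sub_eq_zero] at h2
    exact h2
  intro z hz
  have := S.convex_surface.hasFDerivWithinAt_curveIntegral_segment_of_hasFDerivWithinAt_symmetric
    hα (fun z hz X _ Y _ => hcl z hz X Y) S.zero_mem_surface hz
  simpa [curveIntegral_segment, AffineMap.lineMap_apply, α, L] using this

end PuncturedDisc

/-! ### Connections in terms of potentials and profiles -/

namespace PuncturedDisc

variable {S : PuncturedDisc}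

/-- The primitive, vanishing at the origin, of the first component of the connection form. -/
def Connection.potential (A : S.Connection) (z : ℂ) : ℝ :=
  ∫ r in (0 : ℝ)..1, (S.extend A.form (r • z) z).1

/-- The second component of the connection form in the gauge in which the first one vanishes. -/
def Connection.profile (A : S.Connection) (z : ℂ) : ℂ →L[ℝ] ℝ :=
  Real.exp (-A.potential z) • (ContinuousLinearMap.snd ℝ ℝ ℝ).comp (S.extend A.form z)

theorem contDiffOn_potential {A : S.Connection} (hA : A.NonnegCurved) :
    ContDiffOn ℝ ∞ A.potential S.surface := by
  have h := exists_potential hA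
  rw [contDiffOn_infty_iff_fderivWithin S.uniqueDiffOn_surface]
  exact ⟨fun z hz => (h z hz).differentiableWithinAt,
    (contDiff_comp_left (ContinuousLinearMap.fst ℝ ℝ ℝ) A.smooth).congr fun z hz =>
      (h z hz).fderivWithin (S.uniqueDiffOn_surface z hz)⟩

theorem contDiffOn_profile {A : S.Connection} (hA : A.NonnegCurved) :
    ContDiffOn ℝ ∞ A.profile S.surface :=
  (contDiffOn_potential hA).neg.exp.smul (contDiff_comp_left _ A.smooth)

theorem eqOn_gaugeForm {A : S.Connection} (hA : A.NonnegCurved) :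
    EqOn (S.extend A.form) (S.gaugeForm A.potential A.profile) S.surface := by
  intro z hz
  ext1 v
  have h1 : fderivWithin ℝ A.potential S.surface z =
      (ContinuousLinearMap.fst ℝ ℝ ℝ).comp (S.extend A.form z) :=
    (exists_potential hA z hz).fderivWithin (S.uniqueDiffOn_surface z hz)
  rw [gaugeForm_apply, h1]
  simp [Connection.profile, ← mul_assoc, ← Real.exp_add]

theorem nonnegCurved_iff {A : S.Connection} {h : ℂ → ℝ} {γ : ℂ → ℂ →L[ℝ] ℝ}
    (hA : EqOn (S.extend A.form) (S.gaugeForm h γ) S.surface)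
    (hh : ContDiffOn ℝ ∞ h S.surface) (hγ : ContDiffOn ℝ ∞ γ S.surface) :
    A.NonnegCurved ↔ ∀ z ∈ S.surface, fderivWithin ℝ γ S.surface z 1 Complex.I
      - fderivWithin ℝ γ S.surface z Complex.I 1 ≤ 0 := by
  simp only [Connection.NonnegCurved, curvature_eq hA hh hγ, mem_nonneg_iff, true_and]
  constructor
  · intro H z hz
    have := H ⟨z, hz⟩ 1 Complex.I (by simp [IsOrientedBasis])
    nlinarith [Real.exp_pos (h z)]
  · intro H z X Y hXY
    rw [antisymm_bilin_eq, neg_mul, neg_nonneg]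
    exact mul_nonpos_of_nonneg_of_nonpos (Real.exp_pos _).le
      (mul_nonpos_of_nonneg_of_nonpos (le_of_lt hXY) (H z z.2))

theorem hasDerivWithinAt_comp_path {h : ℂ → ℝ} (hh : ContDiffOn ℝ ∞ h S.surface) {c : ℝ → ℂ}
    (hc : ContDiffOn ℝ ∞ c (Icc 0 1)) (hm : MapsTo c (Icc 0 1) S.surface) {t : ℝ}
    (ht : t ∈ Icc (0 : ℝ) 1) :
    HasDerivWithinAt (h ∘ c) (fderivWithin ℝ h S.surface (c t) (derivWithin c (Icc 0 1) t))
      (Icc 0 1) t :=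
  (hh.differentiableOn (by simp) _ (hm ht)).hasFDerivWithinAt.comp_hasDerivWithinAt t
    (hc.differentiableOn (by simp) t ht).hasDerivWithinAt hm

theorem tangent_eq {c : ℝ → ℂ} (hc : DifferentiableOn ℝ c (Icc 0 1))
    (hm : MapsTo c (Icc 0 1) S.boundary) {t : ℝ} (ht : t ∈ Icc (0 : ℝ) 1) :
    ∃ l : ℝ, derivWithin c (Icc 0 1) t = l • (Complex.I * c t) := by
  have hd := (hc t ht).hasDerivWithinAt
  set c' := derivWithin c (Icc 0 1) t
  have hn : ∀ u ∈ Icc (0 : ℝ) 1, ‖c u‖ ^ 2 = 1 := fun u hu => by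
    have := (hm hu).1
    rw [mem_sphere_zero_iff_norm] at this
    simp [this]
  have h1 : HasDerivWithinAt (fun u => ‖c u‖ ^ 2) (2 * inner ℝ (c t) c') (Icc 0 1) t := hd.norm_sq
  have h2 : HasDerivWithinAt (fun u => ‖c u‖ ^ 2) 0 (Icc 0 1) t :=
    (hasDerivWithinAt_const t _ (1 : ℝ)).congr hn (hn t ht)
  have h3 := (uniqueDiffOn_Icc zero_lt_one t ht).eq_deriv _ h1 h2
  rw [Complex.inner] at h3
  have h5 : (c t).re ^ 2 + (c t).im ^ 2 = 1 := by
    have := hn t ht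
    rw [Complex.sq_norm, Complex.normSq_apply] at this
    linarith
  refine ⟨(c t).re * c'.im - (c t).im * c'.re, ?_⟩
  simp at h3
  have h4 : (c t).re * c'.re + (c t).im * c'.im = 0 := by linarith
  apply Complex.ext
  · simp
    linear_combination (-c'.re) * h5 + (c t).re * h4
  · simp
    linear_combination (-c'.im) * h5 + (c t).im * h4

theorem preservesZeroOnBoundary_of_tangential {A : S.Connection} {h : ℂ → ℝ}
    {γ : ℂ → ℂ →L[ℝ] ℝ} (hA : EqOn (S.extend A.form) (S.gaugeForm h γ) S.surface)
    (hh : ContDiffOn ℝ ∞ h S.surface)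
    (htan : ∀ z ∈ S.boundary, γ z (Complex.I * z) = 0) : A.PreservesZeroOnBoundary := by
  intro c hc hm
  have hm' : MapsTo c (Icc 0 1) S.surface := hm.mono_right boundary_subset_surface
  have e : ∀ t ∈ Icc (0 : ℝ) 1, A.pullbackPath c t =
      (fderivWithin ℝ h S.surface (c t) (derivWithin c (Icc 0 1) t), 0) := by
    intro t ht
    obtain ⟨l, hl⟩ := tangent_eq (hc.differentiableOn (by simp)) hm ht
    rw [Connection.pullbackPath, hA (hm' ht), gaugeForm_apply]
    nth_rw 2 [hl]
    rw [map_smul, htan _ (hm ht)]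
    simp
  obtain ⟨g, hg, hg0⟩ := exists_parallelTransport (a := A.pullbackPath c) (P := h ∘ c)
    (Q := fun _ => 0)
    (fun t ht => by rw [e t ht]; exact hasDerivWithinAt_comp_path hh hc hm' ht)
    (fun t ht => by rw [e t ht, mul_zero]; exact hasDerivWithinAt_const _ _ _)
  exact ⟨g, hg, by simpa using hg0⟩

/-- If `γ` did not vanish on a tangent vector of the boundary, it would have constant sign on a short
boundary arc, and parallel transport along that arc would move `0`. -/
theorem tangential_of_preservesZeroOnBoundary {A : S.Connection} {h : ℂ → ℝ}
    {γ : ℂ → ℂ →L[ℝ] ℝ} (hA : EqOn (S.extend A.form) (S.gaugeForm h γ) S.surface)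
    (hh : ContDiffOn ℝ ∞ h S.surface) (hγ : ContDiffOn ℝ ∞ γ S.surface)
    (hP : A.PreservesZeroOnBoundary) : ∀ z ∈ S.boundary, γ z (Complex.I * z) = 0 := by
  intro z hz
  by_contra hne
  have hz1 : ‖z‖ = 1 := by simpa using hz.1
  let e : ℝ → ℂ := fun u => z * Complex.exp (u * Complex.I)
  have he0 : e 0 = z := by simp [e]
  have hec : ContDiff ℝ ∞ e := by
    have : ContDiff ℝ ∞ fun u : ℝ => (u : ℂ) := Complex.ofRealCLM.contDiff
    exact contDiff_const.mul ((this.mul contDiff_const).cexp)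
  have hed : ∀ u, HasDerivAt e (Complex.I * e u) u := by
    intro u
    have h1 : HasDerivAt (fun u : ℝ => (u : ℂ) * Complex.I) (1 * Complex.I) u :=
      Complex.ofRealCLM.hasDerivAt.mul_const _
    convert! (h1.cexp.const_mul z) using 1
    simp only [e]
    ring
  have heB : ∀ᶠ u in 𝓝 (0 : ℝ), e u ∈ S.boundary := by
    have h1 : ∀ᶠ w in 𝓝 z, w ∉ S.punctures :=
      S.finite_punctures.isClosed.isOpen_compl.mem_nhds hz.2
    have h2 := (hec.continuous.tendsto 0).eventually (he0.symm ▸ h1)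
    filter_upwards [h2] with u hu
    refine ⟨?_, hu⟩
    rw [mem_sphere_zero_iff_norm]
    simp [e, hz1, Complex.norm_exp_ofReal_mul_I]
  obtain ⟨d, hd, hdB⟩ := Metric.eventually_nhds_iff.1 heB
  let f : ℝ → ℝ := fun u => γ (e u) (Complex.I * e u)
  have hfc : ContinuousOn f (Ioo (-d) d) := by
    have hm : MapsTo e (Ioo (-d) d) S.surface := fun u hu =>
      boundary_subset_surface (hdB (by rw [Real.dist_eq, sub_zero, abs_lt]; exact hu))
    exact (hγ.continuousOn.comp hec.continuous.continuousOn hm).clm_apply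
      (continuous_const.mul hec.continuous).continuousOn
  have hf0 : f 0 ≠ 0 := by simpa only [f, he0] using hne
  have hpos : ∀ᶠ u in 𝓝 (0 : ℝ), 0 < f u * f 0 :=
    ((hfc.continuousAt (Ioo_mem_nhds (by linarith) hd)).mul continuousAt_const).eventually
      (lt_mem_nhds (mul_self_pos.2 hf0))
  obtain ⟨d', hd', hpos'⟩ := Metric.eventually_nhds_iff.1 hpos
  obtain ⟨T, hT0, hT⟩ : ∃ T : ℝ, 0 < T ∧ T < min d d' := exists_between (lt_min hd hd')
  have hsm : ∀ t ∈ Icc (0 : ℝ) 1, |T * t| < min d d' := by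
    intro t ht
    rw [abs_of_nonneg (mul_nonneg hT0.le ht.1)]
    nlinarith [ht.2]
  let c : ℝ → ℂ := fun t => e (T * t)
  have hc : ContDiff ℝ ∞ c := hec.comp (contDiff_const.mul contDiff_id)
  have hcB : MapsTo c (Icc 0 1) S.boundary := fun t ht =>
    hdB (by rw [Real.dist_eq, sub_zero]; exact (hsm t ht).trans_le (min_le_left _ _))
  have hcS : MapsTo c (Icc 0 1) S.surface := hcB.mono_right boundary_subset_surface
  have hcd : ∀ t ∈ Icc (0 : ℝ) 1, derivWithin c (Icc 0 1) t = T • (Complex.I * c t) := by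
    intro t ht
    have := (hed (T * t)).scomp t ((hasDerivAt_id t).const_mul T)
    rw [mul_one] at this
    exact this.hasDerivWithinAt.derivWithin (uniqueDiffOn_Icc zero_lt_one t ht)
  obtain ⟨g, hg, hg0⟩ := hP c hc.contDiffOn hcB
  have hq : ∀ t ∈ Icc (0 : ℝ) 1,
      Real.exp (-(h ∘ c) t) * (A.pullbackPath c t).2 = T * f (T * t) := by
    intro t ht
    rw [Connection.pullbackPath, hA (hcS ht), gaugeForm_apply, hcd t ht, map_smul]
    simp only [Function.comp, ← mul_assoc, ← Real.exp_add]
    rw [neg_add_cancel, Real.exp_zero, one_mul, map_smul, smul_eq_mul]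
  have hfT : ContinuousOn (fun t => T * f (T * t)) (Icc 0 1) := by
    refine continuousOn_const.mul (hfc.comp (by fun_prop) fun t ht => ?_)
    rw [mem_Ioo, ← abs_lt]
    exact (hsm t ht).trans_le (min_le_left _ _)
  have key := exp_neg_mul_parallelTransport_zero (P := h ∘ c) hg (fun t ht => by
    rw [Connection.pullbackPath, hA (hcS ht), gaugeForm_apply]
    exact hasDerivWithinAt_comp_path hh hc.contDiffOn hcS ht) (hfT.congr hq)
  rw [hg0, mul_zero, intervalIntegral.integral_congr (g := fun t => T * f (T * t))
    (by rw [uIcc_of_le zero_le_one]; exact hq)] at key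
  have hlt : 0 < ∫ t in (0 : ℝ)..1, T * f (T * t) * f 0 := by
    refine intervalIntegral.intervalIntegral_pos_of_pos_on
      ((hfT.mul continuousOn_const).intervalIntegrable_of_Icc zero_le_one) (fun t ht => ?_)
      zero_lt_one
    rw [mul_assoc]
    refine mul_pos hT0 (hpos' ?_)
    rw [Real.dist_eq, sub_zero]
    exact (hsm t (Ioo_subset_Icc_self ht)).trans_le (min_le_right _ _)
  rw [intervalIntegral.integral_mul_const, ← key, zero_mul] at hlt
  exact lt_irrefl _ hlt

theorem Ends.mapsTo (E : S.Ends) (ζ : S.punctures) : MapsTo (E.ε ζ) (E.dom ζ) S.surface :=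
  (E.isEnd ζ).mapsTo

theorem Ends.hasFDerivWithinAt (E : S.Ends) (ζ : S.punctures) {p : ℝ × ℝ} (hp : p ∈ E.dom ζ) :
    HasFDerivWithinAt (E.ε ζ) (fderivWithin ℝ (E.ε ζ) (E.dom ζ) p) (E.dom ζ) p :=
  ((E.isEnd ζ).smooth.differentiableOn (by simp) p hp).hasFDerivWithinAt

theorem Ends.hasFDerivWithinAt_comp (E : S.Ends) (ζ : S.punctures) {h : ℂ → ℝ}
    (hh : ContDiffOn ℝ ∞ h S.surface) {p : ℝ × ℝ} (hp : p ∈ E.dom ζ) :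
    HasFDerivWithinAt (h ∘ E.ε ζ) ((fderivWithin ℝ h S.surface (E.ε ζ p)).comp
      (fderivWithin ℝ (E.ε ζ) (E.dom ζ) p)) (E.dom ζ) p :=
  (hh.differentiableOn (by simp) _ (E.mapsTo ζ hp)).hasFDerivWithinAt.comp p
    (E.hasFDerivWithinAt ζ hp) (E.mapsTo ζ)

theorem Ends.hasDerivWithinAt_comp_snd (E : S.Ends) (ζ : S.punctures) {h : ℂ → ℝ}
    (hh : ContDiffOn ℝ ∞ h S.surface) {s t : ℝ} (hp : (s, t) ∈ E.dom ζ) :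
    HasDerivWithinAt (fun t => h (E.ε ζ (s, t))) (fderivWithin ℝ h S.surface (E.ε ζ (s, t))
      (fderivWithin ℝ (E.ε ζ) (E.dom ζ) (s, t) (0, 1))) (Icc 0 1) t :=
  (E.hasFDerivWithinAt_comp ζ hh hp).comp_hasDerivWithinAt_of_eq t
    ((hasDerivWithinAt_const t _ s).prodMk (hasDerivWithinAt_id t _))
    (fun _ ht => ⟨hp.1, ht⟩) rfl

theorem Ends.hasDerivWithinAt_comp_fst (E : S.Ends) (ζ : S.punctures) {h : ℂ → ℝ}
    (hh : ContDiffOn ℝ ∞ h S.surface) {s t : ℝ} (hp : (s, t) ∈ E.dom ζ) :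
    HasDerivWithinAt (fun s => h (E.ε ζ (s, t))) (fderivWithin ℝ h S.surface (E.ε ζ (s, t))
      (fderivWithin ℝ (E.ε ζ) (E.dom ζ) (s, t) (1, 0))) (S.halfLine ζ (E.σ ζ)) s :=
  (E.hasFDerivWithinAt_comp ζ hh hp).comp_hasDerivWithinAt_of_eq s
    ((hasDerivWithinAt_id s _).prodMk (hasDerivWithinAt_const s _ t))
    (fun _ hs => ⟨hs, hp.2⟩) rfl

theorem Ends.contDiffOn_comp_snd (E : S.Ends) (ζ : S.punctures) {F : Type*}
    [NormedAddCommGroup F] [NormedSpace ℝ F] {h : ℂ → F}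
    (hh : ContDiffOn ℝ ∞ h S.surface) :
    ContDiffOn ℝ ∞ (fun t => h (E.ε ζ (E.σ ζ, t))) (Icc 0 1) :=
  (hh.comp (E.isEnd ζ).smooth (E.mapsTo ζ)).comp
    (g := fun p : ℝ × ℝ => h (E.ε ζ p)) (contDiff_const.prodMk contDiff_id).contDiffOn
    fun _ ht => ⟨mem_halfLine _ _, ht⟩

/-- The pullback of the connection form to an end has the form `a(t) dt` if and only if the potential
is independent of `s` there, and the profile has the form `c(t) dt`; and parallel transport over
`[0, 1]` takes `0` to a positive multiple of `∫ c`. -/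
theorem isPullbackOnEnd_iff {E : S.Ends} {A : S.Connection} {h : ℂ → ℝ}
    {γ : ℂ → ℂ →L[ℝ] ℝ} (hA : EqOn (S.extend A.form) (S.gaugeForm h γ) S.surface)
    (hh : ContDiffOn ℝ ∞ h S.surface) (ζ : S.punctures) :
    A.IsPullbackOnEnd (E.dom ζ) (E.ε ζ) ↔
      (∀ s s' t, (s, t) ∈ E.dom ζ → (s', t) ∈ E.dom ζ →
        h (E.ε ζ (s, t)) = h (E.ε ζ (s', t))) ∧
      ∃ c : ℝ → ℝ, ContDiffOn ℝ ∞ c (Icc 0 1) ∧ 0 < ∫ t in (0 : ℝ)..1, c t ∧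
        ∀ p ∈ E.dom ζ, ∀ v : ℝ × ℝ,
          γ (E.ε ζ p) (fderivWithin ℝ (E.ε ζ) (E.dom ζ) p v) = v.2 * c p.2 := by
  have hσ : ∀ {t}, t ∈ Icc (0 : ℝ) 1 → (E.σ ζ, t) ∈ E.dom ζ := fun ht => ⟨mem_halfLine _ _, ht⟩
  let K : ℝ → ℝ := fun t => h (E.ε ζ (E.σ ζ, t))
  have hK : ContDiffOn ℝ ∞ K (Icc 0 1) := E.contDiffOn_comp_snd ζ hh
  constructor
  · rintro ⟨a, ⟨ha, g, hg, hg0⟩, hp⟩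
    have hp' : ∀ p ∈ E.dom ζ, ∀ v : ℝ × ℝ,
        fderivWithin ℝ h S.surface (E.ε ζ p) (fderivWithin ℝ (E.ε ζ) (E.dom ζ) p v)
          = v.2 * (a p.2).1 ∧
        Real.exp (h (E.ε ζ p)) * γ (E.ε ζ p) (fderivWithin ℝ (E.ε ζ) (E.dom ζ) p v)
          = v.2 * (a p.2).2 := by
      intro p hpp v
      have := hp p hpp v
      rw [hA (E.mapsTo ζ hpp), gaugeForm_apply, Prod.ext_iff] at this
      simpa using this
    have hconst : ∀ s s' t, (s, t) ∈ E.dom ζ → (s', t) ∈ E.dom ζ →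
        h (E.ε ζ (s, t)) = h (E.ε ζ (s', t)) := by
      intro s s' t hs hs'
      have hd : ∀ s, s ∈ S.halfLine ζ (E.σ ζ) →
          HasDerivWithinAt (fun s => h (E.ε ζ (s, t))) 0 (S.halfLine ζ (E.σ ζ)) s := by
        intro s hs1
        have := E.hasDerivWithinAt_comp_fst ζ hh (s := s) (t := t) ⟨hs1, hs.2⟩
        rwa [(hp' (s, t) ⟨hs1, hs.2⟩ (1, 0)).1, zero_mul] at this
      refine (halfLine_convex ζ (E.σ ζ)).is_const_of_fderivWithin_eq_zero (𝕜 := ℝ)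
        (f := fun s => h (E.ε ζ (s, t))) (fun s hs => (hd s hs).differentiableWithinAt)
        (fun s hs => ?_) hs.1 hs'.1
      have := (hd s hs).hasFDerivWithinAt.fderivWithin (uniqueDiffOn_halfLine _ _ s hs)
      rw [this]
      simp
    have hKd : ∀ t ∈ Icc (0 : ℝ) 1, HasDerivWithinAt K (a t).1 (Icc 0 1) t := by
      intro t ht
      have := E.hasDerivWithinAt_comp_snd ζ hh (hσ ht)
      rwa [(hp' _ (hσ ht) (0, 1)).1, one_mul] at this
    have hcs : ContDiffOn ℝ ∞ (fun t => Real.exp (-K t) * (a t).2) (Icc 0 1) :=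
      hK.neg.exp.mul ha.snd
    refine ⟨hconst, fun t => Real.exp (-K t) * (a t).2, hcs, ?_, ?_⟩
    · rw [← exp_neg_mul_parallelTransport_zero hg hKd hcs.continuousOn]
      positivity
    · rintro ⟨s, t⟩ hst v
      have h1 := (hp' _ hst v).2
      have h2 : K t = h (E.ε ζ (s, t)) := hconst _ _ _ (hσ hst.2) hst
      simp only at h1 ⊢
      rw [h2, mul_left_comm, ← h1, ← mul_assoc, ← Real.exp_add]
      simp
  · rintro ⟨hconst, c, hc, hpos, hp⟩
    let a : ℝ → AffLie := fun t => (derivWithin K (Icc 0 1) t, Real.exp (K t) * c t)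
    have hKd : ∀ t ∈ Icc (0 : ℝ) 1, HasDerivWithinAt K (a t).1 (Icc 0 1) t := fun t ht =>
      (hK.differentiableOn (by simp) t ht).hasDerivWithinAt
    have hQ : ∀ t ∈ Icc (0 : ℝ) 1, HasDerivWithinAt (fun t => ∫ u in (0 : ℝ)..t, c u)
        (Real.exp (-K t) * (a t).2) (Icc 0 1) t := by
      intro t ht
      have e : Real.exp (-K t) * (a t).2 = c t := by
        simp [a, ← mul_assoc, ← Real.exp_add]
      rw [e]
      have : Fact (t ∈ Icc (0 : ℝ) 1) := ⟨ht⟩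
      exact intervalIntegral.integral_hasDerivWithinAt_right
        ((hc.continuousOn.mono (Icc_subset_Icc_right ht.2)).intervalIntegrable_of_Icc ht.1)
        (hc.continuousOn.stronglyMeasurableAtFilter_nhdsWithin measurableSet_Icc t)
        (hc.continuousOn t ht)
    obtain ⟨g, hg, hg0⟩ := exists_parallelTransport hKd hQ
    refine ⟨a, ⟨?_, g, hg, ?_⟩, ?_⟩
    · exact (hK.derivWithin (uniqueDiffOn_Icc zero_lt_one) (by simp)).prodMk (hK.exp.mul hc)
    · rw [hg0, intervalIntegral.integral_same, sub_zero]
      positivity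
    · rintro ⟨s, t⟩ hst v
      have h2 : K t = h (E.ε ζ (s, t)) := hconst _ _ _ (hσ hst.2) hst
      rw [hA (E.mapsTo ζ hst), gaugeForm_apply]
      have h3 : HasFDerivWithinAt (fun p : ℝ × ℝ => K p.2)
          ((ContinuousLinearMap.toSpanSingleton ℝ (derivWithin K (Icc 0 1) t)).comp
            (ContinuousLinearMap.snd ℝ ℝ ℝ)) (E.dom ζ) (s, t) :=
        HasFDerivWithinAt.comp (g := K) (f := Prod.snd) (t := Icc 0 1) (s, t)
          (hKd t hst.2).hasFDerivWithinAt hasFDerivWithinAt_snd fun p hp => hp.2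
      have h4 := (E.uniqueDiffOn_dom ζ _ hst).eq (E.hasFDerivWithinAt_comp ζ hh hst)
        (h3.congr (fun p hp => (hconst _ _ _ (hσ hp.2) hp).symm) h2.symm)
      have h5 := DFunLike.congr_fun h4 v
      simp only [ContinuousLinearMap.comp_apply] at h5
      rw [h5, hp _ hst v]
      simp [a, h2]
      ring

/-- Membership in the space of connections splits into separate conditions on the potential, which
are linear, and on the profile, which are convex. -/
theorem Ends.mem_connections_iff {E : S.Ends} {A : S.Connection} {h : ℂ → ℝ}
    {γ : ℂ → ℂ →L[ℝ] ℝ} (hA : EqOn (S.extend A.form) (S.gaugeForm h γ) S.surface)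
    (hh : ContDiffOn ℝ ∞ h S.surface) (hγ : ContDiffOn ℝ ∞ γ S.surface) :
    A ∈ E.connections ↔ E.IsGauge h ∧ E.IsProfile γ := by
  constructor
  · rintro ⟨h1, h2, h3⟩
    exact ⟨⟨hh, fun ζ => ((isPullbackOnEnd_iff hA hh ζ).1 (h1 ζ)).1⟩,
      ⟨hγ, tangential_of_preservesZeroOnBoundary hA hh hγ h2, (nonnegCurved_iff hA hh hγ).1 h3,
        fun ζ => ((isPullbackOnEnd_iff hA hh ζ).1 (h1 ζ)).2⟩⟩
  · rintro ⟨h1, h2⟩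
    exact ⟨fun ζ => (isPullbackOnEnd_iff hA hh ζ).2 ⟨h1.const ζ, h2.ends ζ⟩,
      preservesZeroOnBoundary_of_tangential hA hh h2.tangential,
      (nonnegCurved_iff hA hh hγ).2 h2.curl_nonpos⟩

theorem Ends.isGauge_isProfile {E : S.Ends} {A : S.Connection} (hA : A ∈ E.connections) :
    E.IsGauge A.potential ∧ E.IsProfile A.profile :=
  (E.mem_connections_iff (eqOn_gaugeForm hA.2.2) (contDiffOn_potential hA.2.2)
    (contDiffOn_profile hA.2.2)).1 hA

/-- The connection with given gauge function and profile. -/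
def mkConnection (S : PuncturedDisc) (h : ℂ → ℝ) (γ : ℂ → ℂ →L[ℝ] ℝ)
    (hh : ContDiffOn ℝ ∞ h S.surface) (hγ : ContDiffOn ℝ ∞ γ S.surface) : S.Connection where
  form z := S.gaugeForm h γ z
  smooth := (contDiffOn_gaugeForm hh hγ).congr fun _ hz => extend_apply _ hz

theorem extend_mkConnection {h : ℂ → ℝ} {γ : ℂ → ℂ →L[ℝ] ℝ}
    (hh : ContDiffOn ℝ ∞ h S.surface) (hγ : ContDiffOn ℝ ∞ γ S.surface) :
    EqOn (S.extend (S.mkConnection h γ hh hγ).form) (S.gaugeForm h γ) S.surface :=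
  fun _ hz => extend_apply _ hz

end PuncturedDisc

/-! ### The contraction -/

namespace PuncturedDisc

variable {S : PuncturedDisc}

theorem Connection.ext_of_eqOn {A B : S.Connection}
    (h : EqOn (S.extend A.form) (S.extend B.form) S.surface) : A = B := by
  cases A with | mk a ha => cases B with | mk b hb =>
  congr
  funext z
  simpa using h z.2

theorem Ends.IsGauge.combo {E : S.Ends} {h k : ℂ → ℝ} (hh : E.IsGauge h) (hk : E.IsGauge k)
    (a b : ℝ) : E.IsGauge fun z => a * h z + b * k z where
  smooth := (contDiffOn_const.mul hh.smooth).add (contDiffOn_const.mul hk.smooth)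
  const ζ s s' t hs hs' := by rw [hh.const ζ s s' t hs hs', hk.const ζ s s' t hs hs']

theorem fderivWithin_combo {γ δ : ℂ → ℂ →L[ℝ] ℝ} (hγ : ContDiffOn ℝ ∞ γ S.surface)
    (hδ : ContDiffOn ℝ ∞ δ S.surface) (a b : ℝ) {z : ℂ} (hz : z ∈ S.surface) :
    fderivWithin ℝ (fun z => a • γ z + b • δ z) S.surface z =
      a • fderivWithin ℝ γ S.surface z + b • fderivWithin ℝ δ S.surface z :=
  (((hγ.differentiableOn (by simp) z hz).hasFDerivWithinAt.const_smul a).add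
    ((hδ.differentiableOn (by simp) z hz).hasFDerivWithinAt.const_smul b)).fderivWithin
    (S.uniqueDiffOn_surface z hz)

theorem Ends.IsProfile.combo {E : S.Ends} {γ δ : ℂ → ℂ →L[ℝ] ℝ} (hγ : E.IsProfile γ)
    (hδ : E.IsProfile δ) {a b : ℝ} (ha : 0 ≤ a) (hb : 0 ≤ b) (hab : 0 < a + b) :
    E.IsProfile fun z => a • γ z + b • δ z where
  smooth := (hγ.smooth.const_smul a).add (hδ.smooth.const_smul b)
  tangential z hz := by simp [hγ.tangential z hz, hδ.tangential z hz]
  curl_nonpos z hz := by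
    rw [fderivWithin_combo hγ.smooth hδ.smooth a b hz]
    have h1 := mul_nonpos_of_nonneg_of_nonpos ha (hγ.curl_nonpos z hz)
    have h2 := mul_nonpos_of_nonneg_of_nonpos hb (hδ.curl_nonpos z hz)
    simp only [add_apply, smul_apply, smul_eq_mul]
    linarith
  ends ζ := by
    obtain ⟨c, hc, hc0, hcp⟩ := hγ.ends ζ
    obtain ⟨d, hd, hd0, hdp⟩ := hδ.ends ζ
    refine ⟨fun t => a * c t + b * d t, (contDiffOn_const.mul hc).add (contDiffOn_const.mul hd),
      ?_, fun p hp v => ?_⟩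
    · rw [intervalIntegral.integral_add, intervalIntegral.integral_const_mul,
        intervalIntegral.integral_const_mul]
      · rcases ha.eq_or_lt with rfl | ha
        · rw [zero_add] at hab
          positivity
        · positivity
      · exact (continuousOn_const.mul hc.continuousOn).intervalIntegrable_of_Icc zero_le_one
      · exact (continuousOn_const.mul hd.continuousOn).intervalIntegrable_of_Icc zero_le_one
    · simp [hcp p hp v, hdp p hp v]
      ring

/-- The potential depends continuously on the connection, together with all its derivatives:
its first derivative is a component of the connection form, so only the values have to be
considered. -/
theorem jointC_potential (E : S.Ends) (n : ℕ) :
    JointC S.surface n fun A : E.connections => A.1.potential := by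
  have h0 : Continuous fun p : E.connections × S.surface => p.1.1.potential p.2 := by
    have hF : Continuous fun q : (E.connections × S.surface) × ℝ =>
        (S.extend q.1.1.1.form ((projIcc (0 : ℝ) 1 zero_le_one q.2 : ℝ) • (q.1.2 : ℂ))
          (q.1.2 : ℂ)).1 := by
      have h1 : ∀ q : (E.connections × S.surface) × ℝ,
          (projIcc (0 : ℝ) 1 zero_le_one q.2 : ℝ) • (q.1.2 : ℂ) ∈ S.surface := fun q =>
        S.convex_surface.smul_mem_of_zero_mem S.zero_mem_surface q.1.2.2
          (projIcc (0 : ℝ) 1 zero_le_one q.2).2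
      have h2 : Continuous fun q : (E.connections × S.surface) × ℝ =>
          (⟨_, h1 q⟩ : S.surface) :=
        ((continuous_subtype_val.comp (continuous_projIcc.comp continuous_snd)).smul
          (continuous_subtype_val.comp (continuous_snd.comp continuous_fst))).subtype_mk h1
      have h3 := (jointC_form (S := S) (n := 0)).continuous.comp
        ((continuous_subtype_val.comp (continuous_fst.comp continuous_fst)).prodMk h2)
      exact (h3.clm_apply
        (continuous_subtype_val.comp (continuous_snd.comp continuous_fst))).fst
    have h4 := intervalIntegral.continuous_parametric_intervalIntegral_of_continuous'
      (μ := MeasureTheory.volume) (f := fun (p : E.connections × S.surface) r => (S.extend p.1.1.form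
        ((projIcc (0 : ℝ) 1 zero_le_one r : ℝ) • (p.2 : ℂ)) (p.2 : ℂ)).1) hF 0 1
    refine h4.congr fun p => intervalIntegral.integral_congr fun r hr => ?_
    rw [uIcc_of_le zero_le_one] at hr
    simp only [projIcc_of_mem zero_le_one hr]
  cases n with
  | zero => exact h0
  | succ n =>
    refine ⟨h0, fun A z hz => (exists_potential A.2.2.2 z hz).differentiableWithinAt,
      (((jointC_form (S := S) (n := n)).comp_param continuous_subtype_val).clm
        S.uniqueDiffOn_surface (ContinuousLinearMap.compL ℝ ℂ AffLie ℝ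
          (ContinuousLinearMap.fst ℝ ℝ ℝ))).congr fun A z hz =>
      (exists_potential A.2.2.2 z hz).fderivWithin (S.uniqueDiffOn_surface z hz)⟩

theorem jointC_profile (E : S.Ends) (n : ℕ) :
    JointC S.surface n fun A : E.connections => A.1.profile := by
  have hU := S.uniqueDiffOn_surface
  have h1 := ((jointC_potential E n).clm hU (-ContinuousLinearMap.id ℝ ℝ)).exp hU
  exact (h1.smul hU (((jointC_form (S := S) (n := n)).comp_param continuous_subtype_val).clm
    hU (ContinuousLinearMap.compL ℝ ℂ AffLie ℝ (ContinuousLinearMap.snd ℝ ℝ ℝ)))).congr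
    fun A z _ => rfl

theorem jointC_gaugeForm {X : Type*} [TopologicalSpace X] {n : ℕ} {h : X → ℂ → ℝ}
    {γ : X → ℂ → ℂ →L[ℝ] ℝ} (hh : JointC S.surface (n + 1) h) (hγ : JointC S.surface n γ) :
    JointC S.surface n fun x => S.gaugeForm (h x) (γ x) := by
  have hU := S.uniqueDiffOn_surface
  exact (hh.2.2.clm hU (ContinuousLinearMap.compL ℝ ℂ ℝ AffLie
    (ContinuousLinearMap.inl ℝ ℝ ℝ))).add hU ((hh.of_succ.exp hU).smul hU
      (hγ.clm hU (ContinuousLinearMap.compL ℝ ℂ ℝ AffLie (ContinuousLinearMap.inr ℝ ℝ ℝ))))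

/-- The straight line from `A` to `B` in terms of potentials and profiles. -/
def Ends.line (E : S.Ends) (B : E.connections) (p : unitInterval × E.connections) :
    E.connections :=
  ⟨S.mkConnection (fun z => (1 - p.1) * p.2.1.potential z + p.1 * B.1.potential z)
      (fun z => (1 - (p.1 : ℝ)) • p.2.1.profile z + (p.1 : ℝ) • B.1.profile z)
      ((E.isGauge_isProfile p.2.2).1.combo (E.isGauge_isProfile B.2).1 _ _).smooth
      ((E.isGauge_isProfile p.2.2).2.combo (E.isGauge_isProfile B.2).2
        (sub_nonneg.2 p.1.2.2) p.1.2.1 (by simp)).smooth,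
    (E.mem_connections_iff (extend_mkConnection _ _)
      ((E.isGauge_isProfile p.2.2).1.combo (E.isGauge_isProfile B.2).1 _ _).smooth
      ((E.isGauge_isProfile p.2.2).2.combo (E.isGauge_isProfile B.2).2
        (sub_nonneg.2 p.1.2.2) p.1.2.1 (by simp)).smooth).2
    ⟨(E.isGauge_isProfile p.2.2).1.combo (E.isGauge_isProfile B.2).1 _ _,
      (E.isGauge_isProfile p.2.2).2.combo (E.isGauge_isProfile B.2).2
        (sub_nonneg.2 p.1.2.2) p.1.2.1 (by simp)⟩⟩

theorem Ends.continuous_line (E : S.Ends) (B : E.connections) : Continuous (E.line B) := by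
  have hU := S.uniqueDiffOn_surface
  have hτ : Continuous fun p : unitInterval × E.connections => (p.1 : ℝ) :=
    continuous_subtype_val.comp continuous_fst
  refine Continuous.subtype_mk (continuous_connection_of_jointC fun n => ?_) _
  refine JointC.congr ?_ fun x => extend_mkConnection _ _
  refine jointC_gaugeForm ?_ ?_
  · exact ((JointC.of_param (continuous_const.sub hτ)).smul hU
      ((jointC_potential E _).comp_param continuous_snd)).add hU
      ((JointC.of_param hτ).smul hU (JointC.of_contDiffOn hU (contDiffOn_potential B.2.2.2)))
  · exact ((JointC.of_param (continuous_const.sub hτ)).smul hU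
      ((jointC_profile E _).comp_param continuous_snd)).add hU
      ((JointC.of_param hτ).smul hU (JointC.of_contDiffOn hU (contDiffOn_profile B.2.2.2)))

/-- The value of the line is determined by its potential and profile. -/
theorem Ends.line_eq (E : S.Ends) (A B C : E.connections) (τ : unitInterval)
    (h : ∀ z, (1 - (τ : ℝ)) * A.1.potential z + τ * B.1.potential z = C.1.potential z)
    (h' : ∀ z, (1 - (τ : ℝ)) • A.1.profile z + (τ : ℝ) • B.1.profile z = C.1.profile z) :
    E.line B (τ, A) = C := by
  refine Subtype.ext (Connection.ext_of_eqOn fun z hz => ?_)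
  rw [eqOn_gaugeForm C.2.2.2 hz, Ends.line, extend_mkConnection _ _ hz]
  congr 1
  exacts [funext h, funext h']

theorem Ends.weaklyContractible_connections (E : S.Ends) (hne : Nonempty E.connections) :
    WeaklyContractible E.connections :=
  weaklyContractible_of_contractions hne fun B => ⟨E.line B, E.continuous_line B,
    fun A => E.line_eq A B A 0 (by simp) (by simp),
    fun A => E.line_eq A B B 1 (by simp) (by simp),
    fun τ => E.line_eq B B B τ (fun z => by ring) (fun z => by rw [← add_smul]; simp)⟩

theorem Ends.nonempty_connections_iff (E : S.Ends) :
    Nonempty E.connections ↔ ∃ γ, E.IsProfile γ := by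
  constructor
  · rintro ⟨A⟩
    exact ⟨_, (E.isGauge_isProfile A.2).2⟩
  · rintro ⟨γ, hγ⟩
    have h0 : E.IsGauge fun _ => 0 := ⟨contDiffOn_const, fun _ _ _ _ _ _ => rfl⟩
    exact ⟨⟨S.mkConnection _ γ h0.smooth hγ.smooth,
      (E.mem_connections_iff (extend_mkConnection _ _) h0.smooth hγ.smooth).2 ⟨h0, hγ⟩⟩⟩

end PuncturedDisc

/-! ### Normalized ends -/

namespace PuncturedDisc

variable {S : PuncturedDisc}

/-- The half-strip `(-∞, 0] × [0, 1]`. -/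
def strip : Set (ℝ × ℝ) := Iic 0 ×ˢ Icc 0 1

theorem mem_strip {p : ℝ × ℝ} : p ∈ strip ↔ p.1 ≤ 0 ∧ 0 ≤ p.2 ∧ p.2 ≤ 1 := Iff.rfl

theorem uniqueDiffOn_strip : UniqueDiffOn ℝ strip :=
  (uniqueDiffOn_Iic _).prod (uniqueDiffOn_Icc zero_lt_one)

theorem isClosed_strip : IsClosed strip := isClosed_Iic.prod isClosed_Icc

namespace Ends

open Classical in
/-- The sign of a puncture, `1` for negative and `-1` for positive ones. -/
def sign (_E : S.Ends) (ζ : S.punctures) : ℝ := if (ζ : ℂ) ∈ S.neg then 1 else -1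

open Classical in
/-- The point which the normalized chart takes as origin. -/
def corner (E : S.Ends) (ζ : S.punctures) : ℝ × ℝ :=
  (E.σ ζ, if (ζ : ℂ) ∈ S.neg then 0 else 1)

/-- The end at `ζ`, parametrized by `(-∞, 0] × [0, 1]`: negative ends are translated, and positive
ends are also rotated by `(s, t) ↦ (-s, 1 - t)`, which preserves orientations. -/
def chart (E : S.Ends) (ζ : S.punctures) (p : ℝ × ℝ) : ℂ := E.ε ζ (E.corner ζ + E.sign ζ • p)

variable (E : S.Ends) (ζ : S.punctures)

theorem sign_mul_self : E.sign ζ * E.sign ζ = 1 := by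
  unfold sign
  split_ifs <;> norm_num

theorem sign_smul_smul {M : Type*} [AddCommGroup M] [Module ℝ M] (v : M) :
    E.sign ζ • E.sign ζ • v = v := by
  rw [smul_smul, sign_mul_self, one_smul]

theorem corner_add_mem_dom {p : ℝ × ℝ} :
    E.corner ζ + E.sign ζ • p ∈ E.dom ζ ↔ p ∈ strip := by
  simp only [mem_strip, dom, halfLine, corner, sign, mem_prod]
  split_ifs
  · simp
  · simp
    exact fun _ => and_comm

theorem exists_corner_add {q : ℝ × ℝ} (hq : q ∈ E.dom ζ) :
    ∃ p ∈ strip, E.corner ζ + E.sign ζ • p = q := by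
  have e : E.corner ζ + E.sign ζ • E.sign ζ • (q - E.corner ζ) = q := by
    rw [sign_smul_smul]
    abel
  exact ⟨E.sign ζ • (q - E.corner ζ), (E.corner_add_mem_dom ζ).1 (by rwa [e]), e⟩

theorem hasFDerivWithinAt_corner_add (p : ℝ × ℝ) :
    HasFDerivWithinAt (fun p => E.corner ζ + E.sign ζ • p)
      (E.sign ζ • ContinuousLinearMap.id ℝ (ℝ × ℝ)) strip p :=
  ((hasFDerivWithinAt_id p strip).const_smul (E.sign ζ)).const_add _

theorem fderivWithin_chart {p : ℝ × ℝ} (hp : p ∈ strip) (v : ℝ × ℝ) :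
    fderivWithin ℝ (E.chart ζ) strip p v =
      fderivWithin ℝ (E.ε ζ) (E.dom ζ) (E.corner ζ + E.sign ζ • p) (E.sign ζ • v) := by
  have := ((E.hasFDerivWithinAt ζ ((E.corner_add_mem_dom ζ).2 hp)).comp p
    (E.hasFDerivWithinAt_corner_add ζ p) fun q hq => (E.corner_add_mem_dom ζ).2 hq).fderivWithin
    (uniqueDiffOn_strip p hp)
  change fderivWithin ℝ (E.ε ζ ∘ fun p => E.corner ζ + E.sign ζ • p) strip p v = _
  rw [this]
  simp

theorem chart_image : E.chart ζ '' strip = E.ε ζ '' E.dom ζ := by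
  ext z
  constructor
  · rintro ⟨p, hp, rfl⟩
    exact ⟨_, (E.corner_add_mem_dom ζ).2 hp, rfl⟩
  · rintro ⟨q, hq, rfl⟩
    obtain ⟨p, hp, rfl⟩ := E.exists_corner_add ζ hq
    exact ⟨p, hp, rfl⟩

theorem disjoint_chart {ζ ζ' : S.punctures} (h : ζ ≠ ζ') :
    Disjoint (E.chart ζ '' strip) (E.chart ζ' '' strip) := by
  rw [chart_image, chart_image]
  exact E.disjoint ζ ζ' h

theorem isEnd_chart : S.IsEnd (Iic 0) atBot ζ (E.chart ζ) where
  mapsTo p hp := E.mapsTo ζ ((E.corner_add_mem_dom ζ).2 hp)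
  smooth := (E.isEnd ζ).smooth.comp (by fun_prop) fun p hp => (E.corner_add_mem_dom ζ).2 hp
  injOn p hp q hq h := by
    have := (E.isEnd ζ).injOn ((E.corner_add_mem_dom ζ).2 hp) ((E.corner_add_mem_dom ζ).2 hq) h
    rw [← E.sign_smul_smul ζ p, add_left_cancel this, sign_smul_smul]
  oriented p hp := by
    have h := (E.isEnd ζ).oriented _ ((E.corner_add_mem_dom ζ).2 hp)
    have h1 := E.fderivWithin_chart ζ hp
    unfold strip at h1
    unfold IsOrientedBasis at h ⊢
    rw [h1, h1, map_smul, map_smul]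
    simp only [Complex.smul_re, Complex.smul_im, smul_eq_mul]
    have h2 := E.sign_mul_self ζ
    refine lt_of_lt_of_eq h ?_
    linear_combination (-1 : ℝ) * ((fderivWithin ℝ (E.ε ζ) (E.dom ζ)
      (E.corner ζ + E.sign ζ • p) (1, 0)).re * (fderivWithin ℝ (E.ε ζ) (E.dom ζ)
      (E.corner ζ + E.sign ζ • p) (0, 1)).im - (fderivWithin ℝ (E.ε ζ) (E.dom ζ)
      (E.corner ζ + E.sign ζ • p) (1, 0)).im * (fderivWithin ℝ (E.ε ζ) (E.dom ζ)
      (E.corner ζ + E.sign ζ • p) (0, 1)).re) * h2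
  proper K hK hKc := by
    have h := ((E.isEnd ζ).proper K hK hKc).image
      (f := fun q => E.sign ζ • (q - E.corner ζ)) (by fun_prop)
    convert! h using 1
    ext p
    constructor
    · rintro ⟨hp, hpK⟩
      refine ⟨E.corner ζ + E.sign ζ • p, ⟨(E.corner_add_mem_dom ζ).2 hp, hpK⟩, ?_⟩
      simp [sign_smul_smul]
    · rintro ⟨q, ⟨hq, hqK⟩, rfl⟩
      obtain ⟨p, hp, rfl⟩ := E.exists_corner_add ζ hq
      simp only [add_sub_cancel_left, sign_smul_smul]
      exact ⟨hp, hqK⟩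
  boundary_iff p hp := by
    refine ((E.isEnd ζ).boundary_iff _ ((E.corner_add_mem_dom ζ).2 hp)).trans ?_
    simp only [corner, sign]
    split_ifs
    · simp
    · simp
      constructor <;> rintro (h | h) <;> [right; left; right; left] <;> linarith
  tendsto t ht := by
    have h := fun t ht => (E.isEnd ζ).tendsto t ht
    simp only [chart, corner, sign]
    by_cases hn : (ζ : ℂ) ∈ S.neg
    · simp only [direction, hn, if_true] at h ⊢
      have h1 := (h t ht).comp (tendsto_atBot_add_const_left atBot (E.σ ζ) tendsto_id)
      refine h1.congr fun s => ?_
      simp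
    · simp only [direction, hn, if_false] at h ⊢
      have h1 := (h (1 - t) ⟨by linarith [ht.2], by linarith [ht.1]⟩).comp
        (tendsto_atTop_add_const_left atBot (E.σ ζ) tendsto_neg_atBot_atTop)
      refine h1.congr fun s => ?_
      simp only [Function.comp]
      congr 1
      ext <;> simp
      ring

theorem chart_mapsTo : MapsTo (E.chart ζ) strip S.surface := (E.isEnd_chart ζ).mapsTo

theorem chart_contDiffOn : ContDiffOn ℝ ∞ (E.chart ζ) strip := (E.isEnd_chart ζ).smooth

theorem chart_injOn : InjOn (E.chart ζ) strip := (E.isEnd_chart ζ).injOn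

theorem chart_hasFDerivWithinAt {p : ℝ × ℝ} (hp : p ∈ strip) :
    HasFDerivWithinAt (E.chart ζ) (fderivWithin ℝ (E.chart ζ) strip p) strip p :=
  ((E.chart_contDiffOn ζ).differentiableOn (by simp) p hp).hasFDerivWithinAt

theorem chart_mem_boundary {p : ℝ × ℝ} (hp : p ∈ strip) :
    E.chart ζ p ∈ S.boundary ↔ p.2 = 0 ∨ p.2 = 1 := (E.isEnd_chart ζ).boundary_iff p hp

theorem norm_chart_lt {p : ℝ × ℝ} (hp : p ∈ strip) (h0 : 0 < p.2) (h1 : p.2 < 1) :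
    ‖E.chart ζ p‖ < 1 := by
  have h2 := E.chart_mapsTo ζ hp
  have h3 := (E.chart_mem_boundary ζ hp).not.2 (by rintro (h | h) <;> linarith)
  refine lt_of_le_of_ne (by simpa using h2.1) fun h => h3 ⟨by simpa using h, h2.2⟩

/-- The condition which a profile has to satisfy on an end, in terms of the normalized end. -/
theorem ends_condition_iff {γ : ℂ → ℂ →L[ℝ] ℝ} :
    (∃ c : ℝ → ℝ, ContDiffOn ℝ ∞ c (Icc 0 1) ∧ 0 < ∫ t in (0 : ℝ)..1, c t ∧
      ∀ p ∈ E.dom ζ, ∀ v : ℝ × ℝ,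
        γ (E.ε ζ p) (fderivWithin ℝ (E.ε ζ) (E.dom ζ) p v) = v.2 * c p.2) ↔
    ∃ c : ℝ → ℝ, ContDiffOn ℝ ∞ c (Icc 0 1) ∧ 0 < E.sign ζ * ∫ t in (0 : ℝ)..1, c t ∧
      ∀ p ∈ strip, ∀ v : ℝ × ℝ,
        γ (E.chart ζ p) (fderivWithin ℝ (E.chart ζ) strip p v) = v.2 * c p.2 := by
  let r : ℝ → ℝ := fun t => (E.corner ζ).2 + E.sign ζ * t
  have hr : MapsTo r (Icc 0 1) (Icc 0 1) := fun t ht =>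
    ((E.corner_add_mem_dom ζ (p := (0, t))).2 ⟨self_mem_Iic, ht⟩).2
  have hrs : ContDiff ℝ ∞ r := by fun_prop
  have hrr : ∀ t, r (r t) = t := by
    intro t
    simp only [r, corner, sign]
    split_ifs <;> simp
  have hint : ∀ c : ℝ → ℝ, ∫ t in (0 : ℝ)..1, c (r t) = ∫ t in (0 : ℝ)..1, c t := by
    intro c
    simp only [r, corner, sign]
    split_ifs
    · simp
    · have := intervalIntegral.integral_comp_sub_left (a := 0) (b := 1) c 1
      simpa [sub_eq_add_neg] using this
  have hs := E.sign_mul_self ζ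
  constructor
  · rintro ⟨c, hc, h0, hp⟩
    refine ⟨fun t => E.sign ζ * c (r t), contDiffOn_const.mul (hc.comp hrs.contDiffOn hr), ?_,
      fun p hp' v => ?_⟩
    · rwa [intervalIntegral.integral_const_mul, hint, ← mul_assoc, hs, one_mul]
    · rw [E.fderivWithin_chart ζ hp', chart, hp _ ((E.corner_add_mem_dom ζ).2 hp')]
      simp [r]
      ring
  · rintro ⟨c, hc, h0, hp⟩
    refine ⟨fun t => E.sign ζ * c (r t), contDiffOn_const.mul (hc.comp hrs.contDiffOn hr), ?_,
      fun q hq v => ?_⟩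
    · rwa [intervalIntegral.integral_const_mul, hint]
    · obtain ⟨p, hp', rfl⟩ := E.exists_corner_add ζ hq
      have h1 := hp p hp' (E.sign ζ • v)
      rw [E.fderivWithin_chart ζ hp', sign_smul_smul, chart] at h1
      rw [h1]
      have h2 : (E.corner ζ + E.sign ζ • p).2 = r p.2 := by simp [r]
      simp only [h2, hrr]
      simp
      ring

end Ends

end PuncturedDisc

/-! ### Local diffeomorphisms of the plane -/

/-- The derivative takes the standard basis to a positively oriented one. -/
def IsOrientedMap (D : ℝ × ℝ →L[ℝ] ℂ) : Prop := IsOrientedBasis (D (1, 0)) (D (0, 1))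

theorem clm_prod_apply {F : Type*} [NormedAddCommGroup F] [NormedSpace ℝ F]
    (D : ℝ × ℝ →L[ℝ] F) (v : ℝ × ℝ) : D v = v.1 • D (1, 0) + v.2 • D (0, 1) := by
  rw [← map_smul, ← map_smul, ← map_add]
  congr 1
  ext <;> simp

theorem IsOrientedMap.injective {D : ℝ × ℝ →L[ℝ] ℂ} (hD : IsOrientedMap D) :
    Function.Injective D := by
  refine (injective_iff_map_eq_zero D).2 fun v hv => ?_
  rw [clm_prod_apply] at hv
  have h1 := congrArg Complex.re hv
  have h2 := congrArg Complex.im hv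
  simp only [Complex.add_re, Complex.add_im, Complex.smul_re, Complex.smul_im, smul_eq_mul,
    Complex.zero_re, Complex.zero_im] at h1 h2
  unfold IsOrientedMap IsOrientedBasis at hD
  set X := D (1, 0)
  set Y := D (0, 1)
  have e1 : v.1 * (X.re * Y.im - X.im * Y.re) = 0 := by linear_combination Y.im * h1 - Y.re * h2
  have e2 : v.2 * (X.re * Y.im - X.im * Y.re) = 0 := by linear_combination X.re * h2 - X.im * h1
  ext
  · exact (mul_eq_zero.1 e1).resolve_right hD.ne'
  · exact (mul_eq_zero.1 e2).resolve_right hD.ne'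

/-- An orientation-preserving linear map as an equivalence. -/
def IsOrientedMap.equiv {D : ℝ × ℝ →L[ℝ] ℂ} (hD : IsOrientedMap D) : (ℝ × ℝ) ≃L[ℝ] ℂ :=
  (LinearEquiv.ofInjectiveOfFinrankEq D.toLinearMap hD.injective
    (by simp [Complex.finrank_real_complex])).toContinuousLinearEquiv

theorem IsOrientedMap.coe_equiv {D : ℝ × ℝ →L[ℝ] ℂ} (hD : IsOrientedMap D) :
    (hD.equiv : ℝ × ℝ →L[ℝ] ℂ) = D := by
  ext <;> rfl

theorem exists_local_inverse {f : ℝ × ℝ → ℂ} {p : ℝ × ℝ} (hf : ContDiffAt ℝ ∞ f p)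
    (hD : IsOrientedMap (fderiv ℝ f p)) :
    ∃ e : OpenPartialHomeomorph (ℝ × ℝ) ℂ, ⇑e = f ∧ p ∈ e.source ∧
      ContDiffAt ℝ ∞ e.symm (f p) := by
  have h1 : HasFDerivAt f (hD.equiv : ℝ × ℝ →L[ℝ] ℂ) p := by
    rw [hD.coe_equiv]
    exact (hf.differentiableAt (by simp)).hasFDerivAt
  exact ⟨hf.toOpenPartialHomeomorph f h1 (by simp), hf.toOpenPartialHomeomorph_coe h1 (by simp),
    hf.mem_toOpenPartialHomeomorph_source h1 (by simp), hf.to_localInverse h1 (by simp)⟩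

/-- A smooth injective map on an open subset of the plane, whose derivative preserves orientations. -/
structure IsOrientedEmbedding (f : ℝ × ℝ → ℂ) (V : Set (ℝ × ℝ)) : Prop where
  isOpen : IsOpen V
  smooth : ContDiffOn ℝ ∞ f V
  oriented : ∀ p ∈ V, IsOrientedMap (fderiv ℝ f p)
  injOn : InjOn f V

namespace IsOrientedEmbedding

variable {f : ℝ × ℝ → ℂ} {V W : Set (ℝ × ℝ)}

theorem mono (h : IsOrientedEmbedding f V) (hW : IsOpen W) (hWV : W ⊆ V) :
    IsOrientedEmbedding f W :=
  ⟨hW, h.smooth.mono hWV, fun p hp => h.oriented p (hWV hp), h.injOn.mono hWV⟩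

theorem contDiffAt (h : IsOrientedEmbedding f V) {p : ℝ × ℝ} (hp : p ∈ V) : ContDiffAt ℝ ∞ f p :=
  h.smooth.contDiffAt (h.isOpen.mem_nhds hp)

theorem isOpen_image (h : IsOrientedEmbedding f V) : IsOpen (f '' V) := by
  rw [isOpen_iff_mem_nhds]
  rintro _ ⟨p, hp, rfl⟩
  obtain ⟨e, he, hpe, -⟩ := exists_local_inverse (h.contDiffAt hp) (h.oriented p hp)
  rw [← he, ← e.map_nhds_eq hpe]
  exact image_mem_map (h.isOpen.mem_nhds hp)

theorem invFunOn_apply (h : IsOrientedEmbedding f V) {p : ℝ × ℝ} (hp : p ∈ V) :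
    Function.invFunOn f V (f p) = p :=
  h.injOn (Function.invFunOn_mem ⟨p, hp, rfl⟩) hp (Function.invFunOn_eq ⟨p, hp, rfl⟩)

theorem contDiffOn_invFunOn (h : IsOrientedEmbedding f V) :
    ContDiffOn ℝ ∞ (Function.invFunOn f V) (f '' V) := by
  rintro _ ⟨p, hp, rfl⟩
  obtain ⟨e, he, hpe, hes⟩ := exists_local_inverse (h.contDiffAt hp) (h.oriented p hp)
  refine (hes.congr_of_eventuallyEq ?_).contDiffWithinAt
  have hfp : f p ∈ e.target := he ▸ e.map_source hpe
  have h1 : ∀ᶠ w in 𝓝 (f p), e.symm w ∈ V := by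
    have : Tendsto e.symm (𝓝 (f p)) (𝓝 p) := by
      have := e.continuousAt_symm hfp
      rwa [ContinuousAt, ← he, e.left_inv hpe, he] at this
    exact this.eventually (h.isOpen.mem_nhds hp)
  filter_upwards [h1, e.open_target.mem_nhds hfp] with w hw hw'
  have h2 : f (e.symm w) = w := by rw [← he, e.right_inv hw']
  rw [← h2, h.invFunOn_apply hw, h2]

end IsOrientedEmbedding

/-! ### Topology of the ends -/

namespace PuncturedDisc

variable {S : PuncturedDisc}

namespace Ends

variable (E : S.Ends) (ζ : S.punctures)

/-- The image of a closed part of the half-strip is closed in the surface: this is properness of the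
end. -/
theorem closure_chart_image {C : Set (ℝ × ℝ)} (hC : IsClosed C) (hCs : C ⊆ strip) :
    closure (E.chart ζ '' C) ⊆ E.chart ζ '' C ∪ S.punctures := by
  intro z hz
  by_cases hp : z ∈ S.punctures
  · exact Or.inr hp
  left
  have hzb : z ∈ Metric.closedBall (0 : ℂ) 1 :=
    (Metric.isClosed_closedBall.closure_subset_iff.2
      (((E.chart_mapsTo ζ).mono_left hCs).image_subset.trans sdiff_subset)) hz
  obtain ⟨r, hr, hrp⟩ := Metric.nhds_basis_closedBall.mem_iff.1
    (S.finite_punctures.isClosed.isOpen_compl.mem_nhds hp)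
  have hK : IsCompact (Metric.closedBall z r ∩ Metric.closedBall 0 1) :=
    (isCompact_closedBall z r).inter_right Metric.isClosed_closedBall
  have hKS : Metric.closedBall z r ∩ Metric.closedBall 0 1 ⊆ S.surface :=
    fun w hw => ⟨hw.2, hrp hw.1⟩
  have h1 := ((E.isEnd_chart ζ).proper _ hKS hK).inter_left hC
  have h2 : IsCompact (E.chart ζ '' (C ∩ (strip ∩ E.chart ζ ⁻¹'
      (Metric.closedBall z r ∩ Metric.closedBall 0 1)))) :=
    h1.image_of_continuousOn ((E.chart_contDiffOn ζ).continuousOn.mono fun p hp => hp.2.1)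
  have h3 : z ∈ closure (E.chart ζ '' (C ∩ (strip ∩ E.chart ζ ⁻¹'
      (Metric.closedBall z r ∩ Metric.closedBall 0 1)))) := by
    rw [mem_closure_iff_nhds] at hz ⊢
    intro t ht
    obtain ⟨w, ⟨hw1, hw2⟩, p, hp, rfl⟩ :=
      hz _ (inter_mem ht (Metric.closedBall_mem_nhds z hr))
    exact ⟨_, hw1, p, ⟨hp, hCs hp, hw2, (E.chart_mapsTo ζ (hCs hp)).1⟩, rfl⟩
  rw [h2.isClosed.closure_eq] at h3
  exact image_mono inter_subset_left h3

/-- The interior of the half-strip. -/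
def innerStrip : Set (ℝ × ℝ) := Iio 0 ×ˢ Ioo 0 1

theorem innerStrip_subset : innerStrip ⊆ strip := prod_mono Iio_subset_Iic_self Ioo_subset_Icc_self

theorem isOpen_innerStrip : IsOpen innerStrip := isOpen_Iio.prod isOpen_Ioo

theorem isOrientedEmbedding_chart : IsOrientedEmbedding (E.chart ζ) innerStrip where
  isOpen := isOpen_innerStrip
  smooth := (E.chart_contDiffOn ζ).mono innerStrip_subset
  oriented p hp := by
    have h : IsOrientedMap (fderivWithin ℝ (E.chart ζ) strip p) :=
      (E.isEnd_chart ζ).oriented p (innerStrip_subset hp)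
    rwa [fderivWithin_of_mem_nhds
      (mem_of_superset (isOpen_innerStrip.mem_nhds hp) innerStrip_subset)] at h
  injOn := (E.chart_injOn ζ).mono innerStrip_subset

/-- Each end covers a neighbourhood of its puncture in the open disc. -/
theorem exists_ball_subset_chart {a : ℝ} (ha : a ≤ 0) :
    ∃ r > 0, Metric.ball (ζ : ℂ) r ∩ Metric.ball 0 1 ⊆ E.chart ζ '' (Iio a ×ˢ Ioo 0 1) := by
  have hsub : Iic a ×ˢ Icc (0 : ℝ) 1 ⊆ strip := prod_mono (Iic_subset_Iic.2 ha) subset_rfl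
  have hsub' : Iio a ×ˢ Ioo (0 : ℝ) 1 ⊆ innerStrip := prod_mono (Iio_subset_Iio ha) subset_rfl
  have hcut : IsCompact (E.chart ζ '' ({a} ×ˢ Icc 0 1)) :=
    (isCompact_singleton.prod isCompact_Icc).image_of_continuousOn
      ((E.chart_contDiffOn ζ).continuousOn.mono
        ((prod_mono (singleton_subset_iff.2 self_mem_Iic) subset_rfl).trans hsub))
  have hζ : (ζ : ℂ) ∈ (E.chart ζ '' ({a} ×ˢ Icc 0 1))ᶜ := by
    rintro ⟨p, hp, h⟩
    have := (E.chart_mapsTo ζ (hsub ⟨le_of_eq hp.1, hp.2⟩)).2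
    rw [h] at this
    exact this ζ.2
  obtain ⟨r, hr, hrs⟩ := Metric.isOpen_iff.1 hcut.isClosed.isOpen_compl _ hζ
  refine ⟨r, hr, ?_⟩
  refine IsPreconnected.subset_of_closure_inter_subset
    ((convex_ball (ζ : ℂ) r).inter (convex_ball 0 1)).isPreconnected
    ((E.isOrientedEmbedding_chart ζ).mono (isOpen_Iio.prod isOpen_Ioo) hsub').isOpen_image ?_ ?_
  · have h1 := (E.isEnd_chart ζ).tendsto (1 / 2) ⟨by norm_num, by norm_num⟩
    obtain ⟨s, hs1, hs2⟩ := ((h1.eventually (Metric.ball_mem_nhds _ hr)).and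
      (eventually_lt_atBot a)).exists
    have hmem : (s, (1 / 2 : ℝ)) ∈ Iio a ×ˢ Ioo (0 : ℝ) 1 := ⟨hs2, by norm_num, by norm_num⟩
    refine ⟨E.chart ζ (s, 1 / 2), ⟨hs1, ?_⟩, _, hmem, rfl⟩
    rw [mem_ball_zero_iff]
    exact E.norm_chart_lt ζ (innerStrip_subset (hsub' hmem)) (by norm_num) (by norm_num)
  · rintro z ⟨hz, hzr, hz1⟩
    have h2 := E.closure_chart_image ζ (isClosed_Iic.prod isClosed_Icc) hsub
      (closure_mono (image_mono (Set.prod_mono Iio_subset_Iic_self Ioo_subset_Icc_self)) hz)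
    rw [mem_ball_zero_iff] at hz1
    rcases h2 with ⟨p, hp, rfl⟩ | h2
    · refine ⟨p, ⟨lt_of_le_of_ne hp.1 fun h => hrs hzr ⟨p, ⟨h, hp.2⟩, rfl⟩, ?_⟩, rfl⟩
      have h3 : E.chart ζ p ∉ S.boundary := fun h => by
        have := h.1
        rw [mem_sphere_zero_iff_norm] at this
        exact hz1.ne this
      rw [E.chart_mem_boundary ζ (hsub hp), not_or] at h3
      exact ⟨lt_of_le_of_ne hp.2.1 (Ne.symm h3.1), lt_of_le_of_ne hp.2.2 h3.2⟩
    · rw [norm_of_mem_punctures h2] at hz1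
      exact absurd hz1 (lt_irrefl _)

end Ends

end PuncturedDisc

/-! ### Stokes' theorem for compactly supported functions -/

/-- The value of `A ∧ B` on the standard basis of the plane. -/
def wedge (A B : ℂ →L[ℝ] ℝ) : ℝ := A 1 * B Complex.I - A Complex.I * B 1

theorem wedge_mul_det (A B : ℂ →L[ℝ] ℝ) (X Y : ℂ) :
    (X.re * Y.im - X.im * Y.re) * wedge A B = A X * B Y - A Y * B X := by
  have e : ∀ (C : ℂ →L[ℝ] ℝ) (Z : ℂ), C Z = Z.re * C 1 + Z.im * C Complex.I := fun C Z => by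
    rw [← smul_eq_mul, ← smul_eq_mul, ← map_smul, ← map_smul, ← map_add]
    simp [Complex.re_add_im]
  rw [e A X, e A Y, e B X, e B Y]
  unfold wedge
  ring

theorem integrable_of_continuousOn_closedBall {h : ℂ → ℝ} {R : ℝ}
    (hc : ContinuousOn h (Metric.closedBall 0 R)) (h0 : ∀ z, R < ‖z‖ → h z = 0) :
    MeasureTheory.Integrable h := by
  rw [← MeasureTheory.integrableOn_iff_integrable_of_support_subset (s := Metric.closedBall 0 R)]
  · exact hc.integrableOn_compact (isCompact_closedBall 0 R)
  · intro z hz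
    by_contra hne
    exact hz (h0 z (by simpa using hne))

/-- Integration by parts: `∫ f dγ = -∫ df ∧ γ` for `f` with compact support in the open disc. -/
theorem integral_mul_curl {f : ℂ → ℝ} {γ : ℂ → ℂ →L[ℝ] ℝ} {R : ℝ} (hR : R < 1)
    (hf : ContDiffOn ℝ 1 f (Metric.ball 0 1)) (hf0 : ∀ z, R < ‖z‖ → f z = 0)
    (hγ : ContDiffOn ℝ ∞ γ (Metric.ball 0 1)) :
    ∫ z, f z * (fderiv ℝ γ z 1 Complex.I - fderiv ℝ γ z Complex.I 1) =
      -∫ z, wedge (fderiv ℝ f z) (γ z) := by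
  have hopen : IsOpen {z : ℂ | R < ‖z‖} := isOpen_lt continuous_const continuous_norm
  have hev : ∀ z : ℂ, R < ‖z‖ → f =ᶠ[𝓝 z] fun _ => 0 := fun z hz => by
    filter_upwards [hopen.mem_nhds hz] with w hw using hf0 w hw
  have hfs : ContDiff ℝ 1 f := by
    rw [contDiff_iff_contDiffAt]
    intro z
    by_cases hz : ‖z‖ < 1
    · exact hf.contDiffAt (Metric.isOpen_ball.mem_nhds (by simpa using hz))
    · exact contDiffAt_const.congr_of_eventuallyEq (hev z (by linarith))
  have hfd : Continuous (fderiv ℝ f) := hfs.continuous_fderiv (by simp)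
  have hfd0 : ∀ z : ℂ, R < ‖z‖ → fderiv ℝ f z = 0 := fun z hz => by
    rw [(hev z hz).fderiv_eq]
    simp
  have hsub : Metric.closedBall (0 : ℂ) R ⊆ Metric.ball 0 1 := Metric.closedBall_subset_ball hR
  have hγd : ContinuousOn (fderiv ℝ γ) (Metric.ball 0 1) :=
    hγ.continuousOn_fderiv_of_isOpen Metric.isOpen_ball (by simp)
  have hg : ∀ v : ℂ, ∀ z ∈ Metric.ball (0 : ℂ) 1, HasFDerivAt (fun z => γ z v)
      ((fderiv ℝ γ z).flip v) z := fun v z hz => by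
    have h1 := ((hγ.contDiffAt (Metric.isOpen_ball.mem_nhds hz)).differentiableAt
      (by simp)).hasFDerivAt
    convert! h1.clm_apply (hasFDerivAt_const v z) using 1
    ext
    simp
  have key : ∀ u v : ℂ, MeasureTheory.Integrable (fun z => f z * fderiv ℝ γ z u v) ∧
      MeasureTheory.Integrable (fun z => fderiv ℝ f z u * γ z v) ∧
      ∫ z, f z * fderiv ℝ γ z u v = -∫ z, fderiv ℝ f z u * γ z v := by
    intro u v
    have i1 : MeasureTheory.Integrable (fun z => f z * fderiv ℝ γ z u v) :=
      integrable_of_continuousOn_closedBall (R := R)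
        (hfs.continuous.continuousOn.mul
          (((hγd.mono hsub).clm_apply continuousOn_const).clm_apply continuousOn_const))
        fun z hz => by simp [hf0 z hz]
    have i2 : MeasureTheory.Integrable (fun z => fderiv ℝ f z u * γ z v) :=
      integrable_of_continuousOn_closedBall (R := R)
        ((hfd.continuousOn.clm_apply continuousOn_const).mul
          ((hγ.continuousOn.mono hsub).clm_apply continuousOn_const))
        fun z hz => by simp [hfd0 z hz]
    have i3 : MeasureTheory.Integrable (fun z => f z * γ z v) :=
      integrable_of_continuousOn_closedBall (R := R)
        (hfs.continuous.continuousOn.mul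
          ((hγ.continuousOn.mono hsub).clm_apply continuousOn_const))
        fun z hz => by simp [hf0 z hz]
    refine ⟨i1, i2, ?_⟩
    have hts : tsupport f ⊆ Metric.closedBall 0 R :=
      closure_minimal (fun z hz => by
        by_contra hne
        exact hz (hf0 z (by simpa using hne))) Metric.isClosed_closedBall
    exact integral_bilinear_hasFDerivAt_right_eq_neg_left_of_integrable
      (B := ContinuousLinearMap.mul ℝ ℝ) (f := f) (f' := fderiv ℝ f) (g := fun z => γ z v)
      (g' := fun z => (fderiv ℝ γ z).flip v) (v := u) i2 i1 i3
      (fun z _ => (hfs.differentiable (by simp) z).hasFDerivAt)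
      (fun z hz => hg v z (hsub (hts hz)))
  obtain ⟨a1, a2, a3⟩ := key 1 Complex.I
  obtain ⟨b1, b2, b3⟩ := key Complex.I 1
  simp only [mul_sub, wedge]
  rw [MeasureTheory.integral_sub a1 b1, MeasureTheory.integral_sub a2 b2, a3, b3]
  ring

/-- Change of variables, with the Jacobian determinant expressed through the images of the standard
basis vectors. -/
theorem IsOrientedEmbedding.integral_image {f : ℝ × ℝ → ℂ} {V : Set (ℝ × ℝ)}
    (h : IsOrientedEmbedding f V) (F : ℂ → ℝ) :
    ∫ z in f '' V, F z = ∫ p in V, ((fderiv ℝ f p (1, 0)).re * (fderiv ℝ f p (0, 1)).im -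
      (fderiv ℝ f p (1, 0)).im * (fderiv ℝ f p (0, 1)).re) * F (f p) := by
  let e := Complex.equivRealProdCLM
  let D : ℝ × ℝ → ℝ × ℝ →L[ℝ] ℝ × ℝ := fun p => (e : ℂ →L[ℝ] ℝ × ℝ).comp (fderiv ℝ f p)
  have hD : ∀ p ∈ V, HasFDerivWithinAt (e ∘ f) (D p) V p := fun p hp =>
    (e.hasFDerivAt.comp p ((h.contDiffAt hp).differentiableAt (by simp)).hasFDerivAt).hasFDerivWithinAt
  have hdet : ∀ p, (D p).det = (fderiv ℝ f p (1, 0)).re * (fderiv ℝ f p (0, 1)).im -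
      (fderiv ℝ f p (1, 0)).im * (fderiv ℝ f p (0, 1)).re := by
    intro p
    rw [ContinuousLinearMap.det, ← LinearMap.det_toMatrix (Module.Basis.finTwoProd ℝ),
      Matrix.det_fin_two]
    simp [LinearMap.toMatrix_apply, D, e]
    ring
  have h1 := MeasureTheory.integral_image_eq_integral_abs_det_fderiv_smul MeasureTheory.volume
    h.isOpen.measurableSet hD (e.injective.comp_injOn h.injOn) (fun q => F (e.symm q))
  have h2 := Complex.volume_preserving_equiv_real_prod.setIntegral_preimage_emb
    Complex.measurableEquivRealProd.measurableEmbedding (fun q => F (e.symm q)) (e ∘ f '' V)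
  have h3 : Complex.measurableEquivRealProd ⁻¹' (e ∘ f '' V) = f '' V := by
    rw [image_comp]
    exact preimage_image_eq _ e.injective
  rw [h3] at h2
  calc ∫ z in f '' V, F z = ∫ z in f '' V, F (e.symm (Complex.measurableEquivRealProd z)) := by
        congr 1
    _ = _ := h2
    _ = _ := h1
    _ = _ := by
      refine MeasureTheory.setIntegral_congr_fun h.isOpen.measurableSet fun p hp => ?_
      have := h.oriented p hp
      simp only [hdet, Function.comp, smul_eq_mul, ContinuousLinearEquiv.symm_apply_apply]
      rw [abs_of_pos this]

/-! ### Cutting off the ends -/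

/-- A smooth function of `s` which is `1` for `s ≤ -2` and `0` for `s ≥ -1`. -/
def stripCutoff (s : ℝ) : ℝ := Real.smoothTransition (-1 - s)

theorem contDiff_stripCutoff : ContDiff ℝ ∞ stripCutoff :=
  Real.smoothTransition.contDiff.comp (contDiff_const.sub contDiff_id)

theorem stripCutoff_eq_one {s : ℝ} (hs : s ≤ -2) : stripCutoff s = 1 :=
  Real.smoothTransition.one_of_one_le (by linarith)

theorem stripCutoff_eq_zero {s : ℝ} (hs : -1 ≤ s) : stripCutoff s = 0 :=
  Real.smoothTransition.zero_of_nonpos (by linarith)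

theorem integral_deriv_stripCutoff :
    ∫ s in Ioo (-3 : ℝ) 0, deriv stripCutoff s = -1 := by
  rw [← MeasureTheory.integral_Ioc_eq_integral_Ioo,
    ← intervalIntegral.integral_of_le (by norm_num), intervalIntegral.integral_deriv_eq_sub
      (fun s _ => contDiff_stripCutoff.differentiable (by simp) s)
      ((contDiff_stripCutoff.continuous_deriv (by simp)).intervalIntegrable _ _),
    stripCutoff_eq_zero (by norm_num), stripCutoff_eq_one (by norm_num)]
  norm_num

namespace PuncturedDisc

variable {S : PuncturedDisc}

namespace Ends

variable (E : S.Ends) (ζ : S.punctures)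

open Classical in
/-- The function on the open disc which is `stripCutoff s` on the end at `ζ`, and zero elsewhere. -/
def endCutoff (z : ℂ) : ℝ :=
  if z ∈ E.chart ζ '' innerStrip then
    stripCutoff (Function.invFunOn (E.chart ζ) innerStrip z).1 else 0

theorem endCutoff_chart {p : ℝ × ℝ} (hp : p ∈ innerStrip) :
    E.endCutoff ζ (E.chart ζ p) = stripCutoff p.1 := by
  rw [endCutoff, if_pos ⟨p, hp, rfl⟩, (E.isOrientedEmbedding_chart ζ).invFunOn_apply hp]

theorem endCutoff_mem_Icc (z : ℂ) : E.endCutoff ζ z ∈ Icc (0 : ℝ) 1 := by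
  unfold endCutoff
  split_ifs
  · exact ⟨Real.smoothTransition.nonneg _, Real.smoothTransition.le_one _⟩
  · exact ⟨le_rfl, zero_le_one⟩

theorem mem_innerStrip_of_norm_lt {p : ℝ × ℝ} (hp : p.1 < 0) (hp' : p ∈ strip)
    (h : ‖E.chart ζ p‖ < 1) : p ∈ innerStrip := by
  have h3 : E.chart ζ p ∉ S.boundary := fun hb => by
    have := hb.1
    rw [mem_sphere_zero_iff_norm] at this
    exact h.ne this
  rw [E.chart_mem_boundary ζ hp', not_or] at h3
  exact ⟨hp, lt_of_le_of_ne hp'.2.1 (Ne.symm h3.1), lt_of_le_of_ne hp'.2.2 h3.2⟩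

theorem endCutoff_eventuallyEq {p : ℝ × ℝ} (hp : p ∈ innerStrip) :
    E.endCutoff ζ =ᶠ[𝓝 (E.chart ζ p)]
      fun z => stripCutoff (Function.invFunOn (E.chart ζ) innerStrip z).1 := by
  filter_upwards [(E.isOrientedEmbedding_chart ζ).isOpen_image.mem_nhds ⟨p, hp, rfl⟩] with z hz
  rw [endCutoff, if_pos hz]

theorem endCutoff_eventuallyEq_zero {z : ℂ} (hz : ‖z‖ < 1)
    (h : z ∉ E.chart ζ '' innerStrip) : E.endCutoff ζ =ᶠ[𝓝 z] fun _ => 0 := by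
  have hsub : Iic (-1 : ℝ) ×ˢ Icc (0 : ℝ) 1 ⊆ strip :=
    prod_mono (Iic_subset_Iic.2 (by norm_num)) subset_rfl
  have hcl : z ∉ closure (E.chart ζ '' (Iic (-1 : ℝ) ×ˢ Icc (0 : ℝ) 1)) := by
    intro hcl
    rcases E.closure_chart_image ζ (isClosed_Iic.prod isClosed_Icc) hsub hcl with
      ⟨p, hp, rfl⟩ | h2
    · exact h ⟨p, E.mem_innerStrip_of_norm_lt ζ
        (lt_of_le_of_lt hp.1 (by norm_num)) (hsub hp) hz, rfl⟩
    · rw [norm_of_mem_punctures h2] at hz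
      exact lt_irrefl _ hz
  filter_upwards [isClosed_closure.isOpen_compl.mem_nhds hcl] with w hw
  unfold endCutoff
  split_ifs with hw'
  · obtain ⟨p, hp, rfl⟩ := hw'
    rw [(E.isOrientedEmbedding_chart ζ).invFunOn_apply hp]
    refine stripCutoff_eq_zero (le_of_not_ge fun hle => hw (subset_closure ⟨p, ⟨hle, ?_⟩, rfl⟩))
    exact (innerStrip_subset hp).2
  · rfl

theorem contDiffOn_endCutoff : ContDiffOn ℝ ∞ (E.endCutoff ζ) (Metric.ball 0 1) := by
  intro z hz
  rw [mem_ball_zero_iff] at hz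
  refine ContDiffAt.contDiffWithinAt ?_
  by_cases h : z ∈ E.chart ζ '' innerStrip
  · obtain ⟨p, hp, rfl⟩ := h
    have hE := E.isOrientedEmbedding_chart ζ
    refine ContDiffAt.congr_of_eventuallyEq ?_ (E.endCutoff_eventuallyEq ζ hp)
    exact contDiff_stripCutoff.contDiffAt.comp _
      (hE.contDiffOn_invFunOn.contDiffAt (hE.isOpen_image.mem_nhds ⟨p, hp, rfl⟩)).fst
  · exact contDiffAt_const.congr_of_eventuallyEq (E.endCutoff_eventuallyEq_zero ζ hz h)

theorem differentiableAt_endCutoff {z : ℂ} (hz : ‖z‖ < 1) :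
    DifferentiableAt ℝ (E.endCutoff ζ) z :=
  ((E.contDiffOn_endCutoff ζ).contDiffAt (Metric.isOpen_ball.mem_nhds (by simpa using hz))).differentiableAt
    (by simp)

theorem fderiv_endCutoff_chart {p : ℝ × ℝ} (hp : p ∈ innerStrip) (v : ℝ × ℝ) :
    fderiv ℝ (E.endCutoff ζ) (E.chart ζ p) (fderiv ℝ (E.chart ζ) p v) =
      v.1 * deriv stripCutoff p.1 := by
  have h1 := (E.differentiableAt_endCutoff ζ (E.norm_chart_lt ζ (innerStrip_subset hp) hp.2.1
    hp.2.2)).hasFDerivAt.comp p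
    (((E.isOrientedEmbedding_chart ζ).contDiffAt hp).differentiableAt (by simp)).hasFDerivAt
  have h2 : HasFDerivAt (fun p : ℝ × ℝ => stripCutoff p.1)
      ((ContinuousLinearMap.toSpanSingleton ℝ (deriv stripCutoff p.1)).comp
        (ContinuousLinearMap.fst ℝ ℝ ℝ)) p :=
    HasFDerivAt.comp (g := stripCutoff) (f := Prod.fst) p
      (contDiff_stripCutoff.differentiable (by simp) p.1).hasDerivAt.hasFDerivAt hasFDerivAt_fst
  have h3 : E.endCutoff ζ ∘ E.chart ζ =ᶠ[𝓝 p] fun p => stripCutoff p.1 := by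
    filter_upwards [isOpen_innerStrip.mem_nhds hp] with q hq using E.endCutoff_chart ζ hq
  have h4 := DFunLike.congr_fun (h1.unique (h2.congr_of_eventuallyEq h3)) v
  simpa using h4

theorem endCutoff_eq_one_near : ∃ r > 0, ∀ z ∈ Metric.ball (ζ : ℂ) r, ‖z‖ < 1 →
    E.endCutoff ζ z = 1 := by
  obtain ⟨r, hr, h⟩ := E.exists_ball_subset_chart ζ (a := -2) (by norm_num)
  refine ⟨r, hr, fun z hz hz1 => ?_⟩
  obtain ⟨p, hp, rfl⟩ := h ⟨hz, by simpa using hz1⟩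
  have hp0 : p.1 ≤ -2 := le_of_lt hp.1
  rw [E.endCutoff_chart ζ ⟨lt_of_le_of_lt hp0 (by norm_num), hp.2⟩, stripCutoff_eq_one hp0]

theorem sum_endCutoff_le_one [Fintype S.punctures] (z : ℂ) : ∑ ζ, E.endCutoff ζ z ≤ 1 := by
  by_cases h : ∃ ζ, z ∈ E.chart ζ '' innerStrip
  · obtain ⟨ζ, hζ⟩ := h
    rw [Finset.sum_eq_single ζ]
    · exact (E.endCutoff_mem_Icc ζ z).2
    · intro ζ' _ hne
      rw [endCutoff, if_neg]
      exact fun h' => (E.disjoint_chart hne).le_bot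
        ⟨image_mono innerStrip_subset h', image_mono innerStrip_subset hζ⟩
    · exact fun h => absurd (Finset.mem_univ _) h
  · rw [Finset.sum_eq_zero]
    · exact zero_le_one
    · intro ζ _
      rw [endCutoff, if_neg fun h' => h ⟨ζ, h'⟩]

/-- The part of the half-strip which contains the support of the derivative of the cutoff. -/
def cutoffRegion : Set (ℝ × ℝ) := Ioo (-3) 0 ×ˢ Ioo 0 1

theorem cutoffRegion_subset : cutoffRegion ⊆ innerStrip :=
  prod_mono Ioo_subset_Iio_self subset_rfl

theorem isOpen_cutoffRegion : IsOpen cutoffRegion := isOpen_Ioo.prod isOpen_Ioo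

theorem wedge_endCutoff_eq_zero {γ : ℂ → ℂ →L[ℝ] ℝ} {z : ℂ} (hz : ‖z‖ < 1)
    (h : z ∉ E.chart ζ '' cutoffRegion) : wedge (fderiv ℝ (E.endCutoff ζ) z) (γ z) = 0 := by
  have hd : fderiv ℝ (E.endCutoff ζ) z = 0 := by
    by_cases h' : z ∈ E.chart ζ '' innerStrip
    · obtain ⟨p, hp, rfl⟩ := h'
      have hp3 : p.1 < -2 := by
        by_contra hlt
        exact h ⟨p, ⟨⟨by linarith, hp.1⟩, hp.2⟩, rfl⟩
      have hev : E.endCutoff ζ =ᶠ[𝓝 (E.chart ζ p)] fun _ => 1 := by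
        have hE := (E.isOrientedEmbedding_chart ζ).mono (W := Iio (-2) ×ˢ Ioo 0 1)
          (isOpen_Iio.prod isOpen_Ioo) (prod_mono (Iio_subset_Iio (by norm_num)) subset_rfl)
        filter_upwards [hE.isOpen_image.mem_nhds ⟨p, ⟨hp3, hp.2⟩, rfl⟩] with w hw
        obtain ⟨q, hq, rfl⟩ := hw
        have hq0 : q.1 ≤ -2 := le_of_lt hq.1
        rw [E.endCutoff_chart ζ ⟨lt_of_le_of_lt hq0 (by norm_num), hq.2⟩, stripCutoff_eq_one hq0]
      rw [hev.fderiv_eq]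
      simp
    · rw [(E.endCutoff_eventuallyEq_zero ζ hz h').fderiv_eq]
      simp
  simp [hd, wedge]

theorem integral_wedge_endCutoff {γ : ℂ → ℂ →L[ℝ] ℝ} {c : ℝ → ℝ}
    (hc : ∀ p ∈ strip, ∀ v : ℝ × ℝ,
      γ (E.chart ζ p) (fderivWithin ℝ (E.chart ζ) strip p v) = v.2 * c p.2)
    {η : ℂ → ℝ} (hη : ∀ z, 1 ≤ ‖z‖ → η z = 0) :
    ∫ z, η z * wedge (fderiv ℝ (E.endCutoff ζ) z) (γ z) =
      ∫ p in cutoffRegion, η (E.chart ζ p) * (deriv stripCutoff p.1 * c p.2) := by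
  have hE := (E.isOrientedEmbedding_chart ζ).mono isOpen_cutoffRegion cutoffRegion_subset
  rw [← MeasureTheory.setIntegral_eq_integral_of_forall_compl_eq_zero
    (s := E.chart ζ '' cutoffRegion), hE.integral_image]
  · refine MeasureTheory.setIntegral_congr_fun isOpen_cutoffRegion.measurableSet fun p hp => ?_
    have hps := innerStrip_subset (cutoffRegion_subset hp)
    have h1 : ∀ v, γ (E.chart ζ p) (fderiv ℝ (E.chart ζ) p v) = v.2 * c p.2 := fun v => by
      rw [← hc p hps v, fderivWithin_of_mem_nhds (mem_of_superset
        (isOpen_innerStrip.mem_nhds (cutoffRegion_subset hp)) innerStrip_subset)]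
    rw [mul_left_comm, wedge_mul_det, h1, h1,
      E.fderiv_endCutoff_chart ζ (cutoffRegion_subset hp),
      E.fderiv_endCutoff_chart ζ (cutoffRegion_subset hp)]
    simp
  · intro z hz
    by_cases hz1 : ‖z‖ < 1
    · rw [E.wedge_endCutoff_eq_zero ζ hz1 hz, mul_zero]
    · rw [hη z (not_lt.1 hz1), zero_mul]

end Ends

end PuncturedDisc

/-! ### Cutting off a neighbourhood of the circle -/

/-- A smooth function which vanishes for `1 - ‖z‖² ≤ δ`, and is `1` for `1 - ‖z‖² ≥ 2 δ`. -/
def rimCutoff (δ : ℝ) (z : ℂ) : ℝ := Real.smoothTransition ((1 - ‖z‖ ^ 2) / δ - 1)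

theorem contDiff_rimCutoff (δ : ℝ) : ContDiff ℝ ∞ (rimCutoff δ) :=
  Real.smoothTransition.contDiff.comp
    (((contDiff_const.sub (contDiff_norm_sq ℝ)).div_const δ).sub contDiff_const)

theorem rimCutoff_eq_zero {δ : ℝ} (hδ : 0 < δ) {z : ℂ} (hz : 1 - δ ≤ ‖z‖ ^ 2) :
    rimCutoff δ z = 0 :=
  Real.smoothTransition.zero_of_nonpos (by
    rw [sub_nonpos, div_le_one hδ]
    linarith)

theorem rimCutoff_mem_Icc (δ : ℝ) (z : ℂ) : rimCutoff δ z ∈ Icc (0 : ℝ) 1 :=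
  ⟨Real.smoothTransition.nonneg _, Real.smoothTransition.le_one _⟩

theorem wedge_rimCutoff (δ : ℝ) (z : ℂ) (B : ℂ →L[ℝ] ℝ) :
    wedge (fderiv ℝ (rimCutoff δ) z) B =
      deriv Real.smoothTransition ((1 - ‖z‖ ^ 2) / δ - 1) * (-(2 / δ) * B (Complex.I * z)) := by
  have h1 : HasFDerivAt (fun z : ℂ => (1 - ‖z‖ ^ 2) / δ - 1)
      (δ⁻¹ • -((2 : ℕ) • innerSL ℝ z) : ℂ →L[ℝ] ℝ) z := by
    simp only [div_eq_mul_inv, mul_comm _ δ⁻¹]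
    exact (((hasStrictFDerivAt_norm_sq z).hasFDerivAt.const_sub 1).const_mul δ⁻¹).sub_const 1
  have h2 : HasFDerivAt (rimCutoff δ) _ z :=
    HasDerivAt.comp_hasFDerivAt (h₂ := Real.smoothTransition) z
      ((Real.smoothTransition.contDiff (n := 1)).differentiable (by simp) _).hasDerivAt h1
  have h3 : B (Complex.I * z) = z.re * B Complex.I - z.im * B 1 := by
    have : Complex.I * z = z.re • Complex.I - z.im • (1 : ℂ) := by
      apply Complex.ext <;> simp
    rw [this, map_sub, map_smul, map_smul, smul_eq_mul, smul_eq_mul]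
  rw [h2.fderiv, wedge, h3]
  simp [Complex.inner]
  ring

theorem exists_bound_deriv_smoothTransition :
    ∃ M : ℝ, 0 ≤ M ∧ ∀ x, |deriv Real.smoothTransition x| ≤ M := by
  have hc : Continuous (deriv Real.smoothTransition) :=
    (Real.smoothTransition.contDiff (n := 1)).continuous_deriv (by simp)
  obtain ⟨M, hM⟩ := (isCompact_Icc (a := (0 : ℝ)) (b := 1)).exists_bound_of_continuousOn
    hc.continuousOn
  refine ⟨M, (norm_nonneg _).trans (hM 0 (by simp)), fun x => ?_⟩
  by_cases hx : x ∈ Icc (0 : ℝ) 1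
  · exact hM x hx
  have h0 : deriv Real.smoothTransition x = 0 := by
    rcases not_and_or.1 hx with hx | hx
    · have : Real.smoothTransition =ᶠ[𝓝 x] fun _ => 0 := by
        filter_upwards [Iio_mem_nhds (not_le.1 hx)] with y hy
        exact Real.smoothTransition.zero_of_nonpos (le_of_lt hy)
      rw [this.deriv_eq]
      simp
    · have : Real.smoothTransition =ᶠ[𝓝 x] fun _ => 1 := by
        filter_upwards [Ioi_mem_nhds (not_le.1 hx)] with y hy
        exact Real.smoothTransition.one_of_one_le (le_of_lt hy)
      rw [this.deriv_eq]
      simp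
  rw [h0, abs_zero]
  exact (norm_nonneg _).trans (hM 0 (by simp))

theorem wedge_rimCutoff_eq_zero {δ : ℝ} (hδ : 0 < δ) {z : ℂ}
    (hz : ‖z‖ ^ 2 ∉ Icc (1 - 2 * δ) (1 - δ)) (B : ℂ →L[ℝ] ℝ) :
    wedge (fderiv ℝ (rimCutoff δ) z) B = 0 := by
  have hcont : Continuous fun z : ℂ => (1 - ‖z‖ ^ 2) / δ - 1 := by fun_prop
  have : fderiv ℝ (rimCutoff δ) z = 0 := by
    rcases not_and_or.1 hz with hz | hz
    · have hz' : 1 < (1 - ‖z‖ ^ 2) / δ - 1 := by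
        rw [lt_sub_iff_add_lt, lt_div_iff₀ hδ]
        linarith
      have : rimCutoff δ =ᶠ[𝓝 z] fun _ => 1 := by
        filter_upwards [(isOpen_lt continuous_const hcont).mem_nhds hz'] with w hw
        exact Real.smoothTransition.one_of_one_le (le_of_lt hw)
      rw [this.fderiv_eq]
      simp
    · have hz' : (1 - ‖z‖ ^ 2) / δ - 1 < 0 := by
        rw [sub_neg, div_lt_one hδ]
        linarith
      have : rimCutoff δ =ᶠ[𝓝 z] fun _ => 0 := by
        filter_upwards [(isOpen_lt hcont continuous_const).mem_nhds hz'] with w hw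
        exact Real.smoothTransition.zero_of_nonpos (le_of_lt hw)
      rw [this.fderiv_eq]
      simp
  simp [this, wedge]

theorem volume_annulus {δ : ℝ} (hδ : 0 < δ) (hδ' : 2 * δ ≤ 1) :
    MeasureTheory.volume {z : ℂ | ‖z‖ ^ 2 ∈ Icc (1 - 2 * δ) (1 - δ)} =
      ENNReal.ofReal (Real.pi * δ) := by
  have e : {z : ℂ | ‖z‖ ^ 2 ∈ Icc (1 - 2 * δ) (1 - δ)} =
      Metric.closedBall 0 (Real.sqrt (1 - δ)) \ Metric.ball 0 (Real.sqrt (1 - 2 * δ)) := by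
    ext z
    simp only [mem_ofPred_eq, mem_Icc, Set.mem_sdiff, Metric.mem_closedBall, dist_zero_right,
      Metric.mem_ball, not_lt]
    rw [Real.le_sqrt (norm_nonneg _) (by linarith), Real.sqrt_le_left (norm_nonneg _)]
    exact and_comm
  rw [e, MeasureTheory.measure_sdiff (Metric.ball_subset_closedBall.trans
      (Metric.closedBall_subset_closedBall (Real.sqrt_le_sqrt (by linarith))))
      Metric.isOpen_ball.measurableSet.nullMeasurableSet (by simp [Complex.volume_ball]; finiteness),
    Complex.volume_closedBall, Complex.volume_ball, ← ENNReal.ofReal_pow (Real.sqrt_nonneg _),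
    ← ENNReal.ofReal_pow (Real.sqrt_nonneg _), Real.sq_sqrt (by linarith),
    Real.sq_sqrt (by linarith), ← NNReal.coe_real_pi, ENNReal.ofReal_mul NNReal.pi.coe_nonneg,
    ENNReal.ofReal_coe_nnreal, ← ENNReal.sub_mul (by simp), ← ENNReal.ofReal_sub _ (by linarith),
    mul_comm]
  congr 2
  ring

/-! ### Emptiness -/

namespace PuncturedDisc

variable {S : PuncturedDisc}

namespace Ends

variable (E : S.Ends)

/-- As the rim cutoff tends to one, the contribution of an end to the integration by parts converges to
minus the flux of `γ` through that end. -/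
theorem tendsto_integral_wedge_endCutoff (ζ : S.punctures) {γ : ℂ → ℂ →L[ℝ] ℝ} {c : ℝ → ℝ}
    (hcs : ContDiffOn ℝ ∞ c (Icc 0 1)) (hc : ∀ p ∈ strip, ∀ v : ℝ × ℝ,
      γ (E.chart ζ p) (fderivWithin ℝ (E.chart ζ) strip p v) = v.2 * c p.2) :
    Tendsto (fun δ => ∫ z, rimCutoff δ z * wedge (fderiv ℝ (E.endCutoff ζ) z) (γ z)) (𝓝[>] 0)
      (𝓝 (-∫ t in (0 : ℝ)..1, c t)) := by
  have hlim : Tendsto (fun δ => ∫ p in cutoffRegion,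
      rimCutoff δ (E.chart ζ p) * (deriv stripCutoff p.1 * c p.2)) (𝓝[>] 0)
      (𝓝 (∫ p in cutoffRegion, deriv stripCutoff p.1 * c p.2)) := by
    have hcont : ContinuousOn (fun p : ℝ × ℝ => deriv stripCutoff p.1 * c p.2)
        (Icc (-3) 0 ×ˢ Icc 0 1) :=
      ((contDiff_stripCutoff.continuous_deriv (by simp)).comp continuous_fst).continuousOn.mul
        (hcs.continuousOn.comp continuousOn_snd fun p hp => hp.2)
    have hsub : cutoffRegion ⊆ Icc (-3) 0 ×ˢ Icc 0 1 :=
      Set.prod_mono Ioo_subset_Icc_self Ioo_subset_Icc_self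
    have hint : MeasureTheory.IntegrableOn (fun p : ℝ × ℝ => deriv stripCutoff p.1 * c p.2)
        cutoffRegion :=
      (hcont.integrableOn_compact (isCompact_Icc.prod isCompact_Icc)).mono_set hsub
    refine MeasureTheory.tendsto_integral_filter_of_dominated_convergence
      (fun p => ‖deriv stripCutoff p.1 * c p.2‖) (Eventually.of_forall fun δ => ?_)
      (Eventually.of_forall fun δ => Eventually.of_forall fun p => ?_) hint.norm ?_
    · refine ContinuousOn.aestronglyMeasurable ?_ isOpen_cutoffRegion.measurableSet
      exact ((contDiff_rimCutoff δ).continuous.comp_continuousOn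
        ((E.chart_contDiffOn ζ).continuousOn.mono
          (cutoffRegion_subset.trans innerStrip_subset))).mul (hcont.mono hsub)
    · rw [norm_mul]
      refine mul_le_of_le_one_left (norm_nonneg _) ?_
      rw [Real.norm_of_nonneg (rimCutoff_mem_Icc δ _).1]
      exact (rimCutoff_mem_Icc δ _).2
    · rw [MeasureTheory.ae_restrict_iff' isOpen_cutoffRegion.measurableSet]
      refine Eventually.of_forall fun p hp => ?_
      have h1 : 0 < 1 - ‖E.chart ζ p‖ ^ 2 := by
        have := E.norm_chart_lt ζ (innerStrip_subset (cutoffRegion_subset hp)) hp.2.1 hp.2.2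
        nlinarith [norm_nonneg (E.chart ζ p)]
      refine tendsto_const_nhds.congr' ?_
      filter_upwards [Ioo_mem_nhdsGT (half_pos h1)] with δ hδ
      have : rimCutoff δ (E.chart ζ p) = 1 := by
        refine Real.smoothTransition.one_of_one_le ?_
        rw [le_sub_iff_add_le, le_div_iff₀ hδ.1]
        linarith [hδ.2]
      rw [this, one_mul]
  have hval : ∫ p in cutoffRegion, deriv stripCutoff p.1 * c p.2 = -∫ t in (0 : ℝ)..1, c t := by
    rw [cutoffRegion, MeasureTheory.Measure.volume_eq_prod, MeasureTheory.setIntegral_prod_mul,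
      integral_deriv_stripCutoff, intervalIntegral.integral_of_le zero_le_one,
      MeasureTheory.integral_Ioc_eq_integral_Ioo]
    ring
  have heq : ∀ δ : ℝ, 0 < δ → ∫ z, rimCutoff δ z * wedge (fderiv ℝ (E.endCutoff ζ) z) (γ z) =
      ∫ p in cutoffRegion, rimCutoff δ (E.chart ζ p) * (deriv stripCutoff p.1 * c p.2) := by
    intro δ hδ
    refine E.integral_wedge_endCutoff ζ hc fun z hz => rimCutoff_eq_zero hδ ?_
    have : (1 : ℝ) ≤ ‖z‖ ^ 2 := one_le_pow₀ hz
    linarith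
  rw [hval] at hlim
  exact hlim.congr' (eventually_nhdsWithin_of_forall fun δ hδ => (heq δ hδ).symm)

/-- The derivative of the rim cutoff is of order `1/δ` on an annulus of area of order `δ`, and is paired
with the rotational component of `γ`, which tends to zero at the boundary. -/
theorem tendsto_integral_wedge_rimCutoff {γ : ℂ → ℂ →L[ℝ] ℝ}
    (hγ : ContDiffOn ℝ ∞ γ S.surface) (htan : ∀ z ∈ S.boundary, γ z (Complex.I * z) = 0)
    {χ : ℂ → ℝ} (hχ : ∀ z, χ z ∈ Icc (0 : ℝ) 1)
    (hχ0 : ∀ ζ ∈ S.punctures, ∃ r > 0, ∀ z ∈ Metric.ball ζ r, ‖z‖ < 1 → χ z = 0) :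
    Tendsto (fun δ => ∫ z, χ z * wedge (fderiv ℝ (rimCutoff δ) z) (γ z)) (𝓝[>] 0) (𝓝 0) := by
  obtain ⟨M, hM0, hM⟩ := exists_bound_deriv_smoothTransition
  choose! r hr hrχ using hχ0
  -- `χ` vanishes, in the open disc, outside a compact subset of the surface
  let K : Set ℂ := Metric.closedBall 0 1 \ ⋃ ζ ∈ S.punctures, Metric.ball ζ (r ζ)
  have hKc : IsCompact K := (isCompact_closedBall (0 : ℂ) 1).diff
    (isOpen_biUnion fun _ _ => Metric.isOpen_ball)
  have hKS : K ⊆ S.surface := fun z hz => ⟨hz.1, fun h =>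
    hz.2 (mem_biUnion h (Metric.mem_ball_self (hr z h)))⟩
  have hχK : ∀ z, ‖z‖ < 1 → z ∉ K → χ z = 0 := by
    intro z hz hzK
    have : z ∈ ⋃ ζ ∈ S.punctures, Metric.ball ζ (r ζ) := by
      by_contra h
      exact hzK ⟨by simpa using hz.le, h⟩
    obtain ⟨ζ, hζ, hzζ⟩ := mem_iUnion₂.1 this
    exact hrχ ζ hζ z hzζ hz
  have hgc : ContinuousOn (fun z => |γ z (Complex.I * z)|) K :=
    ((hγ.continuousOn.mono hKS).clm_apply (continuous_const.mul continuous_id).continuousOn).abs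
  have hsmall : ∀ e > 0, ∃ d > 0, ∀ z ∈ K, 1 - d ≤ ‖z‖ ^ 2 → |γ z (Complex.I * z)| < e := by
    intro e he
    by_contra! H
    have hL : IsCompact (K ∩ {z | e ≤ |γ z (Complex.I * z)|}) :=
      hKc.of_isClosed_subset (hgc.preimage_isClosed_of_isClosed hKc.isClosed isClosed_Ici)
        inter_subset_left
    obtain ⟨z0, hz0, -, -⟩ := H 1 one_pos
    obtain ⟨z1, hz1, -, hz1e⟩ := H 1 one_pos
    obtain ⟨z, hz, hmax⟩ := hL.exists_isMaxOn ⟨z1, hz1, hz1e⟩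
      (f := fun z : ℂ => ‖z‖ ^ 2) (by fun_prop)
    have hlt : ‖z‖ < 1 := by
      refine lt_of_le_of_ne (by simpa using hz.1.1) fun h1 => ?_
      have := htan z ⟨by simpa using h1, (hKS hz.1).2⟩
      have h2 : e ≤ |γ z (Complex.I * z)| := hz.2
      rw [this, abs_zero] at h2
      linarith
    have hpos : 0 < (1 - ‖z‖ ^ 2) / 2 := by nlinarith [norm_nonneg z]
    obtain ⟨w, hw, hwn, hwe⟩ := H _ hpos
    have : ‖w‖ ^ 2 ≤ ‖z‖ ^ 2 := hmax ⟨hw, hwe⟩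
    linarith
  rw [Metric.tendsto_nhds]
  intro e he
  have he' : 0 < e / (2 * Real.pi * M + 1) := by positivity
  obtain ⟨d, hd, hdK⟩ := hsmall _ he'
  filter_upwards [Ioo_mem_nhdsGT (lt_min (half_pos hd) (half_pos one_pos))] with δ hδ
  have hδ0 : 0 < δ := hδ.1
  have hδd : 2 * δ < d := by linarith [hδ.2.trans_le (min_le_left _ _)]
  have hδ1 : 2 * δ < 1 := by linarith [hδ.2.trans_le (min_le_right _ _)]
  set e' := e / (2 * Real.pi * M + 1)
  have hvol := volume_annulus hδ0 hδ1.le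
  have hbound : ∀ z : ℂ, ‖z‖ ^ 2 ∈ Icc (1 - 2 * δ) (1 - δ) →
      ‖χ z * wedge (fderiv ℝ (rimCutoff δ) z) (γ z)‖ ≤ M * (2 / δ * e') := by
    intro z hz
    have hz1 : ‖z‖ < 1 := by nlinarith [hz.2, norm_nonneg z]
    by_cases hzK : z ∈ K
    · have h1 := hdK z hzK (by linarith [hz.1])
      rw [wedge_rimCutoff, norm_mul, norm_mul, Real.norm_of_nonneg (hχ z).1]
      have h2 : ‖-(2 / δ) * γ z (Complex.I * z)‖ ≤ 2 / δ * e' := by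
        rw [norm_mul, norm_neg, Real.norm_of_nonneg (by positivity)]
        exact mul_le_mul_of_nonneg_left h1.le (by positivity)
      calc _ ≤ 1 * (M * (2 / δ * e')) := by
            refine mul_le_mul (hχ z).2 (mul_le_mul (hM _) h2 (norm_nonneg _) hM0)
              (by positivity) zero_le_one
        _ = _ := one_mul _
    · rw [hχK z hz1 hzK, zero_mul, norm_zero]
      positivity
  rw [dist_zero_right, ← MeasureTheory.setIntegral_eq_integral_of_forall_compl_eq_zero
    (s := {z : ℂ | ‖z‖ ^ 2 ∈ Icc (1 - 2 * δ) (1 - δ)})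
    fun z hz => by rw [wedge_rimCutoff_eq_zero hδ0 hz, mul_zero]]
  have h3 := MeasureTheory.norm_setIntegral_le_of_norm_le_const
    (s := {z : ℂ | ‖z‖ ^ 2 ∈ Icc (1 - 2 * δ) (1 - δ)})
    (by rw [hvol]; exact ENNReal.ofReal_lt_top) hbound
  refine h3.trans_lt ?_
  rw [MeasureTheory.measureReal_def, hvol, ENNReal.toReal_ofReal (by positivity)]
  have h4 : M * (2 / δ * e') * (Real.pi * δ) = 2 * Real.pi * M * e' := by
    field_simp
  rw [h4]
  have h5 : (2 * Real.pi * M + 1) * e' = e := by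
    simp only [e']
    field_simp
  nlinarith

/-- If all ends are positive, the flux of a profile through the ends contradicts `dγ ≤ 0`.  The test
function for Stokes' theorem is the product of `1 - ∑ endCutoff`, which removes the ends, and the rim
cutoff, which removes the boundary, where only tangential information on `γ` is available. -/
theorem not_isProfile (hneg : S.neg = ∅) (γ : ℂ → ℂ →L[ℝ] ℝ) : ¬E.IsProfile γ := by
  intro hγ
  have := S.finite_punctures.fintype
  have hsign : ∀ ζ, E.sign ζ = -1 := fun ζ => by simp [sign, hneg]
  have hends := fun ζ => (E.ends_condition_iff ζ).1 (hγ.ends ζ)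
  choose c hc hc0 hcp using hends
  have hc0' : ∀ ζ, 0 < -∫ t in (0 : ℝ)..1, c ζ t := fun ζ => by
    have := hc0 ζ
    rw [hsign] at this
    linarith
  let χ : ℂ → ℝ := fun z => 1 - ∑ ζ, E.endCutoff ζ z
  have hχ : ∀ z, χ z ∈ Icc (0 : ℝ) 1 := fun z =>
    ⟨sub_nonneg.2 (E.sum_endCutoff_le_one z),
      sub_le_self _ (Finset.sum_nonneg fun ζ _ => (E.endCutoff_mem_Icc ζ z).1)⟩
  have hχ0 : ∀ ζ ∈ S.punctures, ∃ r > 0, ∀ z ∈ Metric.ball ζ r, ‖z‖ < 1 → χ z = 0 := by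
    intro ζ hζ
    obtain ⟨r, hr, h⟩ := E.endCutoff_eq_one_near ⟨ζ, hζ⟩
    refine ⟨r, hr, fun z hz hz1 => le_antisymm ?_ (hχ z).1⟩
    have h1 := Finset.single_le_sum (f := fun ζ => E.endCutoff ζ z)
      (fun ζ _ => (E.endCutoff_mem_Icc ζ z).1) (Finset.mem_univ ⟨ζ, hζ⟩)
    simp only [h z hz hz1] at h1
    exact sub_nonpos.2 h1
  have hχs : ContDiffOn ℝ ∞ χ (Metric.ball 0 1) :=
    contDiffOn_const.sub (ContDiffOn.sum fun ζ _ => E.contDiffOn_endCutoff ζ)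
  have hγb : ContDiffOn ℝ ∞ γ (Metric.ball 0 1) := hγ.smooth.mono S.ball_subset_surface
  have hlim1 := tendsto_finsetSum Finset.univ fun ζ _ =>
    E.tendsto_integral_wedge_endCutoff ζ (hc ζ) (hcp ζ)
  have hlim2 := tendsto_integral_wedge_rimCutoff hγ.smooth hγ.tangential hχ hχ0
  have hle := le_of_tendsto_of_tendsto hlim1 hlim2 ?_
  · have hpos : 0 < ∑ ζ, -∫ t in (0 : ℝ)..1, c ζ t := by
      refine Finset.sum_pos (fun ζ _ => hc0' ζ) ?_
      rcases S.exists_puncture with ⟨ζ, hζ⟩ | ⟨ζ, hζ⟩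
      · exact ⟨⟨ζ, Or.inl hζ⟩, Finset.mem_univ _⟩
      · exact ⟨⟨ζ, Or.inr hζ⟩, Finset.mem_univ _⟩
    linarith
  filter_upwards [Ioo_mem_nhdsGT one_pos] with δ hδ
  have hδ0 : 0 < δ := hδ.1
  have hR : Real.sqrt (1 - δ) < 1 := by
    rw [Real.sqrt_lt' one_pos]
    linarith
  have hrim : ∀ z : ℂ, Real.sqrt (1 - δ) < ‖z‖ → rimCutoff δ z = 0 := fun z hz =>
    rimCutoff_eq_zero hδ0 ((Real.sqrt_lt' ((Real.sqrt_nonneg _).trans_lt hz)).1 hz).le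
  have hf0 : ∀ z : ℂ, Real.sqrt (1 - δ) < ‖z‖ → χ z * rimCutoff δ z = 0 := fun z hz => by
    rw [hrim z hz, mul_zero]
  have key := integral_mul_curl (f := fun z => χ z * rimCutoff δ z) hR
    ((hχs.mul (contDiff_rimCutoff δ).contDiffOn).of_le (by simp)) hf0 hγb
  have hnonpos : ∫ z, χ z * rimCutoff δ z *
      (fderiv ℝ γ z 1 Complex.I - fderiv ℝ γ z Complex.I 1) ≤ 0 := by
    refine MeasureTheory.integral_nonpos fun z => ?_
    by_cases hz : ‖z‖ < 1
    · have := hγ.curl_nonpos z (S.ball_subset_surface (by simpa using hz))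
      rw [fderivWithin_of_mem_nhds (S.surface_mem_nhds hz)] at this
      exact mul_nonpos_of_nonneg_of_nonpos
        (mul_nonneg (hχ z).1 (Real.smoothTransition.nonneg _)) this
    · rw [hf0 z (by linarith), zero_mul]
      exact le_rfl
  rw [key, neg_nonpos] at hnonpos
  have hcont1 : ∀ ζ, MeasureTheory.Integrable
      (fun z => rimCutoff δ z * wedge (fderiv ℝ (E.endCutoff ζ) z) (γ z)) := by
    intro ζ
    have hsub : Metric.closedBall (0 : ℂ) (Real.sqrt (1 - δ)) ⊆ Metric.ball 0 1 :=
      Metric.closedBall_subset_ball hR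
    have hd : ContinuousOn (fderiv ℝ (E.endCutoff ζ)) (Metric.ball 0 1) :=
      (E.contDiffOn_endCutoff ζ).continuousOn_fderiv_of_isOpen Metric.isOpen_ball (by simp)
    refine integrable_of_continuousOn_closedBall (R := Real.sqrt (1 - δ)) ?_
      fun z hz => by rw [hrim z hz, zero_mul]
    refine (contDiff_rimCutoff δ).continuous.continuousOn.mul ?_
    exact (((hd.clm_apply continuousOn_const).mul
      (hγb.continuousOn.clm_apply continuousOn_const)).sub
      ((hd.clm_apply continuousOn_const).mul
      (hγb.continuousOn.clm_apply continuousOn_const))).mono hsub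
  have hcont2 : MeasureTheory.Integrable
      (fun z => χ z * wedge (fderiv ℝ (rimCutoff δ) z) (γ z)) := by
    have hsub : Metric.closedBall (0 : ℂ) (Real.sqrt (1 - δ)) ⊆ Metric.ball 0 1 :=
      Metric.closedBall_subset_ball hR
    have hd : Continuous (fderiv ℝ (rimCutoff δ)) :=
      (contDiff_rimCutoff δ).continuous_fderiv (by simp)
    refine integrable_of_continuousOn_closedBall (R := Real.sqrt (1 - δ)) ?_ fun z hz => ?_
    · refine (hχs.continuousOn.mono hsub).mul ?_
      exact ((hd.continuousOn.clm_apply continuousOn_const).mul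
        ((hγb.continuousOn.mono hsub).clm_apply continuousOn_const)).sub
        ((hd.continuousOn.clm_apply continuousOn_const).mul
        ((hγb.continuousOn.mono hsub).clm_apply continuousOn_const))
    · rw [wedge_rimCutoff_eq_zero hδ0, mul_zero]
      rintro ⟨-, h2⟩
      exact absurd ((Real.sqrt_lt' ((Real.sqrt_nonneg _).trans_lt hz)).1 hz) (not_lt.2 h2)
  have hsplit : ∫ z, wedge (fderiv ℝ (fun z => χ z * rimCutoff δ z) z) (γ z) =
      ∫ z, (χ z * wedge (fderiv ℝ (rimCutoff δ) z) (γ z) -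
        ∑ ζ, rimCutoff δ z * wedge (fderiv ℝ (E.endCutoff ζ) z) (γ z)) := by
    congr 1
    funext z
    by_cases hz : ‖z‖ < 1
    · have h1 : HasFDerivAt χ (-∑ ζ, fderiv ℝ (E.endCutoff ζ) z) z :=
        (HasFDerivAt.fun_sum fun ζ _ =>
          (E.differentiableAt_endCutoff ζ hz).hasFDerivAt).const_sub 1
      have h2 := h1.fun_mul ((contDiff_rimCutoff δ).differentiable (by simp) z).hasFDerivAt
      rw [h2.fderiv]
      simp only [wedge, add_apply, smul_apply, smul_eq_mul, neg_apply,
        _root_.sum_apply]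
      rw [← Finset.mul_sum, Finset.sum_sub_distrib, ← Finset.sum_mul, ← Finset.sum_mul]
      ring
    · have hz' : Real.sqrt (1 - δ) < ‖z‖ := by linarith
      have hev : (fun z => χ z * rimCutoff δ z) =ᶠ[𝓝 z] fun _ => 0 := by
        filter_upwards [(isOpen_lt continuous_const continuous_norm).mem_nhds hz'] with w hw
          using hf0 w hw
      have hz2 : ‖z‖ ^ 2 ∉ Icc (1 - 2 * δ) (1 - δ) := fun h => by
        nlinarith [h.2, norm_nonneg z]
      rw [hev.fderiv_eq, wedge_rimCutoff_eq_zero hδ0 hz2]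
      simp [wedge, hrim z hz']
  rw [hsplit, MeasureTheory.integral_sub hcont2 (MeasureTheory.integrable_finsetSum _
    fun ζ _ => hcont1 ζ), MeasureTheory.integral_finsetSum _ fun ζ _ => hcont1 ζ] at hnonpos
  linarith

end Ends

end PuncturedDisc

/-! ### Gluing smooth functions along a flat boundary -/

/-- A smooth function on a closed set, all of whose derivatives vanish on the frontier, can be
extended by zero. -/
theorem contDiff_indicator_of_flat {E F : Type} [NormedAddCommGroup E] [NormedSpace ℝ E]
    [NormedAddCommGroup F] [NormedSpace ℝ F] {s : Set E} (hs : IsClosed s)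
    (hu : UniqueDiffOn ℝ s) {w : E → F} (hw : ContDiffOn ℝ ∞ w s)
    (h0 : ∀ k : ℕ, ∀ x ∈ frontier s, iteratedFDerivWithin ℝ k w s x = 0) :
    ContDiff ℝ ∞ (s.indicator w) := by
  rw [contDiff_infty]
  intro n
  induction n generalizing F with
  | zero =>
    rw [Nat.cast_zero, contDiff_zero]
    refine continuous_indicator (fun x hx => ?_) (hs.closure_eq.symm ▸ hw.continuousOn)
    have := h0 0 x hx
    rwa [← norm_eq_zero, norm_iteratedFDerivWithin_zero, norm_eq_zero] at this
  | succ n ih =>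
    rw [Nat.cast_succ, contDiff_succ_iff_hasFDerivAt]
    refine ⟨s.indicator (fderivWithin ℝ w s), ih (hw.fderivWithin hu (by simp)) ?_, ?_⟩
    · intro k x hx
      have := h0 (k + 1) x hx
      rw [← norm_eq_zero] at this ⊢
      rwa [norm_iteratedFDerivWithin_fderivWithin hu (hs.frontier_subset hx)]
    · intro x
      by_cases hx : x ∈ s
      · have hd := (hw.differentiableOn (by simp) x hx).hasFDerivWithinAt
        by_cases hxi : x ∈ interior s
        · have hn := mem_interior_iff_mem_nhds.1 hxi
          rw [indicator_of_mem hx]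
          refine (hd.hasFDerivAt hn).congr_of_eventuallyEq ?_
          filter_upwards [hn] with y hy using indicator_of_mem hy w
        · have hxf : x ∈ frontier s := ⟨subset_closure hx, hxi⟩
          have e0 : w x = 0 := by
            have := h0 0 x hxf
            rwa [← norm_eq_zero, norm_iteratedFDerivWithin_zero, norm_eq_zero] at this
          have e1 : fderivWithin ℝ w s x = 0 := by
            have := h0 1 x hxf
            rw [← norm_eq_zero] at this ⊢
            rw [← this, ← zero_add 1, ← norm_iteratedFDerivWithin_fderivWithin hu hx,
              norm_iteratedFDerivWithin_zero]
          rw [indicator_of_mem hx, ← hasFDerivWithinAt_univ, ← union_compl_self s]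
          refine HasFDerivWithinAt.union
            (hd.congr (fun y hy => indicator_of_mem hy w) (indicator_of_mem hx w)) ?_
          rw [e1]
          exact (hasFDerivWithinAt_const (0 : F) x sᶜ).congr
            (fun y hy => indicator_of_notMem hy w) (by rw [indicator_of_mem hx, e0])
      · rw [indicator_of_notMem hx]
        refine (hasFDerivAt_const (0 : F) x).congr_of_eventuallyEq ?_
        filter_upwards [hs.isOpen_compl.mem_nhds hx] with y hy using indicator_of_notMem hy w

/-! ### Normal derivatives on the half-plane -/

/-- The half-plane of points with nonpositive first coordinate. -/
def leftHalf : Set (ℝ × ℝ) := Iic 0 ×ˢ univ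

theorem isClosed_leftHalf : IsClosed leftHalf := isClosed_Iic.prod isClosed_univ

theorem uniqueDiffOn_leftHalf : UniqueDiffOn ℝ leftHalf :=
  (uniqueDiffOn_Iic _).prod uniqueDiffOn_univ

theorem mem_leftHalf {p : ℝ × ℝ} : p ∈ leftHalf ↔ p.1 ≤ 0 := by simp [leftHalf]

theorem leftHalf_subset_closure_interior : leftHalf ⊆ closure (interior leftHalf) := by
  rw [leftHalf, interior_prod_eq, closure_prod_eq, interior_Iic, closure_Iio, interior_univ,
    closure_univ]

section

variable {F : Type} [NormedAddCommGroup F] [NormedSpace ℝ F]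

/-- The derivative in the direction of the first coordinate, within the left half-plane. -/
def normalDeriv (w : ℝ × ℝ → F) (p : ℝ × ℝ) : F := fderivWithin ℝ w leftHalf p (1, 0)

theorem ContDiffOn.normalDeriv {w : ℝ × ℝ → F} (hw : ContDiffOn ℝ ∞ w leftHalf) :
    ContDiffOn ℝ ∞ (normalDeriv w) leftHalf :=
  (hw.fderivWithin uniqueDiffOn_leftHalf (by simp)).clm_apply contDiffOn_const

theorem ContDiffOn.iterate_normalDeriv {w : ℝ × ℝ → F} (hw : ContDiffOn ℝ ∞ w leftHalf) (k : ℕ) :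
    ContDiffOn ℝ ∞ (_root_.normalDeriv^[k] w) leftHalf := by
  induction k generalizing w with
  | zero => exact hw
  | succ k ih => exact ih hw.normalDeriv

theorem normalDeriv_congr {w w' : ℝ × ℝ → F} (h : EqOn w w' leftHalf) :
    EqOn (normalDeriv w) (normalDeriv w') leftHalf := fun p hp => by
  rw [normalDeriv, normalDeriv, fderivWithin_congr h (h hp)]

theorem iterate_normalDeriv_congr {w w' : ℝ × ℝ → F} (h : EqOn w w' leftHalf) (k : ℕ) :
    EqOn (normalDeriv^[k] w) (normalDeriv^[k] w') leftHalf := by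
  induction k generalizing w w' with
  | zero => exact h
  | succ k ih => exact ih (normalDeriv_congr h)

theorem iterate_normalDeriv_sub {w w' : ℝ × ℝ → F} (hw : ContDiffOn ℝ ∞ w leftHalf)
    (hw' : ContDiffOn ℝ ∞ w' leftHalf) (k : ℕ) :
    EqOn (normalDeriv^[k] fun p => w p - w' p)
      (fun p => normalDeriv^[k] w p - normalDeriv^[k] w' p) leftHalf := by
  induction k generalizing w w' with
  | zero => exact fun _ _ => rfl
  | succ k ih =>
    refine EqOn.trans (iterate_normalDeriv_congr (w' := fun p => normalDeriv w p - normalDeriv w' p)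
      (fun p hp => ?_) k) (ih hw.normalDeriv hw'.normalDeriv)
    simp only [normalDeriv]
    rw [fderivWithin_fun_sub (uniqueDiffOn_leftHalf p hp) (hw.differentiableOn (by simp) p hp)
      (hw'.differentiableOn (by simp) p hp)]
    rfl

theorem normalDeriv_fderivWithin {w : ℝ × ℝ → F} (hw : ContDiffOn ℝ ∞ w leftHalf) :
    EqOn (normalDeriv (fderivWithin ℝ w leftHalf)) (fderivWithin ℝ (normalDeriv w) leftHalf)
      leftHalf := by
  intro p hp
  have h2 : (2 : WithTop ℕ∞) ≤ ∞ := WithTop.coe_le_coe.2 (le_top : (2 : ℕ∞) ≤ ⊤)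
  have hs : IsSymmSndFDerivWithinAt ℝ w leftHalf p :=
    (hw p hp).isSymmSndFDerivWithinAt (by simpa using h2) uniqueDiffOn_leftHalf
      (leftHalf_subset_closure_interior hp) hp
  have hd := ((hw.fderivWithin uniqueDiffOn_leftHalf (m := ∞) (by simp)).differentiableOn
    (by simp) p hp).hasFDerivWithinAt
  have h1 := (hd.clm_apply (hasFDerivWithinAt_const ((1 : ℝ), (0 : ℝ)) p leftHalf)).fderivWithin
    (uniqueDiffOn_leftHalf p hp)
  refine ContinuousLinearMap.ext fun v => ?_
  change _ = fderivWithin ℝ (fun q => fderivWithin ℝ w leftHalf q (1, 0)) leftHalf p v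
  rw [h1]
  simp [normalDeriv, hs.eq (1, 0) v]

theorem iterate_normalDeriv_fderivWithin {w : ℝ × ℝ → F} (hw : ContDiffOn ℝ ∞ w leftHalf)
    (k : ℕ) : EqOn (normalDeriv^[k] (fderivWithin ℝ w leftHalf))
      (fderivWithin ℝ (normalDeriv^[k] w) leftHalf) leftHalf := by
  induction k generalizing w with
  | zero => exact fun _ _ => rfl
  | succ k ih =>
    exact (iterate_normalDeriv_congr (normalDeriv_fderivWithin hw) k).trans (ih hw.normalDeriv)

theorem fderivWithin_eq_zero_of_boundary {w : ℝ × ℝ → F} (hw : ContDiffOn ℝ ∞ w leftHalf)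
    (h0 : ∀ t, w (0, t) = 0) {t : ℝ} (h1 : normalDeriv w (0, t) = 0) :
    fderivWithin ℝ w leftHalf (0, t) = 0 := by
  have hp : ((0 : ℝ), t) ∈ leftHalf := mem_leftHalf.2 le_rfl
  have h2 := (hw.differentiableOn (by simp) _ hp).hasFDerivWithinAt.comp_hasDerivWithinAt_of_eq
    (s := univ) t ((hasDerivWithinAt_const t univ (0 : ℝ)).prodMk (hasDerivWithinAt_id t univ))
    (fun _ _ => mem_leftHalf.2 le_rfl) rfl
  have h3 : HasDerivWithinAt (w ∘ fun x : ℝ => ((0 : ℝ), id x)) 0 univ t :=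
    (hasDerivWithinAt_const t univ (0 : F)).congr (fun x _ => h0 x) (h0 t)
  have h4 := (uniqueDiffOn_univ t (mem_univ _)).eq_deriv _ h2 h3
  ext
  · simpa [normalDeriv] using h1
  · simpa using h4

/-- If all normal derivatives vanish along the boundary of the half-plane, then so do all
derivatives, since the tangential directions contribute nothing. -/
theorem iteratedFDerivWithin_eq_zero_of_normalDeriv {w : ℝ × ℝ → F}
    (hw : ContDiffOn ℝ ∞ w leftHalf) (h0 : ∀ k t, normalDeriv^[k] w (0, t) = 0) (k : ℕ) (t : ℝ) :
    iteratedFDerivWithin ℝ k w leftHalf (0, t) = 0 := by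
  have hp : ∀ t, ((0 : ℝ), t) ∈ leftHalf := fun t => mem_leftHalf.2 le_rfl
  rw [← norm_eq_zero]
  induction k generalizing F with
  | zero =>
    rw [norm_iteratedFDerivWithin_zero, norm_eq_zero]
    exact h0 0 t
  | succ k ih =>
    rw [← norm_iteratedFDerivWithin_fderivWithin uniqueDiffOn_leftHalf (hp t)]
    refine ih (hw.fderivWithin uniqueDiffOn_leftHalf (by simp)) fun j t => ?_
    rw [iterate_normalDeriv_fderivWithin hw j (hp t)]
    refine fderivWithin_eq_zero_of_boundary (hw.iterate_normalDeriv j) (h0 j) ?_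
    have h2 := h0 (j + 1) t
    rwa [Function.iterate_succ_apply'] at h2

/-! ### Borel's lemma -/

/-- The derivative in the direction of the first coordinate. -/
def derivFst (f : ℝ × ℝ → F) (p : ℝ × ℝ) : F := fderiv ℝ f p (1, 0)

theorem ContDiff.derivFst {f : ℝ × ℝ → F} (hf : ContDiff ℝ ∞ f) : ContDiff ℝ ∞ (derivFst f) :=
  (hf.fderiv_right (by simp)).clm_apply contDiff_const

theorem iterate_derivFst_eq {f : ℝ × ℝ → F} (hf : ContDiff ℝ ∞ f) (k : ℕ) (p : ℝ × ℝ) :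
    derivFst^[k] f p = iteratedFDeriv ℝ k f p fun _ => (1, 0) := by
  induction k generalizing p with
  | zero => simp
  | succ k ih =>
    rw [Function.iterate_succ_apply', iteratedFDeriv_succ_apply_left]
    have h1 : derivFst^[k] f = fun q => iteratedFDeriv ℝ k f q fun _ => (1, 0) := funext ih
    have hk : ((k : ℕ∞) : WithTop ℕ∞) < ∞ := WithTop.coe_lt_coe.2 (ENat.natCast_lt_top k)
    have h2 := (hf.differentiable_iteratedFDeriv (m := k) hk p).hasFDerivAt
    have h3 := (ContinuousMultilinearMap.apply ℝ (fun _ : Fin k => ℝ × ℝ) F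
      fun _ => (1, 0)).hasFDerivAt.comp p h2
    rw [h1, derivFst]
    change fderiv ℝ ((ContinuousMultilinearMap.apply ℝ (fun _ : Fin k => ℝ × ℝ) F
      fun _ => (1, 0)) ∘ iteratedFDeriv ℝ k f) p (1, 0) = _
    rw [h3.fderiv]
    rfl

theorem iterate_derivFst_congr {f g : ℝ × ℝ → F} {U : Set (ℝ × ℝ)} (hU : IsOpen U)
    (h : EqOn f g U) (k : ℕ) : EqOn (derivFst^[k] f) (derivFst^[k] g) U := by
  induction k generalizing f g with
  | zero => exact h
  | succ k ih =>
    refine ih fun p hp => ?_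
    rw [derivFst, derivFst, (h.eventuallyEq_of_mem (hU.mem_nhds hp)).fderiv_eq]

theorem iterate_derivFst_monomial {u : ℝ → F} (hu : ContDiff ℝ ∞ u) (j k : ℕ) :
    derivFst^[k] (fun p : ℝ × ℝ => (p.1 ^ j / (j.factorial : ℝ)) • u p.2) =
      fun p => if k ≤ j then (p.1 ^ (j - k) / ((j - k).factorial : ℝ)) • u p.2 else 0 := by
  have hu' : ContDiff ℝ ∞ fun p : ℝ × ℝ => u p.2 := hu.comp contDiff_snd
  have hudiff : ∀ p : ℝ × ℝ, HasFDerivAt (fun p : ℝ × ℝ => u p.2)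
      ((fderiv ℝ u p.2).comp (ContinuousLinearMap.snd ℝ ℝ ℝ)) p := fun p =>
    (hu.differentiable (by simp) p.2).hasFDerivAt.comp p hasFDerivAt_snd
  have step : ∀ j : ℕ, derivFst (fun p : ℝ × ℝ => (p.1 ^ j / (j.factorial : ℝ)) • u p.2) =
      fun p => if 1 ≤ j then (p.1 ^ (j - 1) / ((j - 1).factorial : ℝ)) • u p.2 else 0 := by
    intro j
    funext p
    have h1 : HasFDerivAt (fun p : ℝ × ℝ => p.1 ^ j / (j.factorial : ℝ))
        (((j : ℝ) * p.1 ^ (j - 1) / (j.factorial : ℝ)) • ContinuousLinearMap.fst ℝ ℝ ℝ) p := by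
      have := ((hasDerivAt_pow j p.1).div_const (j.factorial : ℝ)).comp_hasFDerivAt p
        (hasFDerivAt_fst (𝕜 := ℝ) (E := ℝ) (F := ℝ))
      exact this
    rw [derivFst, (h1.fun_smul (hudiff p)).fderiv]
    simp only [add_apply, smul_apply, ContinuousLinearMap.comp_apply,
      ContinuousLinearMap.coe_snd', map_zero, smul_zero, zero_add,
      ContinuousLinearMap.smulRight_apply, ContinuousLinearMap.coe_fst', smul_eq_mul, mul_one]
    cases j with
    | zero => simp
    | succ j =>
      simp only [Nat.le_add_left, if_true, Nat.add_sub_cancel]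
      congr 1
      rw [Nat.factorial_succ]
      push_cast
      field_simp
  induction k generalizing j with
  | zero => simp
  | succ k ih =>
    rw [Function.iterate_succ_apply, step]
    cases j with
    | zero =>
      have : ∀ k, derivFst^[k] (fun _ : ℝ × ℝ => (0 : F)) = fun _ => 0 := by
        intro k
        induction k with
        | zero => rfl
        | succ k ih => rw [Function.iterate_succ_apply', ih]; funext p; simp [derivFst]
      simp [this]
    | succ j =>
      simp only [Nat.le_add_left, if_true, Nat.add_sub_cancel]
      rw [ih]
      simp

/-- The `k`-th term of a Borel series: it vanishes to order `k` on the line `x = 0`, where its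
`k`-th derivative in `x` is `u`, and its derivatives of order less than `k` are small. -/
theorem exists_borel_term {u : ℝ → F} (hu : ContDiff ℝ ∞ u) (hc : HasCompactSupport u) (k : ℕ) :
    ∃ (b : ℝ × ℝ → F) (v : ℕ → ℝ), ContDiff ℝ ∞ b ∧
      (∀ j t, derivFst^[j] b (0, t) = if j = k then u t else 0) ∧
      (∀ j p, ‖iteratedFDeriv ℝ j b p‖ ≤ v j) ∧ ∀ j < k, v j ≤ (1 / 2) ^ k := by
  let φ : ContDiffBump (0 : ℝ) := default
  let G : ℝ × ℝ → F := fun p => (φ p.1 * (p.1 ^ k / (k.factorial : ℝ))) • u p.2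
  have hG : ContDiff ℝ ∞ G :=
    ((φ.contDiff.comp contDiff_fst).mul ((contDiff_fst.pow k).div_const _)).smul
      (hu.comp contDiff_snd)
  have hGc : HasCompactSupport G := by
    refine HasCompactSupport.intro (φ.hasCompactSupport.isCompact.prod hc.isCompact)
      fun p hp => ?_
    by_cases h1 : p.1 ∈ tsupport φ
    · have h2 : p.2 ∉ tsupport u := fun h2 => hp ⟨h1, h2⟩
      simp [G, image_eq_zero_of_notMem_tsupport h2]
    · simp [G, image_eq_zero_of_notMem_tsupport h1]
  have hM : ∀ j : ℕ, ∃ M : ℝ, ∀ p, ‖iteratedFDeriv ℝ j G p‖ ≤ M := fun j =>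
    (hGc.iteratedFDeriv j).exists_bound_of_continuous
      (hG.continuous_iteratedFDeriv (m := j) (by exact_mod_cast le_top))
  choose M hM using hM
  have hM0 : ∀ j, 0 ≤ M j := fun j => (norm_nonneg _).trans (hM j 0)
  set N : ℝ := 1 + ∑ j ∈ Finset.range k, M j with hN
  have hN1 : 1 ≤ N := by
    have := Finset.sum_nonneg fun j (_ : j ∈ Finset.range k) => hM0 j
    linarith
  -- rescaling by `ε` in the first variable makes the derivatives of order `< k` small
  set ε : ℝ := (1 / 2) ^ k / N with hε
  have hε0 : 0 < ε := by positivity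
  have hε1 : ε ≤ 1 := by
    rw [hε, div_le_one (by positivity)]
    exact (pow_le_one₀ (by norm_num) (by norm_num)).trans hN1
  let L : ℝ × ℝ →L[ℝ] ℝ × ℝ :=
    (ε⁻¹ • ContinuousLinearMap.fst ℝ ℝ ℝ).prod (ContinuousLinearMap.snd ℝ ℝ ℝ)
  have hLa : ∀ p, L p = (ε⁻¹ * p.1, p.2) := fun p => rfl
  have hε1' : 1 ≤ ε⁻¹ := (one_le_inv₀ hε0).2 hε1
  have hL : ‖L‖ ≤ ε⁻¹ := by
    refine L.opNorm_le_bound (by positivity) fun p => ?_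
    rw [hLa, Prod.norm_def]
    refine max_le ?_ ?_
    · rw [norm_mul, Real.norm_of_nonneg (by positivity)]
      exact mul_le_mul_of_nonneg_left (norm_fst_le p) (by positivity)
    · exact (norm_snd_le p).trans (le_mul_of_one_le_left (norm_nonneg _) hε1')
  let b : ℝ × ℝ → F := ε ^ k • (G ∘ L)
  have hGL : ContDiff ℝ ∞ (G ∘ L) := hG.comp L.contDiff
  refine ⟨b, fun j => ε ^ k * (M j * ε⁻¹ ^ j), hGL.const_smul _, fun j t => ?_, fun j p => ?_,
    fun j hj => ?_⟩
  · let U : Set (ℝ × ℝ) := {p | ε⁻¹ * p.1 ∈ Metric.ball (0 : ℝ) φ.rIn}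
    have hU : IsOpen U := Metric.isOpen_ball.preimage (continuous_const.mul continuous_fst)
    have hbU : EqOn b (fun p : ℝ × ℝ => (p.1 ^ k / (k.factorial : ℝ)) • u p.2) U := by
      intro p hp
      have h1 : φ (ε⁻¹ * p.1) = 1 := φ.one_of_mem_closedBall (Metric.ball_subset_closedBall hp)
      simp only [b, G, Pi.smul_apply, Function.comp_apply, hLa, h1, one_mul, smul_smul]
      congr 1
      rw [mul_pow, inv_pow]
      field_simp
    have h0 : ((0 : ℝ), t) ∈ U := by simp [U, φ.rIn_pos]
    rw [iterate_derivFst_congr hU hbU j h0, iterate_derivFst_monomial hu]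
    rcases lt_trichotomy j k with h | h | h
    · have : k - j ≠ 0 := by omega
      simp [h.le, h.ne, this]
    · subst h; simp
    · simp [h.not_ge, h.ne']
  · have h1 : iteratedFDeriv ℝ j b p = ε ^ k • iteratedFDeriv ℝ j (G ∘ L) p :=
      iteratedFDeriv_const_smul_apply ((hGL.of_le (by exact_mod_cast le_top)).contDiffAt)
    rw [h1, norm_smul, Real.norm_of_nonneg (by positivity),
      L.iteratedFDeriv_comp_right hG p (i := j) (by exact_mod_cast le_top)]
    refine mul_le_mul_of_nonneg_left ?_ (by positivity)
    refine (ContinuousMultilinearMap.norm_compContinuousLinearMap_le _ _).trans ?_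
    rw [Finset.prod_const, Finset.card_univ, Fintype.card_fin]
    gcongr
    · exact hM0 j
    · exact hM j _
  · have h1 : M j ≤ N := by
      have := Finset.single_le_sum (fun j (_ : j ∈ Finset.range k) => hM0 j)
        (Finset.mem_range.2 hj)
      linarith
    have h2 : ε ^ k * ε⁻¹ ^ j ≤ ε := by
      rw [inv_pow, ← pow_sub₀ ε hε0.ne' hj.le]
      exact pow_le_of_le_one hε0.le hε1 (by omega)
    calc ε ^ k * (M j * ε⁻¹ ^ j) = M j * (ε ^ k * ε⁻¹ ^ j) := by ring
      _ ≤ N * ε := mul_le_mul h1 h2 (by positivity) (by linarith)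
      _ = (1 / 2) ^ k := by rw [hε]; field_simp

/-- Borel's lemma along a line: a sequence of functions on the line `x = 0` is the sequence of normal
derivatives of a smooth function. -/
theorem exists_contDiff_iterate_derivFst_eq [CompleteSpace F] {u : ℕ → ℝ → F}
    (hu : ∀ k, ContDiff ℝ ∞ (u k)) (hc : ∀ k, HasCompactSupport (u k)) :
    ∃ b : ℝ × ℝ → F, ContDiff ℝ ∞ b ∧ ∀ k t, derivFst^[k] b (0, t) = u k t := by
  choose b v hb hbd hbv hv using fun k => exists_borel_term (hu k) (hc k) k
  have hv0 : ∀ k j, 0 ≤ v k j := fun k j => (norm_nonneg _).trans (hbv k j 0)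
  have hsum : ∀ j : ℕ, Summable fun k => v k j := by
    intro j
    rw [← summable_nat_add_iff (j + 1)]
    refine Summable.of_nonneg_of_le (fun k => hv0 _ _) (fun k => hv (k + (j + 1)) j (by omega)) ?_
    exact (summable_nat_add_iff (f := fun k : ℕ => ((1 : ℝ) / 2) ^ k) (j + 1)).2
      (summable_geometric_of_lt_one (by norm_num) (by norm_num))
  have hB : ContDiff ℝ ∞ fun p => ∑' k, b k p :=
    contDiff_tsum (N := ⊤) (v := fun j k => v k j) hb (fun j _ => hsum j)
      fun j k p _ => hbv k j p
  refine ⟨fun p => ∑' k, b k p, hB, fun k t => ?_⟩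
  rw [iterate_derivFst_eq hB, iteratedFDeriv_tsum_apply (N := ⊤) (v := fun j k => v k j) hb
    (fun j _ => hsum j) (fun j k p _ => hbv k j p) (by exact_mod_cast le_top)]
  have hs : Summable fun i => iteratedFDeriv ℝ k (b i) ((0 : ℝ), t) :=
    Summable.of_norm_bounded (hsum k) fun i => hbv i k _
  have h2 := (ContinuousMultilinearMap.apply ℝ (fun _ : Fin k => ℝ × ℝ) F
      fun _ => (1, 0)).map_tsum hs
  change (ContinuousMultilinearMap.apply ℝ (fun _ : Fin k => ℝ × ℝ) F
      fun _ => (1, 0)) _ = _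
  rw [h2, tsum_eq_single k]
  · change iteratedFDeriv ℝ k (b k) (0, t) (fun _ => (1, 0)) = _
    rw [← iterate_derivFst_eq (hb k), hbd, if_pos rfl]
  · intro i hi
    change iteratedFDeriv ℝ k (b i) (0, t) (fun _ => (1, 0)) = _
    rw [← iterate_derivFst_eq (hb i), hbd, if_neg hi.symm]

theorem iterate_normalDeriv_eq_derivFst {f : ℝ × ℝ → F} (hf : ContDiff ℝ ∞ f) (k : ℕ) :
    EqOn (normalDeriv^[k] f) (derivFst^[k] f) leftHalf := by
  induction k generalizing f with
  | zero => exact fun _ _ => rfl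
  | succ k ih =>
    refine (iterate_normalDeriv_congr (fun p hp => ?_) k).trans (ih hf.derivFst)
    rw [normalDeriv, derivFst,
      (hf.differentiable (by simp) p).fderivWithin (uniqueDiffOn_leftHalf p hp)]

/-- A smooth function on the half-plane, supported in a horizontal strip, extends to a smooth
function on the plane: Borel's lemma provides a function on the plane with the same normal derivatives
at the edge, and the difference is flat there. -/
theorem exists_contDiff_eqOn_leftHalf [CompleteSpace F] {f : ℝ × ℝ → F}
    (hf : ContDiffOn ℝ ∞ f leftHalf) {K : Set ℝ} (hK : IsCompact K)
    (h0 : ∀ p ∈ leftHalf, p.2 ∉ K → f p = 0) :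
    ∃ g : ℝ × ℝ → F, ContDiff ℝ ∞ g ∧ EqOn g f leftHalf := by
  have hmem : ∀ t : ℝ, ((0 : ℝ), t) ∈ leftHalf := fun t => mem_leftHalf.2 le_rfl
  have hsupp : ∀ k, ∀ p ∈ leftHalf, p.2 ∉ K → normalDeriv^[k] f p = 0 := by
    intro k
    induction k with
    | zero => exact h0
    | succ k ih =>
      intro p hp hpK
      rw [Function.iterate_succ_apply', normalDeriv]
      have : normalDeriv^[k] f =ᶠ[𝓝[leftHalf] p] fun _ => (0 : F) := by
        filter_upwards [self_mem_nhdsWithin, mem_nhdsWithin_of_mem_nhds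
          ((hK.isClosed.isOpen_compl.preimage continuous_snd).mem_nhds hpK)] with q hq hqK
        exact ih q hq hqK
      rw [this.fderivWithin_eq (ih p hp hpK)]
      simp
  have hu : ∀ k, ContDiff ℝ ∞ fun t : ℝ => normalDeriv^[k] f (0, t) := fun k =>
    contDiffOn_univ.1 ((hf.iterate_normalDeriv k).comp
      (contDiff_const.prodMk contDiff_id).contDiffOn fun t _ => hmem t)
  obtain ⟨b, hb, hbk⟩ := exists_contDiff_iterate_derivFst_eq hu fun k =>
    HasCompactSupport.intro hK fun t ht => hsupp k _ (hmem t) ht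
  have hw : ContDiffOn ℝ ∞ (fun p => f p - b p) leftHalf := hf.sub hb.contDiffOn
  refine ⟨fun p => b p + leftHalf.indicator (fun p => f p - b p) p, hb.add
    (contDiff_indicator_of_flat isClosed_leftHalf uniqueDiffOn_leftHalf hw ?_), fun p hp => ?_⟩
  · rintro k ⟨x, t⟩ hx
    have hx0 : x = 0 := by
      rw [leftHalf, frontier_prod_univ_eq, frontier_Iic] at hx
      exact hx.1
    subst hx0
    refine iteratedFDerivWithin_eq_zero_of_normalDeriv hw (fun j t => ?_) k t
    rw [iterate_normalDeriv_sub hf hb.contDiffOn j (hmem t)]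
    beta_reduce
    rw [iterate_normalDeriv_eq_derivFst hb j (hmem t), hbk, sub_self]
  · simp only [indicator_of_mem hp]
    abel

end

/-! ### Extending an end past its edge -/

namespace PuncturedDisc

variable {S : PuncturedDisc}

namespace Ends

variable (E : S.Ends)

/-- `f` extends the middle part of the chart of the end at `ζ` past the edge `s = 0`, without meeting
the boundary or any other point of the ends. -/
structure IsExtendedChart (ζ : S.punctures) (f : ℝ × ℝ → ℂ) (r : ℝ) : Prop where
  pos : 0 < r
  lt : r < 1 / 4
  emb : IsOrientedEmbedding f (Iio r ×ˢ Ioo (1 / 2 - r) (1 / 2 + r))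
  eq_chart : ∀ p ∈ Iio r ×ˢ Ioo (1 / 2 - r) (1 / 2 + r), p.1 ≤ 0 → f p = E.chart ζ p
  norm_lt : ∀ p ∈ Iio r ×ˢ Ioo (1 / 2 - r) (1 / 2 + r), ‖f p‖ < 1
  notMem : ∀ p ∈ Iio r ×ˢ Ioo (1 / 2 - r) (1 / 2 + r), 0 < p.1 →
    ∀ ζ', f p ∉ E.chart ζ' '' strip

/-- The extension past the edge needs a cutoff in the `t`-direction, since it is a function on the
half-plane which is extended. -/
theorem exists_contDiff_eq_chart (ζ : S.punctures) :
    ∃ f : ℝ × ℝ → ℂ, ContDiff ℝ ∞ f ∧ EqOn f (E.chart ζ) (Iic 0 ×ˢ Icc (1 / 4) (3 / 4)) := by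
  let ρ : ContDiffBump (1 / 2 : ℝ) := ⟨1 / 4, 3 / 8, by norm_num, by norm_num⟩
  have hρ0 : ∀ t ∉ Icc (1 / 8 : ℝ) (7 / 8), ρ t = 0 := fun t ht => by
    refine ρ.zero_of_le_dist ?_
    rw [Real.dist_eq]
    rcases not_and_or.1 ht with h | h
    · rw [abs_of_neg (by linarith)]; change (3 / 8 : ℝ) ≤ _; linarith
    · rw [abs_of_pos (by linarith)]; change (3 / 8 : ℝ) ≤ _; linarith
  have hsm : ContDiffOn ℝ ∞ (fun p : ℝ × ℝ => ρ p.2 • E.chart ζ p) leftHalf := by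
    intro p hp
    by_cases ht : p.2 ∈ Icc (1 / 8 : ℝ) (7 / 8)
    · have hps : p ∈ strip := ⟨hp.1, by linarith [ht.1], by linarith [ht.2]⟩
      have h1 : ContDiffWithinAt ℝ ∞ (E.chart ζ) leftHalf p := by
        refine (E.chart_contDiffOn ζ p hps).mono_of_mem_nhdsWithin ?_
        filter_upwards [self_mem_nhdsWithin, mem_nhdsWithin_of_mem_nhds
          ((isOpen_Ioo (a := (0 : ℝ)) (b := 1)).preimage continuous_snd |>.mem_nhds
            (show p.2 ∈ Ioo (0 : ℝ) 1 from ⟨by linarith [ht.1], by linarith [ht.2]⟩))]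
          with q hq hq'
        exact ⟨hq.1, Ioo_subset_Icc_self hq'⟩
      exact (ρ.contDiff.comp contDiff_snd).contDiffWithinAt.smul h1
    · refine (contDiffWithinAt_const (c := (0 : ℂ))).congr_of_eventuallyEq_of_mem ?_ hp
      filter_upwards [mem_nhdsWithin_of_mem_nhds
        ((isClosed_Icc.isOpen_compl.preimage continuous_snd).mem_nhds ht)] with q hq
      simp [hρ0 q.2 hq]
  obtain ⟨g, hg, hgf⟩ := exists_contDiff_eqOn_leftHalf hsm
    (isCompact_Icc (a := (1 / 8 : ℝ)) (b := 7 / 8)) fun p _ hp => by simp [hρ0 p.2 hp]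
  refine ⟨g, hg, fun p hp => ?_⟩
  rw [hgf ⟨hp.1, mem_univ _⟩]
  have : ρ p.2 = 1 := ρ.one_of_mem_closedBall (by
    rw [Real.closedBall_eq_Icc]
    change p.2 ∈ Icc (1 / 2 - 1 / 4 : ℝ) (1 / 2 + 1 / 4)
    norm_num
    exact hp.2)
  simp [this]

theorem isOpen_setOf_isOrientedMap : IsOpen {D : ℝ × ℝ →L[ℝ] ℂ | IsOrientedMap D} := by
  have h : ∀ v : ℝ × ℝ, Continuous fun D : ℝ × ℝ →L[ℝ] ℂ => D v := fun v =>
    continuous_id.clm_apply continuous_const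
  exact isOpen_lt continuous_const
    (((Complex.continuous_re.comp (h _)).mul (Complex.continuous_im.comp (h _))).sub
      ((Complex.continuous_im.comp (h _)).mul (Complex.continuous_re.comp (h _))))

theorem exists_isExtendedChart (ζ : S.punctures) : ∃ f r, E.IsExtendedChart ζ f r := by
  obtain ⟨f, hf, hfc⟩ := E.exists_contDiff_eq_chart ζ
  let box : ℝ → Set (ℝ × ℝ) := fun r => Ioo (-r) r ×ˢ Ioo (1 / 2 - r) (1 / 2 + r)
  have hball : ∀ r, box r = Metric.ball ((0 : ℝ), (1 / 2 : ℝ)) r := fun r => by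
    rw [← ball_prod_same, Real.ball_eq_Ioo, Real.ball_eq_Ioo, zero_sub, zero_add]
  have hp0 : ((0 : ℝ), (1 / 2 : ℝ)) ∈ strip := ⟨self_mem_Iic, by norm_num, by norm_num⟩
  have hnear : EqOn f (E.chart ζ) (Iic 0 ×ˢ Ioo (1 / 4) (3 / 4)) :=
    hfc.mono (prod_mono subset_rfl Ioo_subset_Icc_self)
  have hf0 : f (0, 1 / 2) = E.chart ζ (0, 1 / 2) := hnear ⟨self_mem_Iic, by norm_num, by norm_num⟩
  have hD0 : IsOrientedMap (fderiv ℝ f (0, 1 / 2)) := by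
    have h1 : fderivWithin ℝ (E.chart ζ) strip (0, 1 / 2) = fderiv ℝ f (0, 1 / 2) := by
      rw [← (hf.differentiable (by simp) _).fderivWithin (uniqueDiffOn_strip _ hp0)]
      refine Filter.EventuallyEq.fderivWithin_eq ?_ hf0.symm
      filter_upwards [self_mem_nhdsWithin, mem_nhdsWithin_of_mem_nhds
        ((isOpen_Ioo (a := (1 / 4 : ℝ)) (b := 3 / 4)).preimage continuous_snd |>.mem_nhds
          (show (1 / 2 : ℝ) ∈ Ioo (1 / 4 : ℝ) (3 / 4) by norm_num))] with q hq hq'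
      exact (hnear ⟨hq.1, hq'⟩).symm
    rw [← h1]
    exact (E.isEnd_chart ζ).oriented _ hp0
  obtain ⟨e, he, hpe, -⟩ := exists_local_inverse hf.contDiffAt hD0
  have hN : e.source ∩ {p | IsOrientedMap (fderiv ℝ f p)} ∩ {p | ‖f p‖ < 1} ∈
      𝓝 ((0 : ℝ), (1 / 2 : ℝ)) := by
    refine inter_mem (inter_mem (e.open_source.mem_nhds hpe)
      ((isOpen_setOf_isOrientedMap.preimage (hf.continuous_fderiv (by simp))).mem_nhds hD0))
      ((isOpen_lt hf.continuous.norm continuous_const).mem_nhds ?_)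
    change ‖f _‖ < 1
    rw [hf0]
    exact E.norm_chart_lt ζ hp0 (by norm_num) (by norm_num)
  obtain ⟨a', ha', haN'⟩ := Metric.mem_nhds_iff.1 hN
  obtain ⟨a, ha, haa, ha4⟩ : ∃ a : ℝ, 0 < a ∧ a ≤ a' ∧ a ≤ 1 / 4 :=
    ⟨min a' (1 / 4), lt_min ha' (by norm_num), min_le_left _ _, min_le_right _ _⟩
  have haN := (Metric.ball_subset_ball haa).trans haN'
  rw [← hball] at haN
  -- the image of a neighbourhood of the middle of the edge only meets a small part of the ends
  have hZ : IsClosed (closure (E.chart ζ '' (strip \ box a)) ∪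
      ⋃ ζ' ∈ {ζ' : S.punctures | ζ' ≠ ζ}, closure (E.chart ζ' '' strip)) := by
    have : Finite S.punctures := S.finite_punctures
    exact isClosed_closure.union
      ((Set.toFinite _).isClosed_biUnion fun ζ' _ => isClosed_closure)
  have hpunct : E.chart ζ (0, 1 / 2) ∉ S.punctures := (E.chart_mapsTo ζ hp0).2
  have hbox : IsOpen (box a) := isOpen_Ioo.prod isOpen_Ioo
  have hx0 : f (0, 1 / 2) ∉ closure (E.chart ζ '' (strip \ box a)) ∪
      ⋃ ζ' ∈ {ζ' : S.punctures | ζ' ≠ ζ}, closure (E.chart ζ' '' strip) := by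
    rw [hf0]
    rintro (h | h)
    · rcases E.closure_chart_image ζ (isClosed_strip.sdiff hbox) sdiff_subset h
        with ⟨q, hq, hq'⟩ | h
      · have := E.chart_injOn ζ hq.1 hp0 hq'
        subst this
        exact hq.2 (by rw [hball]; exact Metric.mem_ball_self ha)
      · exact hpunct h
    · simp only [mem_iUnion] at h
      obtain ⟨ζ', hne, h⟩ := h
      rcases E.closure_chart_image ζ' isClosed_strip subset_rfl h with h | h
      · exact disjoint_left.1 (E.disjoint_chart hne) h ⟨_, hp0, rfl⟩
      · exact hpunct h
  obtain ⟨b, hb, hbZ⟩ := Metric.mem_nhds_iff.1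
    (hf.continuous.continuousAt.preimage_mem_nhds (hZ.isOpen_compl.mem_nhds hx0))
  rw [← hball] at hbZ
  let r := min (min a b) (1 / 8)
  have hr0 : 0 < r := lt_min (lt_min ha hb) (by norm_num)
  have hra : r ≤ a := (min_le_left _ _).trans (min_le_left _ _)
  have hrb : r ≤ b := (min_le_left _ _).trans (min_le_right _ _)
  have hr8 : r ≤ 1 / 8 := min_le_right _ _
  set V : Set (ℝ × ℝ) := Iio r ×ˢ Ioo (1 / 2 - r) (1 / 2 + r) with hVdef
  have hV : IsOpen V := isOpen_Iio.prod isOpen_Ioo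
  have hVa : ∀ p ∈ V, -a < p.1 → p ∈ box a := fun p hp h =>
    ⟨⟨h, lt_of_lt_of_le hp.1 hra⟩, by linarith [hp.2.1], by linarith [hp.2.2]⟩
  have hVb : ∀ p ∈ V, 0 < p.1 → p ∈ box b := fun p hp h =>
    ⟨⟨by linarith, lt_of_lt_of_le hp.1 hrb⟩, by linarith [hp.2.1], by linarith [hp.2.2]⟩
  have heq : ∀ p ∈ V, p.1 ≤ 0 → f p = E.chart ζ p := fun p hp h =>
    hnear ⟨h, by linarith [hp.2.1], by linarith [hp.2.2]⟩
  have hVs : ∀ p ∈ V, p.1 ≤ 0 → p ∈ strip := fun p hp h =>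
    ⟨h, by linarith [hp.2.1], by linarith [hp.2.2]⟩
  have hinj : InjOn f (box a) := fun p hp q hq h => by
    rw [← he] at h
    exact e.injOn (haN hp).1.1 (haN hq).1.1 h
  have hnot : ∀ p ∈ V, 0 < p.1 → ∀ q ∈ strip, f p ≠ E.chart ζ q := by
    intro p hp h0 q hq h
    by_cases hqa : q ∈ box a
    · have h1 : f q = E.chart ζ q :=
        hnear ⟨hq.1, by linarith [hqa.2.1], by linarith [hqa.2.2]⟩
      have h2 := hinj (hVa p hp (by linarith)) hqa (h.trans h1.symm)
      rw [h2] at h0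
      exact absurd hq.1 (not_le.2 h0)
    · exact hbZ (hVb p hp h0) (Or.inl (subset_closure ⟨q, ⟨hq, hqa⟩, h.symm⟩))
  refine ⟨f, r, hr0, by linarith, ⟨hV, hf.contDiffOn, fun p hp => ?_, ?_⟩, heq, fun p hp => ?_, ?_⟩
  · rcases le_or_gt p.1 (-a) with h | h
    · have hpi : p ∈ innerStrip :=
        ⟨by change p.1 < 0; linarith, by linarith [hp.2.1], by linarith [hp.2.2]⟩
      have : f =ᶠ[𝓝 p] E.chart ζ := by
        filter_upwards [hV.mem_nhds hp, isOpen_innerStrip.mem_nhds hpi] with q hq hq'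
        exact heq q hq (le_of_lt hq'.1)
      rw [this.fderiv_eq]
      exact (E.isOrientedEmbedding_chart ζ).oriented p hpi
    · exact (haN (hVa p hp h)).1.2
  · have key : ∀ p ∈ V, ∀ q ∈ V, 0 < q.1 → f p = f q → p = q := by
      intro p hp q hq h0 h
      rcases le_or_gt p.1 0 with h1 | h1
      · exact absurd ((heq p hp h1).symm.trans h).symm (hnot q hq h0 p (hVs p hp h1))
      · exact hinj (hVa p hp (by linarith)) (hVa q hq (by linarith)) h
    intro p hp q hq h
    rcases le_or_gt q.1 0 with h1 | h1
    · rcases le_or_gt p.1 0 with h2 | h2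
      · rw [heq p hp h2, heq q hq h1] at h
        exact E.chart_injOn ζ (hVs p hp h2) (hVs q hq h1) h
      · exact (key q hq p hp h2 h.symm).symm
    · exact key p hp q hq h1 h
  · rcases le_or_gt p.1 0 with h | h
    · rw [heq p hp h]
      exact E.norm_chart_lt ζ (hVs p hp h) (by linarith [hp.2.1]) (by linarith [hp.2.2])
    · exact (haN (hVa p hp (by linarith))).2
  · rintro p hp h0 ζ' ⟨q, hq, hq'⟩
    by_cases hζ : ζ' = ζ
    · subst hζ
      exact hnot p hp h0 q hq hq'.symm
    · refine hbZ (hVb p hp h0) (Or.inr ?_)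
      simp only [mem_iUnion]
      exact ⟨ζ', hζ, subset_closure ⟨q, hq, hq'⟩⟩

end Ends

end PuncturedDisc

/-! ### Step functions -/

/-- A smooth monotone function which is `0` for `t ≤ 1/2 - r/2` and `1` for `t ≥ 1/2 + r/2`. -/
def middleStep (r t : ℝ) : ℝ := Real.smoothTransition ((t - 1 / 2) / r + 1 / 2)

theorem contDiff_middleStep (r : ℝ) : ContDiff ℝ ∞ (middleStep r) :=
  Real.smoothTransition.contDiff.comp (((contDiff_id.sub contDiff_const).div_const r).add
    contDiff_const)

theorem middleStep_eq_zero {r t : ℝ} (hr : 0 < r) (ht : t ≤ 1 / 2 - r / 2) :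
    middleStep r t = 0 := by
  refine Real.smoothTransition.zero_of_nonpos ?_
  have : (t - 1 / 2) / r ≤ -(1 / 2) := by
    rw [div_le_iff₀ hr]
    linarith
  linarith

theorem middleStep_eq_one {r t : ℝ} (hr : 0 < r) (ht : 1 / 2 + r / 2 ≤ t) :
    middleStep r t = 1 := by
  refine Real.smoothTransition.one_of_one_le ?_
  have : 1 / 2 ≤ (t - 1 / 2) / r := by
    rw [le_div_iff₀ hr]
    linarith
  linarith

theorem deriv_middleStep_nonneg {r : ℝ} (hr : 0 < r) (t : ℝ) : 0 ≤ deriv (middleStep r) t := by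
  refine Monotone.deriv_nonneg fun x y hxy => Real.smoothTransition.monotone ?_
  gcongr

theorem deriv_middleStep_eq_zero {r t : ℝ} (hr : 0 < r)
    (ht : t ∉ Icc (1 / 2 - r / 2) (1 / 2 + r / 2)) : deriv (middleStep r) t = 0 := by
  rcases not_and_or.1 ht with h | h
  · have : middleStep r =ᶠ[𝓝 t] fun _ => 0 := by
      filter_upwards [Iio_mem_nhds (not_le.1 h)] with x hx using middleStep_eq_zero hr (le_of_lt hx)
    rw [this.deriv_eq, deriv_const]
  · have : middleStep r =ᶠ[𝓝 t] fun _ => 1 := by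
      filter_upwards [Ioi_mem_nhds (not_le.1 h)] with x hx using middleStep_eq_one hr (le_of_lt hx)
    rw [this.deriv_eq, deriv_const]

theorem contDiff_deriv_middleStep (r : ℝ) : ContDiff ℝ ∞ (deriv (middleStep r)) :=
  (contDiff_infty_iff_deriv.1 (contDiff_middleStep r)).2

theorem integral_deriv_middleStep {r : ℝ} (hr : 0 < r) (hr' : r < 1 / 4) :
    ∫ t in (0 : ℝ)..1, deriv (middleStep r) t = 1 := by
  rw [intervalIntegral.integral_deriv_eq_sub
      (fun s _ => (contDiff_middleStep r).differentiable (by simp) s)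
      ((contDiff_middleStep r).continuous_deriv (by simp)).continuousOn.intervalIntegrable,
    middleStep_eq_one hr (by linarith), middleStep_eq_zero hr (by linarith), sub_zero]

/-- A smooth antitone function which is `1` for `s ≤ 0` and `0` for `s ≥ r/2`. -/
def edgeCutoff (r s : ℝ) : ℝ := Real.smoothTransition (1 - 2 * s / r)

theorem contDiff_edgeCutoff (r : ℝ) : ContDiff ℝ ∞ (edgeCutoff r) :=
  Real.smoothTransition.contDiff.comp
    (contDiff_const.sub ((contDiff_const.mul contDiff_id).div_const r))

theorem edgeCutoff_eq_one {r s : ℝ} (hr : 0 < r) (hs : s ≤ 0) : edgeCutoff r s = 1 := by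
  refine Real.smoothTransition.one_of_one_le ?_
  have : 2 * s / r ≤ 0 := div_nonpos_of_nonpos_of_nonneg (by linarith) hr.le
  linarith

theorem edgeCutoff_eq_zero {r s : ℝ} (hr : 0 < r) (hs : r / 2 ≤ s) : edgeCutoff r s = 0 := by
  refine Real.smoothTransition.zero_of_nonpos ?_
  have : 1 ≤ 2 * s / r := by
    rw [le_div_iff₀ hr]
    linarith
  linarith

theorem deriv_edgeCutoff_nonpos {r : ℝ} (hr : 0 < r) (s : ℝ) : deriv (edgeCutoff r) s ≤ 0 := by
  refine Antitone.deriv_nonpos fun x y hxy => Real.smoothTransition.monotone ?_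
  gcongr

/-! ### Weak profiles -/

namespace PuncturedDisc

variable {S : PuncturedDisc}

namespace Ends

variable (E : S.Ends)

/-- A one-form on the complement of the punctures which has all properties of a profile, except that
its integral across the end at `ζ`, taken with sign, is `j ζ` instead of being positive. -/
structure IsWeakProfile (γ : ℂ → ℂ →L[ℝ] ℝ) (j : S.punctures → ℝ) : Prop where
  smooth : ContDiffOn ℝ ∞ γ S.puncturesᶜ
  tangential : ∀ z ∈ S.boundary, γ z (Complex.I * z) = 0
  curl_nonpos : ∀ z ∈ S.surface, fderiv ℝ γ z 1 Complex.I - fderiv ℝ γ z Complex.I 1 ≤ 0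
  ends : ∀ ζ, ∃ c : ℝ → ℝ, ContDiffOn ℝ ∞ c (Icc 0 1) ∧ E.sign ζ * ∫ t in (0 : ℝ)..1, c t = j ζ ∧
    ∀ p ∈ strip, ∀ v : ℝ × ℝ,
      γ (E.chart ζ p) (fderivWithin ℝ (E.chart ζ) strip p v) = v.2 * c p.2

variable {E}

theorem IsWeakProfile.differentiableAt {γ : ℂ → ℂ →L[ℝ] ℝ} {j : S.punctures → ℝ}
    (h : E.IsWeakProfile γ j) {z : ℂ} (hz : z ∈ S.surface) : DifferentiableAt ℝ γ z :=
  (h.smooth.contDiffAt (S.finite_punctures.isClosed.isOpen_compl.mem_nhds hz.2)).differentiableAt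
    (by simp)

theorem IsWeakProfile.zero : E.IsWeakProfile (fun _ => 0) fun _ => 0 where
  smooth := contDiffOn_const
  tangential _ _ := rfl
  curl_nonpos z _ := by simp
  ends ζ := ⟨fun _ => 0, contDiffOn_const, by simp, fun p _ v => by simp⟩

theorem IsWeakProfile.add {γ γ' : ℂ → ℂ →L[ℝ] ℝ} {j j' : S.punctures → ℝ}
    (h : E.IsWeakProfile γ j) (h' : E.IsWeakProfile γ' j') :
    E.IsWeakProfile (fun z => γ z + γ' z) fun ζ => j ζ + j' ζ where
  smooth := h.smooth.add h'.smooth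
  tangential z hz := by
    rw [add_apply, h.tangential z hz, h'.tangential z hz, add_zero]
  curl_nonpos z hz := by
    rw [fderiv_fun_add (h.differentiableAt hz) (h'.differentiableAt hz)]
    simp only [add_apply]
    linarith [h.curl_nonpos z hz, h'.curl_nonpos z hz]
  ends ζ := by
    obtain ⟨c, hc, hj, hcp⟩ := h.ends ζ
    obtain ⟨c', hc', hj', hcp'⟩ := h'.ends ζ
    refine ⟨fun t => c t + c' t, hc.add hc', ?_, fun p hp v => ?_⟩
    · have hi : ∀ {c : ℝ → ℝ}, ContDiffOn ℝ ∞ c (Icc 0 1) →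
          IntervalIntegrable c MeasureTheory.volume 0 1 := fun hc =>
        (hc.continuousOn.mono (by rw [uIcc_of_le zero_le_one])).intervalIntegrable
      rw [intervalIntegral.integral_add (hi hc) (hi hc'), mul_add, hj, hj']
    · rw [add_apply, hcp p hp, hcp' p hp, mul_add]

theorem IsWeakProfile.isProfile {γ : ℂ → ℂ →L[ℝ] ℝ} {j : S.punctures → ℝ}
    (h : E.IsWeakProfile γ j) (hj : ∀ ζ, 0 < j ζ) : E.IsProfile γ where
  smooth := h.smooth.mono fun _ hz => hz.2
  tangential := h.tangential
  curl_nonpos z hz := by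
    rw [(h.differentiableAt hz).fderivWithin (S.uniqueDiffOn_surface z hz)]
    exact h.curl_nonpos z hz
  ends ζ := by
    obtain ⟨c, hc, hcj, hcp⟩ := h.ends ζ
    exact (E.ends_condition_iff ζ).2 ⟨c, hc, hcj ▸ hj ζ, hcp⟩

/-- Weak profiles can be added up to a profile. -/
theorem exists_isProfile_of_weak
    (h : ∀ ζ, ∃ γ j, E.IsWeakProfile γ j ∧ (∀ ζ', 0 ≤ j ζ') ∧ 0 < j ζ) : ∃ γ, E.IsProfile γ := by
  classical
  have := S.finite_punctures.fintype
  choose γ j hγ hj hpos using h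
  have key : ∀ s : Finset S.punctures,
      E.IsWeakProfile (fun z => ∑ ζ ∈ s, γ ζ z) fun ζ' => ∑ ζ ∈ s, j ζ ζ' := by
    intro s
    induction s using Finset.induction_on with
    | empty => simpa using IsWeakProfile.zero
    | insert a s ha ih =>
      simp only [Finset.sum_insert ha]
      exact (hγ a).add ih
  exact ⟨_, (key Finset.univ).isProfile fun ζ' => Finset.sum_pos'
    (fun ζ _ => hj ζ ζ') ⟨ζ', Finset.mem_univ _, hpos ζ'⟩⟩

/-! ### Geometry of extended charts -/

namespace IsExtendedChart

variable {ζ : S.punctures} {f : ℝ × ℝ → ℂ} {r : ℝ}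

theorem window_subset (h : E.IsExtendedChart ζ f r) {p : ℝ × ℝ} (hp : p.1 ≤ r / 2)
    (hp' : p.2 ∈ Icc (1 / 2 - r / 2) (1 / 2 + r / 2)) :
    p ∈ Iio r ×ˢ Ioo (1 / 2 - r) (1 / 2 + r) := by
  have := h.pos
  exact ⟨lt_of_le_of_lt hp (by linarith), by linarith [hp'.1], by linarith [hp'.2]⟩

theorem mem_strip (h : E.IsExtendedChart ζ f r) {p : ℝ × ℝ}
    (hp : p ∈ Iio r ×ˢ Ioo (1 / 2 - r) (1 / 2 + r)) (h0 : p.1 ≤ 0) : p ∈ strip := by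
  have := h.lt
  exact ⟨h0, by linarith [hp.2.1], by linarith [hp.2.2]⟩

/-- The domain of the extended chart only meets the ends where it is supposed to. -/
theorem eq_of_chart_eq (h : E.IsExtendedChart ζ f r) {ζ' : S.punctures} {p q : ℝ × ℝ}
    (hp : p ∈ strip) (hq : q ∈ Iio r ×ˢ Ioo (1 / 2 - r) (1 / 2 + r))
    (hpq : E.chart ζ' p = f q) : ζ' = ζ ∧ p = q := by
  have hq0 : q.1 ≤ 0 := not_lt.1 fun h0 => h.notMem q hq h0 ζ' ⟨p, hp, hpq⟩
  have hqs := h.mem_strip hq hq0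
  rw [h.eq_chart q hq hq0] at hpq
  by_cases hζ : ζ' = ζ
  · subst hζ
    exact ⟨rfl, E.chart_injOn _ hp hqs hpq⟩
  · exact absurd ⟨q, hqs, rfl⟩ (disjoint_left.1 (E.disjoint_chart hζ) ⟨p, hp, hpq⟩)

theorem fderivWithin_chart (h : E.IsExtendedChart ζ f r) {p : ℝ × ℝ}
    (hp : p ∈ Iio r ×ˢ Ioo (1 / 2 - r) (1 / 2 + r)) (h0 : p.1 ≤ 0) :
    fderivWithin ℝ (E.chart ζ) strip p = fderiv ℝ f p := by
  rw [← ((h.emb.contDiffAt hp).differentiableAt (by simp)).fderivWithin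
    (uniqueDiffOn_strip _ (h.mem_strip hp h0))]
  refine Filter.EventuallyEq.fderivWithin_eq ?_ (h.eq_chart p hp h0).symm
  filter_upwards [self_mem_nhdsWithin,
    mem_nhdsWithin_of_mem_nhds (h.emb.isOpen.mem_nhds hp)] with q hq hq'
  exact (h.eq_chart q hq' hq.1).symm

/-- The support of the one-forms constructed below is closed away from the punctures. -/
theorem closure_image (h : E.IsExtendedChart ζ f r) :
    closure (f '' (Iic (r / 2) ×ˢ Icc (1 / 2 - r / 2) (1 / 2 + r / 2))) ⊆
      f '' (Iic (r / 2) ×ˢ Icc (1 / 2 - r / 2) (1 / 2 + r / 2)) ∪ S.punctures := by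
  have hr := h.pos
  have hr' := h.lt
  have e : f '' (Iic (r / 2) ×ˢ Icc (1 / 2 - r / 2) (1 / 2 + r / 2)) =
      E.chart ζ '' (Iic 0 ×ˢ Icc (1 / 2 - r / 2) (1 / 2 + r / 2)) ∪
        f '' (Icc 0 (r / 2) ×ˢ Icc (1 / 2 - r / 2) (1 / 2 + r / 2)) := by
    have h1 : Iic (r / 2) = Iic 0 ∪ Icc 0 (r / 2) := (Iic_union_Icc_eq_Iic (by linarith)).symm
    rw [h1, union_prod, image_union]
    congr 1
    refine image_congr fun p hp => h.eq_chart p (h.window_subset ?_ hp.2) hp.1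
    exact le_trans hp.1 (by linarith)
  have hcomp : IsClosed (f '' (Icc 0 (r / 2) ×ˢ Icc (1 / 2 - r / 2) (1 / 2 + r / 2))) :=
    ((isCompact_Icc.prod isCompact_Icc).image_of_continuousOn
      (h.emb.smooth.continuousOn.mono fun p hp => h.window_subset hp.1.2 hp.2)).isClosed
  rw [e, closure_union, hcomp.closure_eq]
  rintro z (hz | hz)
  · rcases E.closure_chart_image ζ (isClosed_Iic.prod isClosed_Icc)
      (prod_mono subset_rfl (Icc_subset_Icc (by linarith) (by linarith))) hz with hz | hz
    · exact Or.inl (Or.inl hz)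
    · exact Or.inr hz
  · exact Or.inl (Or.inr hz)

end IsExtendedChart

end Ends

end PuncturedDisc

/-! ### Pulling back one-forms -/

/-- The exterior derivative commutes with pullback. -/
theorem antisymm_fderiv_pullback {f : ℝ × ℝ → ℂ} {p : ℝ × ℝ} (hf : ContDiffAt ℝ ∞ f p)
    {γ : ℂ → ℂ →L[ℝ] ℝ} (hγ : DifferentiableAt ℝ γ (f p)) (u v : ℝ × ℝ) :
    fderiv ℝ γ (f p) (fderiv ℝ f p u) (fderiv ℝ f p v) -
        fderiv ℝ γ (f p) (fderiv ℝ f p v) (fderiv ℝ f p u) =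
      fderiv ℝ (fun q => γ (f q) (fderiv ℝ f q v)) p u -
        fderiv ℝ (fun q => γ (f q) (fderiv ℝ f q u)) p v := by
  have h1 := hγ.hasFDerivAt.comp p (hf.differentiableAt (by simp)).hasFDerivAt
  have h2 : HasFDerivAt (fderiv ℝ f) (fderiv ℝ (fderiv ℝ f) p) p :=
    ((hf.fderiv_right (m := ∞) (by simp)).differentiableAt (by simp)).hasFDerivAt
  have hs : IsSymmSndFDerivAt ℝ f p :=
    hf.isSymmSndFDerivAt (by simpa using PuncturedDisc.two_le_infty)
  have h3 : ∀ w, fderiv ℝ (fun q => γ (f q) (fderiv ℝ f q w)) p = _ := fun w =>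
    (h1.clm_apply (h2.clm_apply (hasFDerivAt_const w p))).fderiv
  rw [h3 u, h3 v]
  simp [hs.eq u v]

namespace PuncturedDisc

variable {S : PuncturedDisc}

namespace Ends

variable {E : S.Ends}

/-! ### Weak profiles at negative ends -/

open Classical in
/-- The one-form `g(s) c(t) dt`, where `g` is the edge cutoff and `c` is a bump function of integral
one, in the coordinates given by an extended chart. -/
def sinkForm (f : ℝ × ℝ → ℂ) (r : ℝ) (z : ℂ) : ℂ →L[ℝ] ℝ :=
  let V : Set (ℝ × ℝ) := Iio r ×ˢ Ioo (1 / 2 - r) (1 / 2 + r)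
  let ψ := Function.invFunOn f V
  if z ∈ f '' V then (edgeCutoff r (ψ z).1 * deriv (middleStep r) (ψ z).2) •
    (ContinuousLinearMap.snd ℝ ℝ ℝ).comp (fderiv ℝ ψ z) else 0

namespace IsExtendedChart

variable {ζ : S.punctures} {f : ℝ × ℝ → ℂ} {r : ℝ}

theorem sinkForm_apply (h : E.IsExtendedChart ζ f r) {p : ℝ × ℝ}
    (hp : p ∈ Iio r ×ˢ Ioo (1 / 2 - r) (1 / 2 + r)) (v : ℝ × ℝ) :
    sinkForm f r (f p) (fderiv ℝ f p v) =
      v.2 * (edgeCutoff r p.1 * deriv (middleStep r) p.2) := by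
  set V : Set (ℝ × ℝ) := Iio r ×ˢ Ioo (1 / 2 - r) (1 / 2 + r) with hV
  have h1 : (fderiv ℝ (Function.invFunOn f V) (f p)).comp (fderiv ℝ f p) =
      ContinuousLinearMap.id ℝ (ℝ × ℝ) := by
    have hd := (((h.emb.contDiffOn_invFunOn.contDiffAt
      (h.emb.isOpen_image.mem_nhds ⟨p, hp, rfl⟩)).differentiableAt (by simp)).hasFDerivAt).comp p
      ((h.emb.contDiffAt hp).differentiableAt (by simp)).hasFDerivAt
    refine hd.unique ((hasFDerivAt_id p).congr_of_eventuallyEq ?_)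
    filter_upwards [h.emb.isOpen.mem_nhds hp] with q hq using h.emb.invFunOn_apply hq
  have h2 : fderiv ℝ (Function.invFunOn f V) (f p) (fderiv ℝ f p v) = v := by
    rw [← ContinuousLinearMap.comp_apply, h1, ContinuousLinearMap.id_apply]
  simp only [sinkForm]
  rw [if_pos ⟨p, hp, rfl⟩, smul_apply, ContinuousLinearMap.comp_apply, ← hV, h2,
    h.emb.invFunOn_apply hp, smul_eq_mul, mul_comm]
  rfl

theorem sinkForm_eq_zero (h : E.IsExtendedChart ζ f r) {z : ℂ}
    (hz : z ∉ f '' (Iic (r / 2) ×ˢ Icc (1 / 2 - r / 2) (1 / 2 + r / 2))) :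
    sinkForm f r z = 0 := by
  unfold sinkForm
  by_cases hzV : z ∈ f '' (Iio r ×ˢ Ioo (1 / 2 - r) (1 / 2 + r))
  · obtain ⟨p, hp, rfl⟩ := hzV
    have hp' : p ∉ Iic (r / 2) ×ˢ Icc (1 / 2 - r / 2) (1 / 2 + r / 2) := fun hp' =>
      hz ⟨p, hp', rfl⟩
    rw [if_pos ⟨p, hp, rfl⟩, h.emb.invFunOn_apply hp]
    rcases not_and_or.1 hp' with h' | h'
    · rw [edgeCutoff_eq_zero h.pos (le_of_lt (not_le.1 h')), zero_mul, zero_smul]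
    · rw [deriv_middleStep_eq_zero h.pos h', mul_zero, zero_smul]
  · rw [if_neg hzV]

theorem contDiffAt_sinkForm (h : E.IsExtendedChart ζ f r) {z : ℂ} (hz : z ∉ S.punctures) :
    ContDiffAt ℝ ∞ (sinkForm f r) z := by
  by_cases hzV : z ∈ f '' (Iio r ×ˢ Ioo (1 / 2 - r) (1 / 2 + r))
  · have hnhds := h.emb.isOpen_image.mem_nhds hzV
    have hψ := h.emb.contDiffOn_invFunOn.contDiffAt hnhds
    have h1 : ContDiffAt ℝ ∞ (fun z => (edgeCutoff r
        (Function.invFunOn f (Iio r ×ˢ Ioo (1 / 2 - r) (1 / 2 + r)) z).1 *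
        deriv (middleStep r) (Function.invFunOn f (Iio r ×ˢ Ioo (1 / 2 - r) (1 / 2 + r)) z).2) •
        (ContinuousLinearMap.snd ℝ ℝ ℝ).comp
          (fderiv ℝ (Function.invFunOn f (Iio r ×ˢ Ioo (1 / 2 - r) (1 / 2 + r))) z)) z :=
      (((contDiff_edgeCutoff r).contDiffAt.comp z hψ.fst).mul
        ((contDiff_deriv_middleStep r).contDiffAt.comp z hψ.snd)).smul
        (contDiffAt_const.clm_comp (hψ.fderiv_right (by simp)))
    refine h1.congr_of_eventuallyEq ?_
    filter_upwards [hnhds] with w hw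
    simp only [sinkForm]
    rw [if_pos hw]
  · have hcl : z ∉ closure (f '' (Iic (r / 2) ×ˢ Icc (1 / 2 - r / 2) (1 / 2 + r / 2))) :=
      fun hcl => (h.closure_image hcl).elim
        (fun ⟨p, hp, hpz⟩ => hzV ⟨p, h.window_subset hp.1 hp.2, hpz⟩) hz
    refine (contDiffAt_const (c := (0 : ℂ →L[ℝ] ℝ))).congr_of_eventuallyEq ?_
    filter_upwards [isClosed_closure.isOpen_compl.mem_nhds hcl] with w hw
    exact h.sinkForm_eq_zero fun hw' => hw (subset_closure hw')

/-- In the coordinates of the chart, the exterior derivative is `g'(s) c(t) ds ∧ dt`. -/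
theorem curl_sinkForm_nonpos (h : E.IsExtendedChart ζ f r) {z : ℂ} (hz : z ∈ S.surface) :
    fderiv ℝ (sinkForm f r) z 1 Complex.I - fderiv ℝ (sinkForm f r) z Complex.I 1 ≤ 0 := by
  have hd := (h.contDiffAt_sinkForm hz.2).differentiableAt (by simp)
  by_cases hzV : z ∈ f '' (Iio r ×ˢ Ioo (1 / 2 - r) (1 / 2 + r))
  · obtain ⟨p, hp, rfl⟩ := hzV
    have h1 := antisymm_fderiv_pullback (h.emb.contDiffAt hp) hd (1, 0) (0, 1)
    have h2 := antisymm_bilin_eq (fderiv ℝ (sinkForm f r) (f p)) (fderiv ℝ f p (1, 0))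
      (fderiv ℝ f p (0, 1))
    have h3 : (fun q => sinkForm f r (f q) (fderiv ℝ f q (0, 1))) =ᶠ[𝓝 p]
        fun q => edgeCutoff r q.1 * deriv (middleStep r) q.2 := by
      filter_upwards [h.emb.isOpen.mem_nhds hp] with q hq
      rw [h.sinkForm_apply hq, one_mul]
    have h4 : (fun q => sinkForm f r (f q) (fderiv ℝ f q (1, 0))) =ᶠ[𝓝 p] fun q => 0 := by
      filter_upwards [h.emb.isOpen.mem_nhds hp] with q hq
      rw [h.sinkForm_apply hq, zero_mul]
    have h5 : HasFDerivAt (fun q : ℝ × ℝ => edgeCutoff r q.1 * deriv (middleStep r) q.2) _ p :=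
      (((contDiff_edgeCutoff r).differentiable (by simp) p.1).hasDerivAt.comp_hasFDerivAt p
        (hasFDerivAt_fst (𝕜 := ℝ) (E := ℝ) (F := ℝ))).mul
      (((contDiff_deriv_middleStep r).differentiable (by simp) p.2).hasDerivAt.comp_hasFDerivAt p
        (hasFDerivAt_snd (𝕜 := ℝ) (E := ℝ) (F := ℝ)))
    have h6 : fderiv ℝ (fun q => sinkForm f r (f q) (fderiv ℝ f q (0, 1))) p (1, 0) =
        deriv (edgeCutoff r) p.1 * deriv (middleStep r) p.2 := by
      rw [h3.fderiv_eq, h5.fderiv]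
      simp [mul_comm]
    have h7 : fderiv ℝ (fun q => sinkForm f r (f q) (fderiv ℝ f q (1, 0))) p (0, 1) = 0 := by
      rw [h4.fderiv_eq]
      simp
    rw [h2, h6, h7, sub_zero] at h1
    have h8 : 0 < (fderiv ℝ f p (1, 0)).re * (fderiv ℝ f p (0, 1)).im -
      (fderiv ℝ f p (1, 0)).im * (fderiv ℝ f p (0, 1)).re := h.emb.oriented p hp
    have h9 := mul_nonpos_of_nonpos_of_nonneg (deriv_edgeCutoff_nonpos h.pos p.1)
      (deriv_middleStep_nonneg h.pos p.2)
    rw [← h1] at h9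
    exact nonpos_of_mul_nonpos_right h9 h8
  · have hcl : z ∉ closure (f '' (Iic (r / 2) ×ˢ Icc (1 / 2 - r / 2) (1 / 2 + r / 2))) :=
      fun hcl => (h.closure_image hcl).elim
        (fun ⟨p, hp, hpz⟩ => hzV ⟨p, h.window_subset hp.1 hp.2, hpz⟩) hz.2
    have : sinkForm f r =ᶠ[𝓝 z] fun _ => 0 := by
      filter_upwards [isClosed_closure.isOpen_compl.mem_nhds hcl] with w hw
      exact h.sinkForm_eq_zero fun hw' => hw (subset_closure hw')
    rw [this.fderiv_eq]
    simp

open Classical in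
theorem isWeakProfile_sinkForm (h : E.IsExtendedChart ζ f r) (hζ : (ζ : ℂ) ∈ S.neg) :
    E.IsWeakProfile (sinkForm f r) (Pi.single ζ 1) where
  smooth z hz := (h.contDiffAt_sinkForm hz).contDiffWithinAt
  tangential z hz := by
    rw [h.sinkForm_eq_zero, zero_apply]
    rintro ⟨p, hp, rfl⟩
    have h1 := h.norm_lt p (h.window_subset hp.1 hp.2)
    have h2 := hz.1
    rw [mem_sphere_zero_iff_norm] at h2
    exact h1.ne h2
  curl_nonpos z hz := h.curl_sinkForm_nonpos hz
  ends ζ' := by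
    by_cases hζ' : ζ' = ζ
    · subst hζ'
      refine ⟨deriv (middleStep r), (contDiff_deriv_middleStep r).contDiffOn, ?_, fun p hp v => ?_⟩
      · rw [integral_deriv_middleStep h.pos h.lt]
        simp [sign, hζ]
      · by_cases hpt : p.2 ∈ Icc (1 / 2 - r / 2) (1 / 2 + r / 2)
        · have hr := h.pos
          have hp0 : p.1 ≤ 0 := hp.1
          have hpV := h.window_subset (by linarith) hpt
          rw [h.fderivWithin_chart hpV hp0, ← h.eq_chart p hpV hp0, h.sinkForm_apply hpV,
            edgeCutoff_eq_one hr hp0, one_mul]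
        · rw [h.sinkForm_eq_zero, zero_apply, deriv_middleStep_eq_zero h.pos hpt, mul_zero]
          rintro ⟨q, hq, hqp⟩
          obtain ⟨-, rfl⟩ := h.eq_of_chart_eq hp (h.window_subset hq.1 hq.2) hqp.symm
          exact hpt hq.2
    · refine ⟨fun _ => 0, contDiffOn_const, by simp [hζ'], fun p hp v => ?_⟩
      rw [h.sinkForm_eq_zero, zero_apply, mul_zero]
      rintro ⟨q, hq, hqp⟩
      exact hζ' (h.eq_of_chart_eq hp (h.window_subset hq.1 hq.2) hqp.symm).1

end IsExtendedChart

end Ends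

end PuncturedDisc

/-! ### Smooth functions with prescribed values -/

/-- Local smooth solutions of a convex condition on an open subset of the plane can be glued
together. -/
theorem exists_contDiffOn_forall_mem_convex_of_local {U : Set ℂ} (hU : IsOpen U) {t : ℂ → Set ℝ}
    (ht : ∀ x, Convex ℝ (t x))
    (h : ∀ x ∈ U, ∃ W ∈ 𝓝 x, ∃ g : ℂ → ℝ, ContDiffOn ℝ ∞ g W ∧ ∀ y ∈ W, g y ∈ t y) :
    ∃ g : ℂ → ℝ, ContDiffOn ℝ ∞ g U ∧ ∀ y ∈ U, g y ∈ t y := by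
  classical
  let M : TopologicalSpace.Opens ℂ := ⟨U, hU⟩
  have : LocallyCompactSpace M := hU.locallyCompactSpace
  have : SigmaCompactSpace M := sigmaCompactSpace_of_locallyCompact_secondCountable
  obtain ⟨g, hg⟩ := exists_contMDiffMap_forall_mem_convex_of_local (n := (⊤ : ℕ∞))
    (modelWithCornersSelf ℝ ℂ) (M := M) (t := fun x => t x) (fun x => ht x) (fun x => by
      obtain ⟨W, hW, g, hg, hgt⟩ := h x x.2
      refine ⟨Subtype.val ⁻¹' W, continuous_subtype_val.continuousAt.preimage_mem_nhds hW,
        fun y => g y, ?_, fun y hy => hgt y hy⟩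
      exact hg.contMDiffOn.comp (contMDiff_subtype_val.contMDiffOn) fun y hy => hy)
  let G : ℂ → ℝ := fun y => if hy : y ∈ U then g ⟨y, hy⟩ else 0
  have hG : ∀ y : M, G y = g y := fun y => dif_pos y.2
  refine ⟨G, fun y hy => ?_, fun y hy => ?_⟩
  · have h1 : ContMDiffAt (modelWithCornersSelf ℝ ℂ) (modelWithCornersSelf ℝ ℝ) ∞
        (fun z : M => G z) ⟨y, hy⟩ := by
      rw [show (fun z : M => G z) = g from funext hG]
      exact g.contMDiff.contMDiffAt
    exact ((contMDiffAt_subtype_iff (U := M) (f := G)).1 h1).contDiffAt.contDiffWithinAt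
  · rw [hG ⟨y, hy⟩]
    exact hg ⟨y, hy⟩

/-! ### The boundary near a puncture -/

namespace PuncturedDisc

variable {S : PuncturedDisc}

namespace Ends

variable (E : S.Ends) (ζ : S.punctures)

theorem hasFDerivWithinAt_norm_sq_chart {p : ℝ × ℝ} (hp : p ∈ strip) :
    HasFDerivWithinAt (fun q => ‖E.chart ζ q‖ ^ 2)
      (2 • (innerSL ℝ (E.chart ζ p)).comp (fderivWithin ℝ (E.chart ζ) strip p)) strip p :=
  (E.chart_hasFDerivWithinAt ζ hp).norm_sq

/-- Boundary points of an end maximize the norm, so that it does not increase, to first order, in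
directions pointing into the end. -/
theorem inner_fderivWithin_chart_nonpos {p v : ℝ × ℝ} (hp : p ∈ strip) (ht : p.2 = 0 ∨ p.2 = 1)
    (hv : p + v ∈ strip) :
    (E.chart ζ p).re * (fderivWithin ℝ (E.chart ζ) strip p v).re +
      (E.chart ζ p).im * (fderivWithin ℝ (E.chart ζ) strip p v).im ≤ 0 := by
  have hmax : IsMaxOn (fun q => ‖E.chart ζ q‖ ^ 2) strip p := by
    intro q hq
    have h1 : ‖E.chart ζ p‖ = 1 :=
      mem_sphere_zero_iff_norm.1 ((E.chart_mem_boundary ζ hp).2 ht).1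
    have h2 : ‖E.chart ζ q‖ ≤ 1 := mem_closedBall_zero_iff.1 (E.chart_mapsTo ζ hq).1
    change ‖E.chart ζ q‖ ^ 2 ≤ ‖E.chart ζ p‖ ^ 2
    rw [h1]
    exact pow_le_pow_left₀ (norm_nonneg _) h2 2
  have hconv : Convex ℝ strip := (convex_Iic _).prod (convex_Icc _ _)
  have h3 := hmax.localize.hasFDerivWithinAt_nonpos (E.hasFDerivWithinAt_norm_sq_chart ζ hp)
    (mem_posTangentConeAt_of_segment_subset (hconv.segment_subset hp hv))
  have h4 : (2 • (innerSL ℝ (E.chart ζ p)).comp (fderivWithin ℝ (E.chart ζ) strip p)) v =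
      2 * ((E.chart ζ p).re * (fderivWithin ℝ (E.chart ζ) strip p v).re +
      (E.chart ζ p).im * (fderivWithin ℝ (E.chart ζ) strip p v).im) := by
    simp [Complex.inner]
    ring
  rw [h4] at h3
  linarith

/-- As `s` increases, the side `t = 0` of an end moves counterclockwise along the unit circle, and the
side `t = 1` moves clockwise. -/
theorem exists_fderivWithin_chart_eq {p : ℝ × ℝ} (hp : p ∈ strip) (hs : p.1 < 0)
    (ht : p.2 = 0 ∨ p.2 = 1) :
    ∃ c : ℝ, 0 < (1 - 2 * p.2) * c ∧
      fderivWithin ℝ (E.chart ζ) strip p (1, 0) = c • (Complex.I * E.chart ζ p) := by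
  have h1 : ‖E.chart ζ p‖ = 1 :=
    mem_sphere_zero_iff_norm.1 ((E.chart_mem_boundary ζ hp).2 ht).1
  have hsq : (E.chart ζ p).re ^ 2 + (E.chart ζ p).im ^ 2 = 1 := by
    have := Complex.sq_norm (E.chart ζ p)
    rw [h1, Complex.normSq_apply] at this
    linarith
  have ht2 : (1 - 2 * p.2) ^ 2 = 1 := by rcases ht with h | h <;> rw [h] <;> norm_num
  have hX1 := E.inner_fderivWithin_chart_nonpos ζ hp ht (v := p.1 • (1, 0)) <| by
    refine ⟨?_, ?_⟩
    · simp; linarith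
    · simpa using hp.2
  have hX2 := E.inner_fderivWithin_chart_nonpos ζ hp ht (v := (-p.1) • (1, 0)) <| by
    refine ⟨?_, ?_⟩
    · simp
    · simpa using hp.2
  have hY := E.inner_fderivWithin_chart_nonpos ζ hp ht (v := (1 - 2 * p.2) • (0, 1)) <| by
    refine ⟨?_, ?_⟩
    · simpa using hp.1
    · rcases ht with h | h
      · simp [h]
      · simp [h]
        norm_num
  have hor : IsOrientedBasis (fderivWithin ℝ (E.chart ζ) strip p (1, 0))
    (fderivWithin ℝ (E.chart ζ) strip p (0, 1)) := (E.isEnd_chart ζ).oriented p hp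
  unfold IsOrientedBasis at hor
  rw [map_smul] at hX1 hX2 hY
  set w := E.chart ζ p
  set X := fderivWithin ℝ (E.chart ζ) strip p (1, 0)
  set Y := fderivWithin ℝ (E.chart ζ) strip p (0, 1)
  simp only [Complex.smul_re, Complex.smul_im, smul_eq_mul] at hX1 hX2 hY
  have hX : w.re * X.re + w.im * X.im = 0 := by
    have : p.1 * (w.re * X.re + w.im * X.im) = 0 := by nlinarith
    exact (mul_eq_zero.1 this).resolve_left hs.ne
  set c := w.re * X.im - w.im * X.re with hc
  have hre : X.re = -(c * w.im) := by
    linear_combination (-X.re) * hsq + w.re * hX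
  have him : X.im = c * w.re := by
    linear_combination (-X.im) * hsq + w.im * hX
  refine ⟨c, ?_, ?_⟩
  · rw [hre, him] at hor
    have h2 : 0 < ((1 - 2 * p.2) * c) * (-((1 - 2 * p.2) * (w.re * Y.re + w.im * Y.im))) := by
      have : ((1 - 2 * p.2) * c) * (-((1 - 2 * p.2) * (w.re * Y.re + w.im * Y.im))) =
        (1 - 2 * p.2) ^ 2 * (-(c * w.im) * Y.im - c * w.re * Y.re) := by ring
      rw [this, ht2, one_mul]
      exact hor
    exact pos_of_mul_pos_left h2 (by linarith)
  · apply Complex.ext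
    · simp [hre]
    · simp [him]

theorem hasDerivWithinAt_chart_side {s t : ℝ} (hp : (s, t) ∈ strip) :
    HasDerivWithinAt (fun s => E.chart ζ (s, t))
      (fderivWithin ℝ (E.chart ζ) strip (s, t) (1, 0)) (Iic 0) s :=
  (E.chart_hasFDerivWithinAt ζ hp).comp_hasDerivWithinAt_of_eq s
    ((hasDerivWithinAt_id s (Iic 0)).prodMk (hasDerivWithinAt_const s (Iic 0) t))
    (fun _ hx => ⟨hx, hp.2⟩) rfl

theorem side_mem_strip {s t : ℝ} (hs : s ≤ 0) (ht : t = 0 ∨ t = 1) : (s, t) ∈ strip := by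
  rcases ht with rfl | rfl
  · exact ⟨hs, le_rfl, zero_le_one⟩
  · exact ⟨hs, zero_le_one, le_rfl⟩

theorem continuousOn_chart_side {t : ℝ} (ht : t = 0 ∨ t = 1) :
    ContinuousOn (fun s => E.chart ζ (s, t)) (Iic 0) := fun _ hs =>
  (E.hasDerivWithinAt_chart_side ζ (side_mem_strip hs ht)).continuousWithinAt

/-- The sides of the ends do not cross a line which meets the unit circle in punctures only. -/
theorem side_lt {μ : ℂ →L[ℝ] ℝ} {a : ℝ} (hne : ∀ z ∈ S.boundary, μ z ≠ a) {t : ℝ}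
    (ht : t = 0 ∨ t = 1) {s s' : ℝ} (hs : s ≤ 0) (hs' : s' ≤ 0) (h : a < μ (E.chart ζ (s, t))) :
    a < μ (E.chart ζ (s', t)) := by
  by_contra hcon
  have hc : ContinuousOn (fun s => μ (E.chart ζ (s, t))) (Iic 0) :=
    μ.continuous.comp_continuousOn (E.continuousOn_chart_side ζ ht)
  obtain ⟨x, hx, hxa⟩ := isPreconnected_Iic.intermediate_value hs' hs hc ⟨not_lt.1 hcon, h.le⟩
  exact hne _ ((E.chart_mem_boundary ζ (side_mem_strip hx ht)).2 ht) hxa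

/-- The position of the sides of an end relative to a line through the puncture is determined by the
orientation. -/
theorem lt_side {μ : ℂ →L[ℝ] ℝ} {a : ℝ} (hne : ∀ z ∈ S.boundary, μ z ≠ a) (hζ : μ ζ = a) {t : ℝ}
    (ht : t = 0 ∨ t = 1) (hpos : 0 < (1 - 2 * t) * μ (Complex.I * ζ)) {s : ℝ} (hs : s ≤ 0) :
    a < μ (E.chart ζ (s, t)) := by
  have hlim := (E.isEnd_chart ζ).tendsto t (side_mem_strip le_rfl ht).2
  have hev : ∀ᶠ s in atBot, 0 < (1 - 2 * t) * μ (Complex.I * E.chart ζ (s, t)) :=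
    (((μ.continuous.tendsto _).comp (hlim.const_mul Complex.I)).const_mul (1 - 2 * t)).eventually
      (lt_mem_nhds hpos)
  obtain ⟨b, hb⟩ := eventually_atBot.1 hev
  -- the function `μ` increases along the side, starting with the value `a` at the puncture
  let b' := min b (-1)
  have hb0 : b' < 0 := lt_of_le_of_lt (min_le_right _ _) (by norm_num)
  have hmono : MonotoneOn (fun s => μ (E.chart ζ (s, t))) (Iic b') := by
    have hd : ∀ s ∈ Iic b', HasDerivAt (fun s => μ (E.chart ζ (s, t)))
        (μ (fderivWithin ℝ (E.chart ζ) strip (s, t) (1, 0))) s := fun s hs => by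
      have hs0 : s < 0 := lt_of_le_of_lt hs hb0
      exact μ.hasFDerivAt.comp_hasDerivAt s ((E.hasDerivWithinAt_chart_side ζ
        (side_mem_strip hs0.le ht)).hasDerivAt (Iic_mem_nhds hs0))
    refine monotoneOn_of_deriv_nonneg (convex_Iic _)
      (fun s hs => (hd s hs).continuousAt.continuousWithinAt)
      (fun s hs => (hd s (interior_subset hs)).differentiableAt.differentiableWithinAt)
      fun s hs => ?_
    have hs' : s ∈ Iic b' := interior_subset hs
    rw [(hd s hs').deriv]
    obtain ⟨c, hc, hcd⟩ := E.exists_fderivWithin_chart_eq ζ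
      (side_mem_strip (hs'.trans hb0.le) ht) (lt_of_le_of_lt hs' hb0) ht
    have h1 := mul_pos hc (hb s (hs'.trans (min_le_left _ _)))
    have h2 : (1 - 2 * t) ^ 2 = 1 := by rcases ht with h | h <;> rw [h] <;> norm_num
    rw [hcd, map_smul, smul_eq_mul]
    change 0 < (1 - 2 * t) * c * _ at h1
    nlinarith
  have hle : a ≤ μ (E.chart ζ (b', t)) := by
    have h1 : Tendsto (fun s => μ (E.chart ζ (s, t))) atBot (𝓝 a) := by
      rw [← hζ]
      exact (μ.continuous.tendsto _).comp hlim
    refine le_of_tendsto h1 ?_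
    filter_upwards [eventually_le_atBot b'] with s hs using hmono hs self_mem_Iic hs
  exact E.side_lt ζ hne ht hb0.le hs (lt_of_le_of_ne hle
    (hne _ ((E.chart_mem_boundary ζ (side_mem_strip hb0.le ht)).2 ht)).symm)

end Ends

end PuncturedDisc

namespace PuncturedDisc

variable {S : PuncturedDisc}

/-! ### Functions interpolating between boundary values -/

namespace Ends

variable (E : S.Ends)

/-- A function on the boundary which is locally constant, and constant on both sides of each end. -/
structure IsBoundaryValue (b : ℂ → ℝ) : Prop where
  eventually_eq : ∀ z ∈ S.boundary, ∀ᶠ w in 𝓝 z, w ∈ S.boundary → b w = b z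
  side_eq : ∀ ζ s t, s ≤ 0 → t = 0 ∨ t = 1 → b (E.chart ζ (s, t)) = b (E.chart ζ (0, t))

/-- The function on an end which only depends on `t`, and goes from one boundary value to the other
in the window of width `r` around `t = 1/2`. -/
def interpolation (b : ℂ → ℝ) (ζ : S.punctures) (r t : ℝ) : ℝ :=
  b (E.chart ζ (0, 0)) + (b (E.chart ζ (0, 1)) - b (E.chart ζ (0, 0))) * middleStep r t

theorem contDiff_interpolation (b : ℂ → ℝ) (ζ : S.punctures) (r : ℝ) :
    ContDiff ℝ ∞ (E.interpolation b ζ r) :=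
  contDiff_const.add (contDiff_const.mul (contDiff_middleStep r))

theorem interpolation_of_le {b : ℂ → ℝ} {ζ : S.punctures} {r t : ℝ} (hr : 0 < r)
    (ht : t ≤ 1 / 2 - r / 2) : E.interpolation b ζ r t = b (E.chart ζ (0, 0)) := by
  simp [interpolation, middleStep_eq_zero hr ht]

theorem interpolation_of_ge {b : ℂ → ℝ} {ζ : S.punctures} {r t : ℝ} (hr : 0 < r)
    (ht : 1 / 2 + r / 2 ≤ t) : E.interpolation b ζ r t = b (E.chart ζ (0, 1)) := by
  simp [interpolation, middleStep_eq_one hr ht]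

/-- The values which an interpolating function may take at `z`. -/
def admissible (b : ℂ → ℝ) (r : S.punctures → ℝ) (z : ℂ) : Set ℝ :=
  {v | (z ∈ S.boundary → v = b z) ∧
    ∀ ζ, ∀ p ∈ strip, E.chart ζ p = z → v = E.interpolation b ζ (r ζ) p.2}

theorem convex_admissible (b : ℂ → ℝ) (r : S.punctures → ℝ) (z : ℂ) :
    Convex ℝ (E.admissible b r z) := by
  intro x hx y hy a c _ _ hac
  have key : ∀ v, x = v → y = v → a • x + c • y = v := fun v h1 h2 => by
    rw [h1, h2, ← add_smul, hac, one_smul]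
  exact ⟨fun hz => key _ (hx.1 hz) (hy.1 hz),
    fun ζ p hp hpz => key _ (hx.2 ζ p hp hpz) (hy.2 ζ p hp hpz)⟩

variable {E} {b : ℂ → ℝ} {f : S.punctures → ℝ × ℝ → ℂ} {r : S.punctures → ℝ}

theorem IsBoundaryValue.admissible_nonempty (hb : E.IsBoundaryValue b)
    (hr : ∀ ζ, 0 < r ζ ∧ r ζ < 1 / 4) (z : ℂ) : (E.admissible b r z).Nonempty := by
  by_cases h : ∃ ζ, ∃ p ∈ strip, E.chart ζ p = z
  · obtain ⟨ζ, ⟨s, t⟩, hp, rfl⟩ := h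
    refine ⟨E.interpolation b ζ (r ζ) t, fun hz => ?_, fun ζ' q hq hqp => ?_⟩
    · rcases (E.chart_mem_boundary ζ hp).1 hz with h | h
      · change t = 0 at h
        subst h
        rw [E.interpolation_of_le (hr ζ).1 (by linarith [hr ζ]),
          hb.side_eq ζ s 0 hp.1 (Or.inl rfl)]
      · change t = 1 at h
        subst h
        rw [E.interpolation_of_ge (hr ζ).1 (by linarith [hr ζ]),
          hb.side_eq ζ s 1 hp.1 (Or.inr rfl)]
    · by_cases hζ : ζ' = ζ
      · subst hζ
        rw [E.chart_injOn _ hq hp hqp]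
      · exact absurd ⟨_, hp, rfl⟩ (disjoint_left.1 (E.disjoint_chart hζ) ⟨q, hq, hqp⟩)
  · exact ⟨b z, fun _ => rfl, fun ζ p hp hpz => absurd ⟨ζ, p, hp, hpz⟩ h⟩

/-- A point `z` which is not in the image of a part of an end has a neighbourhood which is
disjoint from that part. -/
theorem eventually_notMem_chart_image {ζ : S.punctures} {C : Set (ℝ × ℝ)} (hC : IsClosed C)
    (hCs : C ⊆ strip) {z : ℂ} (hz : z ∉ S.punctures) (h : z ∉ E.chart ζ '' C) :
    ∀ᶠ w in 𝓝 z, ∀ p ∈ C, E.chart ζ p ≠ w := by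
  have hcl : z ∉ closure (E.chart ζ '' C) := fun hcl =>
    (E.closure_chart_image ζ hC hCs hcl).elim h hz
  filter_upwards [isClosed_closure.isOpen_compl.mem_nhds hcl] with w hw p hp hpw
  exact hw (subset_closure ⟨p, hp, hpw⟩)

/-- Near a point in the window of an end, the interpolation in the coordinates of the extended chart
is a local solution; elsewhere, a constant is. -/
theorem IsBoundaryValue.exists_local (hb : E.IsBoundaryValue b)
    (h : ∀ ζ, E.IsExtendedChart ζ (f ζ) (r ζ)) {z : ℂ} (hz : z ∉ S.punctures) :
    ∃ W ∈ 𝓝 z, ∃ g : ℂ → ℝ, ContDiffOn ℝ ∞ g W ∧ ∀ y ∈ W, g y ∈ E.admissible b r y := by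
  by_cases hwin : ∃ ζ, z ∈ f ζ '' (Iio (r ζ) ×ˢ Ioo (1 / 2 - r ζ) (1 / 2 + r ζ))
  · obtain ⟨ζ, hζ⟩ := hwin
    refine ⟨_, (h ζ).emb.isOpen_image.mem_nhds hζ, fun y => E.interpolation b ζ (r ζ)
      (Function.invFunOn (f ζ) (Iio (r ζ) ×ˢ Ioo (1 / 2 - r ζ) (1 / 2 + r ζ)) y).2,
      (E.contDiff_interpolation b ζ (r ζ)).comp_contDiffOn (h ζ).emb.contDiffOn_invFunOn.snd, ?_⟩
    rintro _ ⟨q, hq, rfl⟩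
    refine ⟨fun hqb => ?_, fun ζ' p hp hpq => ?_⟩
    · exact absurd (mem_sphere_zero_iff_norm.1 hqb.1) ((h ζ).norm_lt q hq).ne
    · obtain ⟨rfl, rfl⟩ := (h ζ).eq_of_chart_eq hp hq hpq
      simp only [(h _).emb.invFunOn_apply hq]
  · -- away from the windows, a constant will do
    obtain ⟨v, hv⟩ := hb.admissible_nonempty (fun ζ => ⟨(h ζ).pos, (h ζ).lt⟩) z
    have h1 : ∀ᶠ y in 𝓝 z, y ∈ S.boundary → v = b y := by
      by_cases hzb : z ∈ S.boundary
      · filter_upwards [hb.eventually_eq z hzb] with y hy hyb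
        rw [hv.1 hzb, hy hyb]
      · have : z ∉ Metric.sphere (0 : ℂ) 1 := fun hs => hzb ⟨hs, hz⟩
        filter_upwards [Metric.isClosed_sphere.isOpen_compl.mem_nhds this] with y hy hyb
        exact absurd hyb.1 hy
    have h2 : ∀ ζ, ∀ᶠ y in 𝓝 z, ∀ p ∈ strip, E.chart ζ p = y →
        v = E.interpolation b ζ (r ζ) p.2 := by
      intro ζ
      have hpos := (h ζ).pos
      have hlt := (h ζ).lt
      have hlow : ∀ᶠ y in 𝓝 z, ∀ p ∈ Iic (0 : ℝ) ×ˢ Icc (0 : ℝ) (1 / 2 - r ζ / 2),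
          E.chart ζ p = y → v = E.interpolation b ζ (r ζ) p.2 := by
        have hsub : Iic (0 : ℝ) ×ˢ Icc (0 : ℝ) (1 / 2 - r ζ / 2) ⊆ strip :=
          prod_mono subset_rfl (Icc_subset_Icc le_rfl (by linarith))
        by_cases hmem : z ∈ E.chart ζ '' (Iic (0 : ℝ) ×ˢ Icc (0 : ℝ) (1 / 2 - r ζ / 2))
        · obtain ⟨q, hq, hqz⟩ := hmem
          refine Eventually.of_forall fun y p hp _ => ?_
          rw [hv.2 ζ q (hsub hq) hqz, E.interpolation_of_le hpos hq.2.2,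
            E.interpolation_of_le hpos hp.2.2]
        · filter_upwards [eventually_notMem_chart_image (isClosed_Iic.prod isClosed_Icc) hsub hz
            hmem] with y hy p hp hpy
          exact absurd hpy (hy p hp)
      have hhigh : ∀ᶠ y in 𝓝 z, ∀ p ∈ Iic (0 : ℝ) ×ˢ Icc (1 / 2 + r ζ / 2) 1,
          E.chart ζ p = y → v = E.interpolation b ζ (r ζ) p.2 := by
        have hsub : Iic (0 : ℝ) ×ˢ Icc (1 / 2 + r ζ / 2) 1 ⊆ strip :=
          prod_mono subset_rfl (Icc_subset_Icc (by linarith) le_rfl)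
        by_cases hmem : z ∈ E.chart ζ '' (Iic (0 : ℝ) ×ˢ Icc (1 / 2 + r ζ / 2) 1)
        · obtain ⟨q, hq, hqz⟩ := hmem
          refine Eventually.of_forall fun y p hp _ => ?_
          rw [hv.2 ζ q (hsub hq) hqz, E.interpolation_of_ge hpos hq.2.1,
            E.interpolation_of_ge hpos hp.2.1]
        · filter_upwards [eventually_notMem_chart_image (isClosed_Iic.prod isClosed_Icc) hsub hz
            hmem] with y hy p hp hpy
          exact absurd hpy (hy p hp)
      have hmid : ∀ᶠ y in 𝓝 z, ∀ p ∈ Iic (0 : ℝ) ×ˢ Icc (1 / 2 - r ζ / 2) (1 / 2 + r ζ / 2),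
          E.chart ζ p ≠ y := by
        refine eventually_notMem_chart_image (isClosed_Iic.prod isClosed_Icc)
          (prod_mono subset_rfl (Icc_subset_Icc (by linarith) (by linarith))) hz ?_
        rintro ⟨q, hq, hqz⟩
        have hq0 : q.1 ≤ 0 := hq.1
        have hqV := (h ζ).window_subset (by linarith) hq.2
        exact hwin ⟨ζ, q, hqV, ((h ζ).eq_chart q hqV hq0).trans hqz⟩
      filter_upwards [hlow, hhigh, hmid] with y hy1 hy2 hy3 p hp hpy
      rcases le_total p.2 (1 / 2 - r ζ / 2) with h4 | h4
      · exact hy1 p ⟨hp.1, hp.2.1, h4⟩ hpy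
      · rcases le_total p.2 (1 / 2 + r ζ / 2) with h5 | h5
        · exact absurd hpy (hy3 p ⟨hp.1, h4, h5⟩)
        · exact hy2 p ⟨hp.1, h5, hp.2.2⟩ hpy
    have : Finite S.punctures := S.finite_punctures
    have h3 := h1.and (eventually_all.2 h2)
    exact ⟨_, h3, fun _ => v, contDiffOn_const, fun y hy => hy⟩

theorem IsBoundaryValue.exists_interpolating (hb : E.IsBoundaryValue b)
    (h : ∀ ζ, E.IsExtendedChart ζ (f ζ) (r ζ)) :
    ∃ C : ℂ → ℝ, ContDiffOn ℝ ∞ C S.puncturesᶜ ∧ ∀ z ∉ S.punctures, C z ∈ E.admissible b r z :=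
  exists_contDiffOn_forall_mem_convex_of_local S.finite_punctures.isClosed.isOpen_compl
    (E.convex_admissible b r) fun _ hz => hb.exists_local h hz

/-- The differential of an interpolating function is a weak profile. -/
theorem IsBoundaryValue.exists_isWeakProfile (hb : E.IsBoundaryValue b) :
    ∃ γ, E.IsWeakProfile γ fun ζ =>
      E.sign ζ * (b (E.chart ζ (0, 1)) - b (E.chart ζ (0, 0))) := by
  choose f r h using fun ζ => E.exists_isExtendedChart ζ
  obtain ⟨C, hC, hCb⟩ := hb.exists_interpolating h
  have hopen : IsOpen S.puncturesᶜ := S.finite_punctures.isClosed.isOpen_compl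
  have hCat : ∀ z ∉ S.punctures, ContDiffAt ℝ ∞ C z := fun z hz =>
    hC.contDiffAt (hopen.mem_nhds hz)
  refine ⟨fderiv ℝ C, hC.fderiv_of_isOpen hopen (by simp), fun z hz => ?_, fun z hz => ?_,
    fun ζ => ?_⟩
  · -- `C` is constant along the unit circle near `z`
    have h1 : HasDerivAt (fun θ : ℝ => Complex.exp (θ * Complex.I) * z) (Complex.I * z) 0 := by
      have := ((Complex.ofRealCLM.hasDerivAt (x := (0 : ℝ))).mul_const Complex.I).cexp.mul_const z
      simpa using this
    have h2 := ((hCat z hz.2).differentiableAt (by simp)).hasFDerivAt.comp_hasDerivAt_of_eq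
      (0 : ℝ) h1 (by simp)
    have htend : Tendsto (fun θ : ℝ => Complex.exp (θ * Complex.I) * z) (𝓝 0) (𝓝 z) := by
      have := h1.continuousAt.tendsto
      simpa using this
    have h3 : (C ∘ fun θ : ℝ => Complex.exp (θ * Complex.I) * z) =ᶠ[𝓝 0] fun _ => b z := by
      filter_upwards [htend.eventually (hb.eventually_eq z hz),
        htend.eventually (hopen.mem_nhds hz.2)] with θ hθ hθ'
      have hmem : Complex.exp (θ * Complex.I) * z ∈ S.boundary := by
        refine ⟨?_, hθ'⟩
        rw [mem_sphere_zero_iff_norm, norm_mul, Complex.norm_exp_ofReal_mul_I, one_mul]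
        exact mem_sphere_zero_iff_norm.1 hz.1
      rw [Function.comp_apply, (hCb _ hθ').1 hmem, hθ hmem]
    exact h2.unique ((hasDerivAt_const (0 : ℝ) (b z)).congr_of_eventuallyEq h3)
  · have hs : IsSymmSndFDerivAt ℝ C z :=
      (hCat z hz.2).isSymmSndFDerivAt (by simpa using two_le_infty)
    rw [hs.eq 1 Complex.I, sub_self]
  · refine ⟨deriv (E.interpolation b ζ (r ζ)), ?_, ?_, fun p hp v => ?_⟩
    · exact (contDiff_infty_iff_deriv.1 (E.contDiff_interpolation b ζ (r ζ))).2.contDiffOn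
    · have hpos := (h ζ).pos
      have hlt := (h ζ).lt
      rw [intervalIntegral.integral_deriv_eq_sub
        (fun s _ => (E.contDiff_interpolation b ζ (r ζ)).differentiable (by simp) s)
        ((E.contDiff_interpolation b ζ (r ζ)).continuous_deriv
          (by simp)).continuousOn.intervalIntegrable,
        E.interpolation_of_ge hpos (by linarith), E.interpolation_of_le hpos (by linarith)]
    · have hpz : E.chart ζ p ∉ S.punctures := (E.chart_mapsTo ζ hp).2
      have h1 := ((hCat _ hpz).differentiableAt (by simp)).hasFDerivAt.comp_hasFDerivWithinAt p
        (E.chart_hasFDerivWithinAt ζ hp)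
      have h2 : HasFDerivWithinAt (fun q : ℝ × ℝ => E.interpolation b ζ (r ζ) q.2)
          (deriv (E.interpolation b ζ (r ζ)) p.2 • ContinuousLinearMap.snd ℝ ℝ ℝ) strip p :=
        (((E.contDiff_interpolation b ζ (r ζ)).differentiable (by simp)
          p.2).hasDerivAt.comp_hasFDerivAt p hasFDerivAt_snd).hasFDerivWithinAt
      have h3 : EqOn (C ∘ E.chart ζ) (fun q : ℝ × ℝ => E.interpolation b ζ (r ζ) q.2) strip :=
        fun q hq => (hCb _ (E.chart_mapsTo ζ hq).2).2 ζ q hq rfl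
      have h4 := (uniqueDiffOn_strip p hp).eq h1 (h2.congr h3 (h3 hp))
      have h5 := congrArg (fun L : ℝ × ℝ →L[ℝ] ℝ => L v) h4
      simpa [mul_comm] using h5

/-! ### Boundary values jumping at two punctures -/

/-- The linear function whose level line through `ζ₁` is the line through `ζ₁` and `ζ₂`, and which is
larger to the right of that line. -/
def chordForm (ζ₁ ζ₂ : ℂ) : ℂ →L[ℝ] ℝ :=
  (ζ₂ - ζ₁).im • Complex.reCLM - (ζ₂ - ζ₁).re • Complex.imCLM

theorem chordForm_apply (ζ₁ ζ₂ z : ℂ) :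
    chordForm ζ₁ ζ₂ z = (ζ₂.im - ζ₁.im) * z.re - (ζ₂.re - ζ₁.re) * z.im := by
  simp [chordForm]

theorem chordForm_right (ζ₁ ζ₂ : ℂ) : chordForm ζ₁ ζ₂ ζ₂ = chordForm ζ₁ ζ₂ ζ₁ := by
  rw [chordForm_apply, chordForm_apply]
  ring

theorem re_sq_add_im_sq {z : ℂ} (hz : ‖z‖ = 1) : z.re ^ 2 + z.im ^ 2 = 1 := by
  have := Complex.sq_norm z
  rw [hz, Complex.normSq_apply] at this
  linarith

section

variable {ζ₁ ζ₂ : ℂ}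

theorem inner_lt_one (h₁ : ‖ζ₁‖ = 1) (h₂ : ‖ζ₂‖ = 1) (hne : ζ₁ ≠ ζ₂) :
    ζ₁.re * ζ₂.re + ζ₁.im * ζ₂.im < 1 := by
  have h3 : 0 < Complex.normSq (ζ₁ - ζ₂) := Complex.normSq_pos.2 (sub_ne_zero.2 hne)
  rw [Complex.normSq_apply, Complex.sub_re, Complex.sub_im] at h3
  nlinarith [re_sq_add_im_sq h₁, re_sq_add_im_sq h₂]

theorem chordForm_I_mul_left_pos (h₁ : ‖ζ₁‖ = 1) (h₂ : ‖ζ₂‖ = 1) (hne : ζ₁ ≠ ζ₂) :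
    0 < chordForm ζ₁ ζ₂ (Complex.I * ζ₁) := by
  have e : chordForm ζ₁ ζ₂ (Complex.I * ζ₁) =
      (ζ₁.re ^ 2 + ζ₁.im ^ 2) - (ζ₁.re * ζ₂.re + ζ₁.im * ζ₂.im) := by
    rw [chordForm_apply]
    simp
    ring
  rw [e, re_sq_add_im_sq h₁, sub_pos]
  exact inner_lt_one h₁ h₂ hne

theorem chordForm_I_mul_right_neg (h₁ : ‖ζ₁‖ = 1) (h₂ : ‖ζ₂‖ = 1) (hne : ζ₁ ≠ ζ₂) :
    chordForm ζ₁ ζ₂ (Complex.I * ζ₂) < 0 := by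
  have e : chordForm ζ₁ ζ₂ (Complex.I * ζ₂) =
      (ζ₁.re * ζ₂.re + ζ₁.im * ζ₂.im) - (ζ₂.re ^ 2 + ζ₂.im ^ 2) := by
    rw [chordForm_apply]
    simp
    ring
  rw [e, re_sq_add_im_sq h₂, sub_neg]
  exact inner_lt_one h₁ h₂ hne

/-- A line meets the unit circle in at most two points. -/
theorem eq_or_eq_of_chordForm_eq (h₁ : ‖ζ₁‖ = 1) (h₂ : ‖ζ₂‖ = 1) (hne : ζ₁ ≠ ζ₂) {z : ℂ}
    (hz : ‖z‖ = 1) (h : chordForm ζ₁ ζ₂ z = chordForm ζ₁ ζ₂ ζ₁) : z = ζ₁ ∨ z = ζ₂ := by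
  have h3 : 0 < Complex.normSq (ζ₂ - ζ₁) := Complex.normSq_pos.2 (sub_ne_zero.2 hne.symm)
  rw [Complex.normSq_apply, Complex.sub_re, Complex.sub_im] at h3
  have e1 := re_sq_add_im_sq h₁
  have e2 := re_sq_add_im_sq h₂
  have e := re_sq_add_im_sq hz
  rw [chordForm_apply, chordForm_apply] at h
  -- `z = ζ₁ + τ (ζ₂ - ζ₁)`
  obtain ⟨τ, hτ⟩ : ∃ τ, τ * ((ζ₂.re - ζ₁.re) * (ζ₂.re - ζ₁.re) +
      (ζ₂.im - ζ₁.im) * (ζ₂.im - ζ₁.im)) = (z.re - ζ₁.re) * (ζ₂.re - ζ₁.re) +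
      (z.im - ζ₁.im) * (ζ₂.im - ζ₁.im) := ⟨_, div_mul_cancel₀ _ h3.ne'⟩
  have hre : z.re = ζ₁.re + τ * (ζ₂.re - ζ₁.re) := by
    refine mul_right_cancel₀ h3.ne' ?_
    linear_combination (ζ₂.im - ζ₁.im) * h - (ζ₂.re - ζ₁.re) * hτ
  have him : z.im = ζ₁.im + τ * (ζ₂.im - ζ₁.im) := by
    refine mul_right_cancel₀ h3.ne' ?_
    linear_combination -(ζ₂.re - ζ₁.re) * h - (ζ₂.im - ζ₁.im) * hτ
  have h4 : τ * (τ - 1) = 0 := by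
    refine (mul_eq_zero.1 (?_ : τ * (τ - 1) * ((ζ₂.re - ζ₁.re) * (ζ₂.re - ζ₁.re) +
      (ζ₂.im - ζ₁.im) * (ζ₂.im - ζ₁.im)) = 0)).resolve_right h3.ne'
    rw [hre, him] at e
    linear_combination e - (1 - τ) * e1 - τ * e2
  rcases mul_eq_zero.1 h4 with h5 | h5
  · left
    apply Complex.ext <;> simp [hre, him, h5]
  · right
    have : τ = 1 := by linarith
    apply Complex.ext <;> simp [hre, him, this]

end

open Classical in
/-- The indicator function of one side of a line which meets the unit circle in punctures. -/
theorem isBoundaryValue_indicator (E : S.Ends) {μ : ℂ →L[ℝ] ℝ} {a : ℝ}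
    (hne : ∀ z ∈ S.boundary, μ z ≠ a) :
    E.IsBoundaryValue fun z => if a < μ z then 1 else 0 where
  eventually_eq z hz := by
    rcases lt_or_gt_of_ne (hne z hz) with h | h
    · filter_upwards [μ.continuous.continuousAt.eventually (gt_mem_nhds h)] with w hw _
      rw [if_neg hw.not_gt, if_neg h.not_gt]
    · filter_upwards [μ.continuous.continuousAt.eventually (lt_mem_nhds h)] with w hw _
      rw [if_pos hw, if_pos h]
  side_eq ζ s t hs ht := by
    have : a < μ (E.chart ζ (s, t)) ↔ a < μ (E.chart ζ (0, t)) :=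
      ⟨E.side_lt ζ hne ht hs le_rfl, E.side_lt ζ hne ht le_rfl hs⟩
    simp only [this]

/-- The weak profile at a positive puncture `ζ₁`, obtained from the indicator function of the arc going
counterclockwise from `ζ₁` to a negative puncture `ζ₂`. -/
theorem exists_isWeakProfile_of_pos (E : S.Ends) {ζ₁ ζ₂ : S.punctures} (h₁ : (ζ₁ : ℂ) ∉ S.neg)
    (h₂ : (ζ₂ : ℂ) ∈ S.neg) :
    ∃ γ j, E.IsWeakProfile γ j ∧ (∀ ζ, 0 ≤ j ζ) ∧ 0 < j ζ₁ := by
  classical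
  have hne : ζ₁ ≠ ζ₂ := fun h => h₁ (h ▸ h₂)
  have hne' : (ζ₁ : ℂ) ≠ ζ₂ := Subtype.coe_injective.ne hne
  have hn₁ := norm_of_mem_punctures ζ₁.2
  have hn₂ := norm_of_mem_punctures ζ₂.2
  set μ := chordForm (ζ₁ : ℂ) ζ₂ with hμ
  set a := μ ζ₁ with ha
  have hcirc : ∀ z : ℂ, ‖z‖ = 1 → μ z = a → z = ζ₁ ∨ z = ζ₂ := fun z hz h =>
    eq_or_eq_of_chordForm_eq hn₁ hn₂ hne' hz h
  have hbd : ∀ z ∈ S.boundary, μ z ≠ a := fun z hz h => by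
    rcases hcirc z (mem_sphere_zero_iff_norm.1 hz.1) h with rfl | rfl
    · exact hz.2 ζ₁.2
    · exact hz.2 ζ₂.2
  have hbd' : ∀ z ∈ S.boundary, (-μ) z ≠ -a := fun z hz h => hbd z hz (neg_injective h)
  obtain ⟨γ, hγ⟩ := (E.isBoundaryValue_indicator hbd).exists_isWeakProfile
  have hpos₁ := chordForm_I_mul_left_pos hn₁ hn₂ hne'
  have hneg₂ := chordForm_I_mul_right_neg hn₁ hn₂ hne'
  have h10 : a < μ (E.chart ζ₁ (0, 0)) :=
    E.lt_side ζ₁ hbd rfl (Or.inl rfl) (by simpa using hpos₁) le_rfl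
  have h11 : ¬a < μ (E.chart ζ₁ (0, 1)) := by
    have := E.lt_side ζ₁ (μ := -μ) (a := -a) hbd' rfl (Or.inr rfl)
      (by rw [neg_apply]; linarith) le_rfl
    rw [neg_apply, neg_lt_neg_iff] at this
    exact this.not_gt
  have h20 : ¬a < μ (E.chart ζ₂ (0, 0)) := by
    have := E.lt_side ζ₂ (μ := -μ) (a := -a) hbd'
      (by rw [neg_apply, hμ, chordForm_right]) (Or.inl rfl) (by rw [neg_apply]; linarith) le_rfl
    rw [neg_apply, neg_lt_neg_iff] at this
    exact this.not_gt
  have h21 : a < μ (E.chart ζ₂ (0, 1)) :=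
    E.lt_side ζ₂ hbd (chordForm_right _ _) (Or.inr rfl) (by linarith) le_rfl
  have hj₁ : E.sign ζ₁ * ((if a < μ (E.chart ζ₁ (0, 1)) then (1 : ℝ) else 0) -
      if a < μ (E.chart ζ₁ (0, 0)) then 1 else 0) = 1 := by
    rw [if_pos h10, if_neg h11, sign, if_neg h₁]
    norm_num
  refine ⟨γ, _, hγ, fun ζ => ?_, ?_⟩
  · by_cases hζ₁ : ζ = ζ₁
    · subst hζ₁
      exact hj₁.symm ▸ zero_le_one
    by_cases hζ₂ : ζ = ζ₂
    · subst hζ₂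
      simp only [if_pos h21, if_neg h20, sign, if_pos h₂]
      norm_num
    -- at the other punctures, both sides of the end lie on the same side of the line
    have hζ : μ ζ ≠ a := fun h => (hcirc ζ (norm_of_mem_punctures ζ.2) h).elim
      (fun h => hζ₁ (Subtype.ext h)) fun h => hζ₂ (Subtype.ext h)
    have hlim : ∀ t : ℝ, t = 0 ∨ t = 1 →
        Tendsto (fun s => μ (E.chart ζ (s, t))) atBot (𝓝 (μ ζ)) := fun t ht =>
      (μ.continuous.tendsto _).comp ((E.isEnd_chart ζ).tendsto t (side_mem_strip le_rfl ht).2)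
    have hiff : ∀ t : ℝ, t = 0 ∨ t = 1 → (a < μ (E.chart ζ (0, t)) ↔ a < μ ζ) := by
      intro t ht
      rcases lt_or_gt_of_ne hζ with h | h
      · obtain ⟨s, hs, hs0⟩ := (((hlim t ht).eventually (gt_mem_nhds h)).and
          (eventually_le_atBot 0)).exists
        exact iff_of_false (fun h' => (E.side_lt ζ hbd ht le_rfl hs0 h').not_gt hs) h.not_gt
      · obtain ⟨s, hs, hs0⟩ := (((hlim t ht).eventually (lt_mem_nhds h)).and
          (eventually_le_atBot 0)).exists
        exact iff_of_true (E.side_lt ζ hbd ht hs0 le_rfl hs) h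
    simp only [hiff 0 (Or.inl rfl), hiff 1 (Or.inr rfl), sub_self, mul_zero, le_refl]
  · exact hj₁.symm ▸ zero_lt_one

/-- Existence of a profile: the positive ends are paired with a negative one, which absorbs their flux,
and each negative end carries a form whose flux disappears just past the end. -/
theorem exists_isProfile (E : S.Ends) (hneg : S.neg.Nonempty) : ∃ γ, E.IsProfile γ := by
  classical
  obtain ⟨ζ₂, h₂⟩ := hneg
  refine exists_isProfile_of_weak fun ζ => ?_
  by_cases hζ : (ζ : ℂ) ∈ S.neg
  · obtain ⟨f, r, h⟩ := E.exists_isExtendedChart ζ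
    refine ⟨_, _, h.isWeakProfile_sinkForm hζ, fun ζ' => ?_, by simp⟩
    by_cases hζ' : ζ' = ζ
    · subst hζ'
      simp
    · simp [hζ']
  · exact E.exists_isWeakProfile_of_pos hζ (ζ₂ := ⟨ζ₂, Or.inl h₂⟩) h₂

end Ends

end PuncturedDisc

end

theorem lemma6p3 (S : PuncturedDisc) (E : S.Ends) :
    (S.neg = ∅ → IsEmpty E.connections) ∧
      (S.neg.Nonempty → WeaklyContractible E.connections) := by
  refine ⟨fun h => not_nonempty_iff.1 fun hne => ?_, fun h =>
    E.weaklyContractible_connections (E.nonempty_connections_iff.2 (E.exists_isProfile h))⟩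
  obtain ⟨γ, hγ⟩ := E.nonempty_connections_iff.1 hne
  exact E.not_isProfile h γ hγ
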